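/- **Setting.** Let $d\ge 0$, $n,m\ge 1$, and let $f_{ij}:\mathbb R^d\to\mathbb R$ ($i\in[n]$, $j\in[m]$) be convex and $L$-smooth ($L>0$: differentiable with $L$-Lipschitz gradient). Put $f_i=\frac1m\sum_j f_{ij}$ and $f=\frac1n\sum_i f_i$, let $x^*$ be a minimizer of $f$, and assume that $f$ is $\mu$-quasi strongly convex, $\mu\ge0$: $f(x^*)\ge f(x)+\langle\nabla f(x),x^*-x\rangle+\frac\mu2\|x-x^*\|^2$ for all $x$. Let $\mathcal C$ be a (possibly randomized) operator on $\mathbb R^d$ with $\mathbf E\|\mathcal C(x)-x\|^2\le(1-\delta)\|x\|^2$ for all $x$, where $\delta\in(0,1]$, and $\mathcal Q$ a randomized operator with $\mathbf E\mathcal Q(x)=x$ and $\mathbf E\|\mathcal Q(x)-x\|^2\le\omega\|x\|^2$ for all $x$, where $\omega\ge0$. **Method (EC-LSVRG-DIANA).** Fix $\gamma>0$, $\alpha,p\in(0,1)$ and initial vectors $x^0,h_i^0,w_i^0\in\mathbb R^d$, $e_i^0=0$. For $k=0,1,\dots$, with $h^k=\frac1n\sum_i h_i^k$, each worker $i$ draws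 $l$ uniformly from $[m]$ and sets $$\hat g_i^k=\nabla f_{il}(x^k)-\nabla f_{il}(w_i^k)+\nabla f_i(w_i^k),\quad g_i^k=\hat g_i^k-h_i^k+h^k,\quad v_i^k=\mathcal C(e_i^k+\gamma g_i^k),$$ $$e_i^{k+1}=e_i^k+\gamma g_i^k-v_i^k,\quad h_i^{k+1}=h_i^k+\alpha\,\mathcal Q(\hat g_i^k-h_i^k),\quad w_i^{k+1}=x^k\text{ with probability }p,\ w_i^{k+1}=w_i^k\text{ otherwise},$$ and $x^{k+1}=x^k-\frac1n\sum_i v_i^k$; all random choices (indices, coins, randomness of $\mathcal C$ and of $\mathcal Q$, over all workers and iterations) are independent. Write $g^k=\frac1n\sum_ig_i^k$, $e^k=\frac1n\sum_ie_i^k$, let $\mathbf E_k$ be the conditional expectation given all random choices made before iteration $k$, $\bar g_i^k=\mathbf E_k[g_i^k]$, and $$\sigma_{1,k}^2=\tfrac1n\sum_i\|h_i^k-\nabla f_i(x^*)\|^2,\qquad \sigma_{2,k}^2=\tfrac1{nm}\sum_{i,j}\|\nabla f_{ij}(w_i^k)-\nabla f_{ij}(x^*)\|^2,$$ $$\eta=\min\{\tfrac{\gamma\mu}2,\tfrac\alpha4,\tfrac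 p4\},\quad w_k=(1-\eta)^{-(k+1)},\quad W_K=\sum_{k=0}^Kw_k,\quad \bar x^K=\tfrac1{W_K}\sum_{k=0}^Kw_kx^k.$$ **Theorem.** Assume $\alpha\le\frac1{\omega+1}$ and $$0<\gamma\le\gamma_{\max}:=\min\left\{\frac{9}{296L},\ \frac{\delta}{4L\sqrt{6\left(4+3\delta+\frac{2}{1-\alpha}\left(3+\frac4{1-p}\right)(4+3\delta)+\frac{6\delta}{1-p}\right)}}\right\}.$$ (a) The method satisfies the parametric assumption with $A=A'=2L$, $\widetilde A=3L$, $B_1=B_2'=2$, $B_1'=B_2=0$, $\widetilde B_1=\widetilde B_2=3$, $\rho_1=\alpha$, $\rho_2=p$, $C_1=3L\alpha$, $C_2=Lp$, $G=2$, $D_1=\widetilde D_1=D_1'=D_2=0$. That is, for all $k\ge0$, all quantities involved being integrable, almost surely $\mathbf E_k[g^k]=\nabla f(x^k)$ and $$\tfrac1n\sum_i\|\bar g_i^k\|^2\le4L(f(x^k)-f(x^*))+2\sigma_{1,k}^2,$$ $$\tfrac1n\sum_i\mathbf E_k\|g_i^k-\bar g_i^k\|^2\le6L(f(x^k)-f(x^*))+3\sigma_{1,k}^2+3\sigma_{2,k}^2,$$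 $$\mathbf E_k\|g^k\|^2\le4L(f(x^k)-f(x^*))+2\sigma_{2,k}^2,$$ $$\mathbf E_k[\sigma_{1,k+1}^2]\le(1-\alpha)\sigma_{1,k}^2+6L\alpha(f(x^k)-f(x^*))+2\alpha\sigma_{2,k}^2,$$ $$\mathbf E_k[\sigma_{2,k+1}^2]\le(1-p)\sigma_{2,k}^2+2Lp(f(x^k)-f(x^*)).$$ (b) With $D_3=0$ and $$F_1=\frac{24L\gamma^2\left(\frac4\delta+3\right)}{\delta\alpha(1-\eta)},\qquad F_2=\frac{24L\gamma^2\left(\frac4{1-\alpha}\left(\frac4\delta+3\right)+3\right)}{\delta p(1-\eta)},$$ one has for all $K\ge0$ $$3L\sum_{k=0}^Kw_k\mathbf E\|e^k\|^2\le\tfrac14\sum_{k=0}^Kw_k\mathbf E[f(x^k)-f(x^*)]+F_1\sigma_{1,0}^2+F_2\sigma_{2,0}^2.$$ (c) Let $M_2=\frac8{3p}+\frac{32}{9p}$, $T^0=\|x^0-x^*\|^2+M_2\gamma^2\sigma_{2,0}^2$ and $C_0=\frac4\gamma\left(T^0+\gamma F_1\sigma_{1,0}^2+\gamma F_2\sigma_{2,0}^2\right)$.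 If $\mu>0$, then for all $K\ge0$ $$\mathbf E[f(\bar x^K)-f(x^*)]\le\left(1-\min\{\tfrac{\gamma\mu}2,\tfrac\alpha4,\tfrac p4\}\right)^KC_0,$$ and if $\mu=0$, then $\mathbf E[f(\bar x^K)-f(x^*)]\le C_0/K$ for all $K\ge1$. (d) There is an absolute constant $c>0$ such that, whenever $\mu>0$, $m\ge2$, $p=\frac1m$, $\alpha=\min\{\frac1{\omega+1},\frac12\}$, $\gamma=\gamma_{\max}$ and $\kappa=L/\mu$: for every $\varepsilon>0$, $\mathbf E[f(\bar x^K)-f(x^*)]\le\varepsilon$ for all $K\ge c\left(\omega+m+\frac\kappa\delta\right)\ln\frac{C_0}\varepsilon$; and for all sufficiently small $\varepsilon>0$ (how small may depend on the problem and on the initial vectors) the same holds for all $K\ge c\left(\omega+m+\frac\kappa\delta\right)\ln\frac1\varepsilon$. That is, the iteration complexity is $O\left(\left(\omega+m+\frac\kappa\delta\right)\ln\frac1\varepsilon\right)$. -/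

import Mathlib

open MeasureTheory ProbabilityTheory

noncomputable section

namespace ECLSVRGDiana

/-- The space `ℝᵈ` with the Euclidean norm. -/
abbrev Vec (d : ℕ) := EuclideanSpace ℝ (Fin d)

/-- `f` is differentiable and its gradient is `L`-Lipschitz. -/
def IsLSmooth {d : ℕ} (L : ℝ) (f : Vec d → ℝ) : Prop :=
  Differentiable ℝ f ∧ ∀ x y, ‖gradient f x - gradient f y‖ ≤ L * ‖x - y‖

/-- `f` is `μ`-quasi strongly convex with respect to its minimizer `xs`. -/
structure IsQuasiStronglyConvex {d : ℕ} (μ : ℝ) (f : Vec d → ℝ) (xs : Vec d) : Prop where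
  isMin : ∀ x, f xs ≤ f x
  ineq : ∀ x, f x + inner ℝ (gradient f x) (xs - x) + μ / 2 * ‖x - xs‖ ^ 2 ≤ f xs

/-- A randomized operator `x ↦ C s x`, with random seed `s` of law `ν`, that contracts on average:
`E‖C(x) - x‖² ≤ (1 - δ)‖x‖²`. -/
structure IsCompressor {d : ℕ} {S : Type*} [MeasurableSpace S] (ν : Measure S) (δ : ℝ)
    (C : S → Vec d → Vec d) : Prop where
  measurable : Measurable (fun z : S × Vec d => C z.1 z.2)
  integrable : ∀ x, Integrable (fun s => ‖C s x - x‖ ^ 2) ν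
  contraction : ∀ x, ∫ s, ‖C s x - x‖ ^ 2 ∂ν ≤ (1 - δ) * ‖x‖ ^ 2

/-- A randomized operator `x ↦ Q s x`, with random seed `s` of law `ν`, that is unbiased and
satisfies `E‖Q(x) - x‖² ≤ ω‖x‖²`. -/
structure IsQuantizer {d : ℕ} {S : Type*} [MeasurableSpace S] (ν : Measure S) (ω : ℝ)
    (Q : S → Vec d → Vec d) : Prop where
  measurable : Measurable (fun z : S × Vec d => Q z.1 z.2)
  integrable : ∀ x, Integrable (fun s => Q s x) ν
  integrable_sq : ∀ x, Integrable (fun s => ‖Q s x - x‖ ^ 2) ν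
  unbiased : ∀ x, ∫ s, Q s x ∂ν = x
  variance : ∀ x, ∫ s, ‖Q s x - x‖ ^ 2 ∂ν ≤ ω * ‖x‖ ^ 2

/-! ### The finite-sum problem -/

/-- `f_i = (1/m) ∑_j f_{ij}`. -/
def localLoss {d n m : ℕ} (F : Fin n → Fin m → Vec d → ℝ) (i : Fin n) (x : Vec d) : ℝ :=
  (1 / (m : ℝ)) * ∑ j, F i j x

/-- `f = (1/n) ∑_i f_i`. -/
def loss {d n m : ℕ} (F : Fin n → Fin m → Vec d → ℝ) (x : Vec d) : ℝ :=
  (1 / (n : ℝ)) * ∑ i, localLoss F i x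

/-- The average of the `n` vectors held by the workers. -/
def avg {d n : ℕ} (v : Fin n → Vec d) : Vec d := (1 / (n : ℝ)) • ∑ i, v i

/-! ### Randomness -/

/-- What one worker draws in one iteration: the index of a summand, the coin deciding whether its
reference point is refreshed, the seed of its compressor, the seed of its quantizer. -/
abbrev Noise (m : ℕ) (S T : Type*) := Fin m × Bool × S × T

/-- The law of a coin that is `true` with probability `p`. -/
def coin (p : ℝ) : Measure Bool :=
  ENNReal.ofReal p • Measure.dirac true + ENNReal.ofReal (1 - p) • Measure.dirac false

/-- The draws of all workers in all iterations are independent. Each draw consists of a uniform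
index, a `p`-coin and the two seeds, independent of each other. -/
structure IsNoise {n m : ℕ} {S T Ω : Type*} [MeasurableSpace S] [MeasurableSpace T]
    [MeasurableSpace Ω] (P : Measure Ω) (p : ℝ) (νC : Measure S) (νQ : Measure T)
    (ξ : ℕ → Fin n → Ω → Noise m S T) : Prop where
  measurable : ∀ k i, Measurable (ξ k i)
  law : ∀ k i, P.map (ξ k i) =
    (uniformOn (Set.univ : Set (Fin m))).prod ((coin p).prod (νC.prod νQ))
  indep : iIndepFun (fun a : ℕ × Fin n => ξ a.1 a.2) P

/-- The σ-algebra generated by all draws made before iteration `k`. -/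
abbrev history {n m : ℕ} {S T Ω : Type*} [MeasurableSpace S] [MeasurableSpace T]
    (ξ : ℕ → Fin n → Ω → Noise m S T) (k : ℕ) : MeasurableSpace Ω :=
  ⨆ j : Fin k, ⨆ i : Fin n, MeasurableSpace.comap (ξ j i) inferInstance

/-! ### The method EC-LSVRG-DIANA -/

/-- The iterate `x`, the errors `e_i`, the shifts `h_i` and the reference points `w_i`. -/
structure State (d n : ℕ) where
  x : Vec d
  e : Fin n → Vec d
  h : Fin n → Vec d
  w : Fin n → Vec d

/-- `ĝ_i = ∇f_{il}(x) - ∇f_{il}(w_i) + ∇f_i(w_i)`, where `l` is the index drawn. -/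
def gHat {d n m : ℕ} (F : Fin n → Fin m → Vec d → ℝ) (s : State d n) (i : Fin n) (l : Fin m) :
    Vec d :=
  gradient (F i l) s.x - gradient (F i l) (s.w i) + gradient (localLoss F i) (s.w i)

/-- `g_i = ĝ_i - h_i + h`, where `h` is the average of the `h_i`. -/
def gLoc {d n m : ℕ} (F : Fin n → Fin m → Vec d → ℝ) (s : State d n) (i : Fin n) (l : Fin m) :
    Vec d :=
  gHat F s i l - s.h i + avg s.h

/-- `v_i = C(e_i + γ g_i)`. -/
def vLoc {d n m : ℕ} {S T : Type*} (F : Fin n → Fin m → Vec d → ℝ) (C : S → Vec d → Vec d)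
    (γ : ℝ) (s : State d n) (z : Fin n → Noise m S T) (i : Fin n) : Vec d :=
  C (z i).2.2.1 (s.e i + γ • gLoc F s i (z i).1)

/-- One iteration of the method. -/
def step {d n m : ℕ} {S T : Type*} (F : Fin n → Fin m → Vec d → ℝ) (C : S → Vec d → Vec d)
    (Q : T → Vec d → Vec d) (γ α : ℝ) (s : State d n) (z : Fin n → Noise m S T) : State d n where
  x := s.x - avg (vLoc F C γ s z)
  e := fun i => s.e i + γ • gLoc F s i (z i).1 - vLoc F C γ s z i
  h := fun i => s.h i + α • Q (z i).2.2.2 (gHat F s i (z i).1 - s.h i)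
  w := fun i => if (z i).2.1 = true then s.x else s.w i

/-- The trajectory of the method started at `x⁰`, `h_i⁰`, `w_i⁰` and `e_i⁰ = 0`. -/
def run {d n m : ℕ} {S T Ω : Type*} (F : Fin n → Fin m → Vec d → ℝ) (C : S → Vec d → Vec d)
    (Q : T → Vec d → Vec d) (γ α : ℝ) (x0 : Vec d) (h0 w0 : Fin n → Vec d)
    (ξ : ℕ → Fin n → Ω → Noise m S T) : ℕ → Ω → State d n
  | 0, _ => ⟨x0, fun _ => 0, h0, w0⟩
  | k + 1, ω => step F C Q γ α (run F C Q γ α x0 h0 w0 ξ k ω) (fun i => ξ k i ω)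

/-- `σ₁² = (1/n) ∑_i ‖h_i - ∇f_i(x*)‖²`. -/
def sigma1Sq {d n m : ℕ} (F : Fin n → Fin m → Vec d → ℝ) (xs : Vec d) (h : Fin n → Vec d) : ℝ :=
  (1 / (n : ℝ)) * ∑ i, ‖h i - gradient (localLoss F i) xs‖ ^ 2

/-- `σ₂² = (1/(nm)) ∑_i ∑_j ‖∇f_{ij}(w_i) - ∇f_{ij}(x*)‖²`. -/
def sigma2Sq {d n m : ℕ} (F : Fin n → Fin m → Vec d → ℝ) (xs : Vec d) (w : Fin n → Vec d) : ℝ :=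
  (1 / ((n : ℝ) * (m : ℝ))) * ∑ i, ∑ j, ‖gradient (F i j) (w i) - gradient (F i j) xs‖ ^ 2

/-! ### The parametric assumption on error-feedback methods -/

/-- The constants of the parametric assumption; a trailing `t` stands for a tilde and a trailing
`p` for a prime. -/
structure Params where
  (A At Ap B1 B2 B1t B2t B1p B2p C1 C2 G D1 D1t D1p D2 D3 ρ1 ρ2 F1 F2 : ℝ)

/-- `η = min {γμ/2, ρ₁/4, ρ₂/4}`. -/
def eta (γ μ ρ1 ρ2 : ℝ) : ℝ := min (γ * μ / 2) (min (ρ1 / 4) (ρ2 / 4))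

/-- `w_k = (1 - η)^{-(k+1)}`. -/
def weight (η : ℝ) (k : ℕ) : ℝ := ((1 - η) ^ (k + 1))⁻¹

/-- `W_K = ∑_{k ≤ K} w_k`. -/
def weightSum (η : ℝ) (K : ℕ) : ℝ := ∑ k ∈ Finset.range (K + 1), weight η k

/-- `x̄ᴷ = (1/W_K) ∑_{k ≤ K} w_k xᵏ`. -/
def weightedAvg {d : ℕ} {Ω : Type*} (η : ℝ) (x : ℕ → Ω → Vec d) (K : ℕ) (ω : Ω) : Vec d :=
  (weightSum η K)⁻¹ • ∑ k ∈ Finset.range (K + 1), weight η k • x k ω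

/-- The parametric assumption on the iterates `x`, the stochastic gradients `g_i` (with average
`g`) and the sequences `s1 = σ₁²`, `s2 = σ₂²`. The σ-algebra `ℱ k` is the information available at
the start of iteration `k`; `E[ · ∣ xᵏ]` is the conditional expectation given `ℱ k`. -/
structure ParametricAssumption {d n : ℕ} {Ω : Type*} [MeasurableSpace Ω] (P : Measure Ω)
    (ℱ : ℕ → MeasurableSpace Ω) (f : Vec d → ℝ) (xs : Vec d) (x : ℕ → Ω → Vec d)
    (g : ℕ → Fin n → Ω → Vec d) (s1 s2 : ℕ → Ω → ℝ) (c : Params) : Prop where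
  nonneg : 0 ≤ c.A ∧ 0 ≤ c.At ∧ 0 ≤ c.Ap ∧ 0 ≤ c.B1 ∧ 0 ≤ c.B2 ∧ 0 ≤ c.B1t ∧ 0 ≤ c.B2t ∧
    0 ≤ c.B1p ∧ 0 ≤ c.B2p ∧ 0 ≤ c.C1 ∧ 0 ≤ c.C2 ∧ 0 ≤ c.G ∧ 0 ≤ c.D1 ∧ 0 ≤ c.D1t ∧ 0 ≤ c.D1p ∧
    0 ≤ c.D2 ∧ 0 ≤ c.D3
  rho1_mem : c.ρ1 ∈ Set.Icc (0 : ℝ) 1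
  rho2_mem : c.ρ2 ∈ Set.Icc (0 : ℝ) 1
  x_known : ∀ k, StronglyMeasurable[ℱ k] (x k)
  s1_known : ∀ k, StronglyMeasurable[ℱ k] (s1 k)
  s2_known : ∀ k, StronglyMeasurable[ℱ k] (s2 k)
  s1_integrable : ∀ k, Integrable (s1 k) P
  s2_integrable : ∀ k, Integrable (s2 k) P
  f_integrable : ∀ k, Integrable (fun ω => f (x k ω)) P
  g_memLp : ∀ k i, MemLp (g k i) 2 P
  unbiased : ∀ k, P[fun ω => avg (fun i => g k i ω) | ℱ k] =ᵐ[P] fun ω => gradient f (x k ω)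
  mean_bound : ∀ k, ∀ᵐ ω ∂P, (1 / (n : ℝ)) * ∑ i, ‖(P[g k i | ℱ k]) ω‖ ^ 2 ≤
    2 * c.A * (f (x k ω) - f xs) + c.B1 * s1 k ω + c.B2 * s2 k ω + c.D1
  variance_bound : ∀ k, ∀ᵐ ω ∂P,
    (1 / (n : ℝ)) * ∑ i, (P[fun ω' => ‖g k i ω' - (P[g k i | ℱ k]) ω'‖ ^ 2 | ℱ k]) ω ≤
    2 * c.At * (f (x k ω) - f xs) + c.B1t * s1 k ω + c.B2t * s2 k ω + c.D1t
  second_moment : ∀ k, ∀ᵐ ω ∂P, (P[fun ω' => ‖avg (fun i => g k i ω')‖ ^ 2 | ℱ k]) ω ≤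
    2 * c.Ap * (f (x k ω) - f xs) + c.B1p * s1 k ω + c.B2p * s2 k ω + c.D1p
  s1_step : ∀ k, ∀ᵐ ω ∂P, (P[s1 (k + 1) | ℱ k]) ω ≤
    (1 - c.ρ1) * s1 k ω + 2 * c.C1 * (f (x k ω) - f xs) + c.G * c.ρ1 * s2 k ω + c.D2
  s2_step : ∀ k, ∀ᵐ ω ∂P, (P[s2 (k + 1) | ℱ k]) ω ≤
    (1 - c.ρ2) * s2 k ω + 2 * c.C2 * (f (x k ω) - f xs)

/-- The bound on the weighted sum of the squared averaged errors `eᵏ`: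
`3L ∑_{k≤K} w_k E‖eᵏ‖² ≤ ¼ ∑_{k≤K} w_k E[f(xᵏ) - f(x*)] + F₁ σ₁,₀² + F₂ σ₂,₀² + γ D₃ W_K`. -/
def ErrorSumBound {d : ℕ} {Ω : Type*} [MeasurableSpace Ω] (P : Measure Ω) (f : Vec d → ℝ)
    (xs : Vec d) (x e : ℕ → Ω → Vec d) (s1 s2 : ℕ → Ω → ℝ) (L μ γ : ℝ) (c : Params) : Prop :=
  0 ≤ c.F1 ∧ 0 ≤ c.F2 ∧ (∀ k, MemLp (e k) 2 P) ∧
  ∀ K : ℕ,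
    3 * L * ∑ k ∈ Finset.range (K + 1), weight (eta γ μ c.ρ1 c.ρ2) k * ∫ ω, ‖e k ω‖ ^ 2 ∂P ≤
      1 / 4 * ∑ k ∈ Finset.range (K + 1),
        weight (eta γ μ c.ρ1 c.ρ2) k * ∫ ω, (f (x k ω) - f xs) ∂P
      + c.F1 * ∫ ω, s1 0 ω ∂P + c.F2 * ∫ ω, s2 0 ω ∂P
      + γ * c.D3 * weightSum (eta γ μ c.ρ1 c.ρ2) K

/-! ### The constants for EC-LSVRG-DIANA -/

def F1 (L μ γ δ α p : ℝ) : ℝ :=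
  24 * L * γ ^ 2 * (4 / δ + 3) / (δ * α * (1 - eta γ μ α p))

def F2 (L μ γ δ α p : ℝ) : ℝ :=
  24 * L * γ ^ 2 * (4 / (1 - α) * (4 / δ + 3) + 3) / (δ * p * (1 - eta γ μ α p))

def params (L μ γ δ α p : ℝ) : Params where
  A := 2 * L
  At := 3 * L
  Ap := 2 * L
  B1 := 2
  B2 := 0
  B1t := 3
  B2t := 3
  B1p := 0
  B2p := 2
  C1 := 3 * L * α
  C2 := L * p
  G := 2
  D1 := 0
  D1t := 0
  D1p := 0
  D2 := 0
  D3 := 0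
  ρ1 := α
  ρ2 := p
  F1 := F1 L μ γ δ α p
  F2 := F2 L μ γ δ α p

/-- The largest admissible stepsize. -/
def gammaMax (L δ α p : ℝ) : ℝ :=
  min (9 / (296 * L))
    (δ / (4 * L * √(6 * (4 + 3 * δ + 2 / (1 - α) * (3 + 4 / (1 - p)) * (4 + 3 * δ)
      + 6 * δ / (1 - p)))))

/-- `T⁰ = ‖x⁰ - x*‖² + M₂ γ² σ₂,₀²` with `M₂ = 8/(3p) + 32/(9p)`. -/
def T0 {d : ℕ} (γ p : ℝ) (x0 xs : Vec d) (s20 : ℝ) : ℝ :=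
  ‖x0 - xs‖ ^ 2 + (8 / (3 * p) + 32 / (9 * p)) * γ ^ 2 * s20

/-- `4 (T⁰ + γ F₁ σ₁,₀² + γ F₂ σ₂,₀²) / γ`. -/
def initConst {d : ℕ} (L μ γ δ α p : ℝ) (x0 xs : Vec d) (s10 s20 : ℝ) : ℝ :=
  4 * (T0 γ p x0 xs s20 + γ * F1 L μ γ δ α p * s10 + γ * F2 L μ γ δ α p * s20) / γ

end ECLSVRGDiana

end

noncomputable section

namespace ECLSVRGDiana

/-! ### Smooth convex functions -/

section Smooth

variable {d : ℕ} {L : ℝ} {f : Vec d → ℝ}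

/-! The proof follows the virtual iterate `x̃ = x - e`, where `e` is the average error. What the
compressor discards in `x` is stored in `e`, so `x̃` performs an exact stochastic gradient step `x̃
- γ g` (`step_x_sub_avg_e`), and `g` is conditionally unbiased for `∇f(x)`. Expanding `‖x̃ - x*‖²`,
quasi strong convexity at `x` yields contraction and a decrease by the function gap; evaluating the
gradient at `x` instead of `x̃` costs `3L‖e‖²` (`IsProblem.perturbed_descent`). The second moment of
`g` involves only the gap and `σ₂²`, so adding a multiple of `γ² σ₂²` gives a Lyapunov function
(`lyapunov_step`).

The squared errors remain to be bounded. Three quantities contract in a chain: `σ₂²` at rate `p`,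
fed by the gap; `σ₁²` at rate `α`, fed by the gap and `σ₂²`; the mean of `‖e_i‖²` at rate `δ/2`, fed
by all of these times `γ²`. The weights `w_k` grow more slowly than each of the three contracts, so
each recursion can be summed against them (`weighted_sum_le_of_contraction`), and the three sums are
substituted into one another (`error_sum_arith`). The bound on `γ` makes the resulting coefficient
of the gap at most `1/4`, while the descent provides `1/2`. What is left bounds the weighted sum of
gaps by `C₀`, and Jensen's inequality turns this into the rate.

The one-step bounds rest on co-coercivity of the gradients of the `f_ij` at `x*`
(`IsProblem.mean_gradient_sub_sq_le`), on `∇f(x*) = 0`, which removes linear terms and centres the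
shifts, and on the fact that a variance is at most a second moment. They are first proved at a
frozen state, as finite averages over the drawn index. They become conditional expectations because
the state is determined by the history and the new draw is independent of it
(`condExp_comp_prodMk`). Every expression is an average over workers of functions of a single draw,
so one draw is integrated out at a time. -/

lemma IsLSmooth.hasDerivAt_line (hf : IsLSmooth L f) (x v : Vec d) (t : ℝ) :
    HasDerivAt (fun t : ℝ => f (x + t • v)) (inner ℝ (gradient f (x + t • v)) v) t := by
  have h1 : HasDerivAt (fun t : ℝ => x + t • v) v t := by
    simpa using ((hasDerivAt_id t).smul_const v).const_add x
  have h2 := (hf.1 (x + t • v)).hasFDerivAt.comp_hasDerivAt t h1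
  rwa [inner_gradient_left]

/-- Along the segment from `x` to `y` both sides are functions of `t` that agree at `t = 0`, and the
Lipschitz bound compares their derivatives. -/
lemma IsLSmooth.le_quadratic (hf : IsLSmooth L f) (x y : Vec d) :
    f y ≤ f x + inner ℝ (gradient f x) (y - x) + L / 2 * ‖y - x‖ ^ 2 := by
  set v := y - x with hv
  have hB : ∀ t : ℝ, HasDerivAt
      (fun t : ℝ => f x + t * inner ℝ (gradient f x) v + L / 2 * t ^ 2 * ‖v‖ ^ 2)
      (inner ℝ (gradient f x) v + L * t * ‖v‖ ^ 2) t := by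
    intro t
    have h1 := ((hasDerivAt_id t).mul_const (inner ℝ (gradient f x) v)).const_add (f x)
    have h2 := (((hasDerivAt_pow 2 t).const_mul (L / 2)).mul_const (‖v‖ ^ 2))
    refine (h1.add h2).congr_deriv ?_
    push_cast
    ring
  have key := image_le_of_deriv_right_le_deriv_boundary (a := 0) (b := 1)
    (f := fun t : ℝ => f (x + t • v)) (f' := fun t => inner ℝ (gradient f (x + t • v)) v)
    (fun t _ => (hf.hasDerivAt_line x v t).continuousAt.continuousWithinAt)
    (fun t _ => (hf.hasDerivAt_line x v t).hasDerivWithinAt)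
    (B := fun t : ℝ => f x + t * inner ℝ (gradient f x) v + L / 2 * t ^ 2 * ‖v‖ ^ 2)
    (B' := fun t => inner ℝ (gradient f x) v + L * t * ‖v‖ ^ 2)
    (by simp) (fun t _ => (hB t).continuousAt.continuousWithinAt)
    (fun t _ => (hB t).hasDerivWithinAt) (fun t ht => by
      have h1 : inner ℝ (gradient f (x + t • v)) v
          = inner ℝ (gradient f x) v + inner ℝ (gradient f (x + t • v) - gradient f x) v := by
        rw [inner_sub_left]; ring
      have h2 := real_inner_le_norm (gradient f (x + t • v) - gradient f x) v
      have h3 := hf.2 (x + t • v) x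
      rw [add_sub_cancel_left, norm_smul, Real.norm_of_nonneg ht.1] at h3
      have h4 := mul_le_mul_of_nonneg_right h3 (norm_nonneg v)
      nlinarith) (x := 1) (by simp)
  simpa [hv] using key

lemma IsLSmooth.add_inner_le (hf : IsLSmooth L f) (hc : ConvexOn ℝ Set.univ f) (x y : Vec d) :
    f x + inner ℝ (gradient f x) (y - x) ≤ f y := by
  have hg : ConvexOn ℝ Set.univ (fun t : ℝ => f (x + t • (y - x))) := by
    refine ⟨convex_univ, fun s _ t _ a b ha hb hab => ?_⟩
    have := hc.2 (Set.mem_univ (x + s • (y - x))) (Set.mem_univ (x + t • (y - x))) ha hb hab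
    convert this using 2
    obtain rfl : b = 1 - a := by linarith
    simp only [smul_eq_mul]
    module
  have := hg.le_slope_of_hasDerivAt (Set.mem_univ 0) (Set.mem_univ 1) one_pos
    (hf.hasDerivAt_line x (y - x) 0)
  simp only [zero_smul, add_zero, slope_def_field, one_smul, add_sub_cancel, sub_zero, div_one]
    at this
  linarith

/-- The value at the point `x - u / L`, with `u` the difference of the gradients, is bounded below
by the tangent plane at `y` and above by the quadratic model at `x`. Comparing the two leaves `‖u‖²
/ (2L)`. -/
lemma IsLSmooth.norm_gradient_sub_sq_le (hL : 0 < L) (hf : IsLSmooth L f)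
    (hc : ConvexOn ℝ Set.univ f) (x y : Vec d) :
    ‖gradient f x - gradient f y‖ ^ 2 ≤
      2 * L * (f x - f y - inner ℝ (gradient f y) (x - y)) := by
  set u := gradient f x - gradient f y with hu
  have h1 := hf.add_inner_le hc y (x - L⁻¹ • u)
  have h2 := hf.le_quadratic x (x - L⁻¹ • u)
  have e1 : x - L⁻¹ • u - y = (x - y) - L⁻¹ • u := by abel
  have e2 : x - L⁻¹ • u - x = -(L⁻¹ • u) := by abel
  rw [e1, inner_sub_right, inner_smul_right] at h1
  rw [e2, inner_neg_right, inner_smul_right, norm_neg, norm_smul,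
    Real.norm_of_nonneg (by positivity)] at h2
  have h3 : inner ℝ (gradient f x) u - inner ℝ (gradient f y) u = ‖u‖ ^ 2 := by
    rw [← inner_sub_left, ← hu, real_inner_self_eq_norm_sq]
  have h4 : L / 2 * (L⁻¹ * ‖u‖) ^ 2 = L⁻¹ / 2 * ‖u‖ ^ 2 := by field_simp
  have h5 : L⁻¹ / 2 * ‖u‖ ^ 2 ≤ f x - f y - inner ℝ (gradient f y) (x - y) := by
    rw [h4] at h2
    have : L⁻¹ * (inner ℝ (gradient f x) u - inner ℝ (gradient f y) u) = L⁻¹ * ‖u‖ ^ 2 := by rw [h3]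
    linarith
  calc ‖u‖ ^ 2 = 2 * L * (L⁻¹ / 2 * ‖u‖ ^ 2) := by field_simp
    _ ≤ _ := by gcongr

lemma gradient_eq_zero_of_isMin {xs : Vec d} (h : ∀ x, f xs ≤ f x) : gradient f xs = 0 := by
  have : fderiv ℝ f xs = 0 := IsLocalMin.fderiv_eq_zero (Filter.Eventually.of_forall h)
  simp [gradient, this]

lemma IsLSmooth.continuous_gradient (hf : IsLSmooth L f) : Continuous (gradient f) := by
  refine (LipschitzWith.of_dist_le_mul (K := L.toNNReal) fun x y => ?_).continuous
  rw [dist_eq_norm, dist_eq_norm]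
  exact (hf.2 x y).trans (by gcongr; exact Real.le_coe_toNNReal L)

/-- Smoothness dominates quasi strong convexity; the vector `v` covers dimension zero. -/
lemma IsQuasiStronglyConvex.mul_norm_sq_le {μ : ℝ} {xs : Vec d} (hf : IsLSmooth L f)
    (hq : IsQuasiStronglyConvex μ f xs) (v : Vec d) : μ * ‖v‖ ^ 2 ≤ L * ‖v‖ ^ 2 := by
  have h1 := hq.ineq (xs - v)
  have h2 := hf.le_quadratic (xs - v) xs
  have e1 : xs - v - xs = -v := by abel
  have e2 : xs - (xs - v) = v := by abel
  rw [e1, e2, norm_neg] at h1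
  rw [e2] at h2
  linarith

end Smooth

/-! ### Averages -/

section Average

variable {d n : ℕ}

lemma avg_const (hn : 1 ≤ n) (c : Vec d) : avg (fun _ : Fin n => c) = c := by
  have : (n : ℝ) ≠ 0 := by positivity
  simp [avg, ← Nat.cast_smul_eq_nsmul ℝ, smul_smul, this]

lemma avg_add (u v : Fin n → Vec d) : avg (fun i => u i + v i) = avg u + avg v := by
  simp [avg, Finset.sum_add_distrib]

lemma avg_sub (u v : Fin n → Vec d) : avg (fun i => u i - v i) = avg u - avg v := by
  simp [avg, Finset.sum_sub_distrib, smul_sub]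

lemma avg_smul (c : ℝ) (u : Fin n → Vec d) : avg (fun i => c • u i) = c • avg u := by
  simp only [avg, ← Finset.smul_sum]
  rw [smul_comm]

lemma inner_avg (u : Vec d) (v : Fin n → Vec d) :
    inner ℝ u (avg v) = (1 / (n : ℝ)) * ∑ i, inner ℝ u (v i) := by
  rw [avg, inner_smul_right, inner_sum]

lemma mean_const (hn : 1 ≤ n) (c : ℝ) : (1 / (n : ℝ)) * ∑ _i : Fin n, c = c := by
  have : (n : ℝ) ≠ 0 := by positivity
  simp
  field_simp

lemma mean_le_mean {u v : Fin n → ℝ} (h : ∀ i, u i ≤ v i) :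
    (1 / (n : ℝ)) * ∑ i, u i ≤ (1 / (n : ℝ)) * ∑ i, v i := by
  gcongr with i _
  exact h i

lemma mean_add (u v : Fin n → ℝ) : (1 / (n : ℝ)) * ∑ i, (u i + v i) =
    (1 / (n : ℝ)) * ∑ i, u i + (1 / (n : ℝ)) * ∑ i, v i := by
  rw [Finset.sum_add_distrib, mul_add]

lemma mean_sub (u v : Fin n → ℝ) : (1 / (n : ℝ)) * ∑ i, (u i - v i) =
    (1 / (n : ℝ)) * ∑ i, u i - (1 / (n : ℝ)) * ∑ i, v i := by
  rw [Finset.sum_sub_distrib, mul_sub]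

lemma mean_mul (c : ℝ) (u : Fin n → ℝ) : (1 / (n : ℝ)) * ∑ i, c * u i =
    c * ((1 / (n : ℝ)) * ∑ i, u i) := by
  rw [← Finset.mul_sum]; ring

/-- Used in two ways: `c = -avg v` gives that a variance is at most a second moment; a centred `v`
splits a second moment into mean and noise. -/
lemma mean_norm_add_sq (hn : 1 ≤ n) (c : Vec d) (v : Fin n → Vec d) :
    (1 / (n : ℝ)) * ∑ i, ‖c + v i‖ ^ 2 =
      ‖c‖ ^ 2 + 2 * inner ℝ c (avg v) + (1 / (n : ℝ)) * ∑ i, ‖v i‖ ^ 2 := by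
  simp only [norm_add_sq_real]
  rw [mean_add, mean_add, mean_const hn, mean_mul, inner_avg]

lemma mean_norm_sub_avg_sq (hn : 1 ≤ n) (v : Fin n → Vec d) :
    (1 / (n : ℝ)) * ∑ i, ‖v i - avg v‖ ^ 2 =
      (1 / (n : ℝ)) * ∑ i, ‖v i‖ ^ 2 - ‖avg v‖ ^ 2 := by
  have h := mean_norm_add_sq hn (-avg v) v
  have e : ∀ i, -avg v + v i = v i - avg v := fun i => by abel
  simp only [e, norm_neg, inner_neg_left, real_inner_self_eq_norm_sq] at h
  rw [h]; ring

lemma mean_norm_sub_avg_sq_le (hn : 1 ≤ n) (v : Fin n → Vec d) :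
    (1 / (n : ℝ)) * ∑ i, ‖v i - avg v‖ ^ 2 ≤ (1 / (n : ℝ)) * ∑ i, ‖v i‖ ^ 2 := by
  rw [mean_norm_sub_avg_sq hn]
  linarith [sq_nonneg ‖avg v‖]

lemma norm_avg_sq_le (hn : 1 ≤ n) (v : Fin n → Vec d) :
    ‖avg v‖ ^ 2 ≤ (1 / (n : ℝ)) * ∑ i, ‖v i‖ ^ 2 := by
  have h := mean_norm_sub_avg_sq hn v
  have : 0 ≤ (1 / (n : ℝ)) * ∑ i, ‖v i - avg v‖ ^ 2 := by positivity
  linarith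

lemma norm_sub_sq_le_two_mul (a b : Vec d) : ‖a - b‖ ^ 2 ≤ 2 * ‖a‖ ^ 2 + 2 * ‖b‖ ^ 2 := by
  have h1 := norm_sub_sq_real a b
  have h2 := norm_add_sq_real a b
  nlinarith [sq_nonneg ‖a + b‖]

lemma hasGradientAt_mean {G : Fin n → Vec d → ℝ} (hG : ∀ i, Differentiable ℝ (G i)) (x : Vec d) :
    HasGradientAt (fun x => (1 / (n : ℝ)) * ∑ i, G i x) (avg fun i => gradient (G i) x) x := by
  rw [hasGradientAt_iff_hasFDerivAt]
  have h := (HasFDerivAt.fun_sum (u := Finset.univ)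
    (fun i _ => (hG i x).hasFDerivAt)).const_mul (1 / (n : ℝ))
  refine h.congr_fderiv ?_
  simp [avg, gradient]

lemma gradient_mean {G : Fin n → Vec d → ℝ} (hG : ∀ i, Differentiable ℝ (G i)) (x : Vec d) :
    gradient (fun x => (1 / (n : ℝ)) * ∑ i, G i x) x = avg fun i => gradient (G i) x :=
  (hasGradientAt_mean hG x).gradient

lemma IsLSmooth.mean {L : ℝ} {G : Fin n → Vec d → ℝ} (hn : 1 ≤ n)
    (hG : ∀ i, IsLSmooth L (G i)) : IsLSmooth L (fun x => (1 / (n : ℝ)) * ∑ i, G i x) := by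
  have hd : ∀ i, Differentiable ℝ (G i) := fun i => (hG i).1
  refine ⟨fun x => (hasGradientAt_mean hd x).differentiableAt, fun x y => ?_⟩
  rw [gradient_mean hd, gradient_mean hd, ← avg_sub, avg, norm_smul,
    Real.norm_of_nonneg (by positivity), ← mean_const hn (L * ‖x - y‖)]
  gcongr
  exact (norm_sum_le _ _).trans (Finset.sum_le_sum fun i _ => (hG i).2 x y)

lemma convexOn_mean {G : Fin n → Vec d → ℝ} (hG : ∀ i, ConvexOn ℝ Set.univ (G i)) :
    ConvexOn ℝ Set.univ (fun x => (1 / (n : ℝ)) * ∑ i, G i x) := by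
  refine ⟨convex_univ, fun x hx y hy a b ha hb hab => ?_⟩
  simp only [smul_eq_mul]
  have : ∑ i, G i (a • x + b • y) ≤ ∑ i, (a * G i x + b * G i y) :=
    Finset.sum_le_sum fun i _ => (hG i).2 hx hy ha hb hab
  calc _ ≤ (1 / (n : ℝ)) * ∑ i, (a * G i x + b * G i y) := by gcongr
    _ = _ := by rw [mean_add, mean_mul, mean_mul]

end Average

/-! ### Bounds at a fixed state -/

/-- The standing hypotheses on the objective. -/
structure IsProblem {d n m : ℕ} (F : Fin n → Fin m → Vec d → ℝ) (xs : Vec d) (L μ : ℝ) : Prop where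
  one_le_n : 1 ≤ n
  one_le_m : 1 ≤ m
  L_pos : 0 < L
  μ_nonneg : 0 ≤ μ
  convex : ∀ i j, ConvexOn ℝ Set.univ (F i j)
  smooth : ∀ i j, IsLSmooth L (F i j)
  quasi : IsQuasiStronglyConvex μ (loss F) xs

/-- The mean of `g_i` over the index drawn. -/
def gBar {d n m : ℕ} (F : Fin n → Fin m → Vec d → ℝ) (s : State d n) (i : Fin n) : Vec d :=
  gradient (localLoss F i) s.x - s.h i + avg s.h

lemma sigma2Sq_eq_mean {d n m : ℕ} (F : Fin n → Fin m → Vec d → ℝ) (xs : Vec d)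
    (w : Fin n → Vec d) : sigma2Sq F xs w =
      (1 / (n : ℝ)) * ∑ i, (1 / (m : ℝ)) *
        ∑ j, ‖gradient (F i j) (w i) - gradient (F i j) xs‖ ^ 2 := by
  rw [sigma2Sq, ← Finset.mul_sum, ← mul_assoc, one_div_mul_one_div]

lemma sigma1Sq_nonneg {d n m : ℕ} (F : Fin n → Fin m → Vec d → ℝ) (xs : Vec d)
    (h : Fin n → Vec d) : 0 ≤ sigma1Sq F xs h := by
  unfold sigma1Sq; positivity

lemma sigma2Sq_nonneg {d n m : ℕ} (F : Fin n → Fin m → Vec d → ℝ) (xs : Vec d)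
    (w : Fin n → Vec d) : 0 ≤ sigma2Sq F xs w := by
  unfold sigma2Sq; positivity

lemma norm_convexComb_sq {d : ℕ} (t : ℝ) (a b : Vec d) :
    ‖(1 - t) • a + t • b‖ ^ 2 = (1 - t) * ‖a‖ ^ 2 + t * ‖b‖ ^ 2 - t * (1 - t) * ‖b - a‖ ^ 2 := by
  rw [norm_add_sq_real, norm_sub_sq_real, norm_smul, norm_smul, inner_smul_left, inner_smul_right,
    mul_pow, mul_pow, Real.norm_eq_abs, Real.norm_eq_abs, sq_abs, sq_abs, real_inner_comm a b]
  simp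
  ring

/-- Young's inequality with parameter `δ/2`: half of the contraction is given up, as `(1-δ)(1+δ/2) ≤
1-δ/2`, and the other factor is `(1-δ)(1+2/δ) ≤ 2/δ`. -/
lemma norm_add_sq_le_of_contraction {d : ℕ} {δ : ℝ} (hδ : 0 < δ) (hδ1 : δ ≤ 1) (a b : Vec d) :
    (1 - δ) * ‖a + b‖ ^ 2 ≤ (1 - δ / 2) * ‖a‖ ^ 2 + 2 / δ * ‖b‖ ^ 2 := by
  have h1 : 2 * inner ℝ a b ≤ δ / 2 * ‖a‖ ^ 2 + 2 / δ * ‖b‖ ^ 2 := by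
    have h2 := real_inner_le_norm a b
    have h3 : δ / 2 * ‖a‖ ^ 2 + 2 / δ * ‖b‖ ^ 2 - 2 * (‖a‖ * ‖b‖)
        = (δ * ‖a‖ - 2 * ‖b‖) ^ 2 / (2 * δ) := by field_simp; ring
    have : 0 ≤ (δ * ‖a‖ - 2 * ‖b‖) ^ 2 / (2 * δ) := by positivity
    linarith
  have h4 := norm_add_sq_real a b
  have h5 : 0 ≤ 1 - δ := by linarith
  have h6 : (1 - δ) * ‖a + b‖ ^ 2 ≤
      (1 - δ) * ((1 + δ / 2) * ‖a‖ ^ 2 + (1 + 2 / δ) * ‖b‖ ^ 2) := by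
    refine mul_le_mul_of_nonneg_left ?_ h5
    linarith
  have h7 : (1 - δ) * (1 + 2 / δ) = 2 / δ - 1 - δ := by field_simp; ring
  have h8 : (1 - δ) * ((1 + δ / 2) * ‖a‖ ^ 2 + (1 + 2 / δ) * ‖b‖ ^ 2) =
      (1 - δ) * (1 + δ / 2) * ‖a‖ ^ 2 + (2 / δ - 1 - δ) * ‖b‖ ^ 2 := by rw [← h7]; ring
  rw [h8] at h6
  refine h6.trans (add_le_add ?_ ?_) <;> gcongr
  · nlinarith
  · linarith

namespace IsProblem

variable {d n m : ℕ} {F : Fin n → Fin m → Vec d → ℝ} {xs : Vec d} {L μ : ℝ}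

lemma smooth_local (hF : IsProblem F xs L μ) (i : Fin n) : IsLSmooth L (localLoss F i) :=
  IsLSmooth.mean hF.one_le_m (hF.smooth i)

lemma smooth_loss (hF : IsProblem F xs L μ) : IsLSmooth L (loss F) :=
  IsLSmooth.mean hF.one_le_n hF.smooth_local

lemma convex_local (hF : IsProblem F xs L μ) (i : Fin n) : ConvexOn ℝ Set.univ (localLoss F i) :=
  convexOn_mean (hF.convex i)

lemma convex_loss (hF : IsProblem F xs L μ) : ConvexOn ℝ Set.univ (loss F) :=
  convexOn_mean hF.convex_local

lemma gradient_local (hF : IsProblem F xs L μ) (i : Fin n) (x : Vec d) :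
    gradient (localLoss F i) x = avg fun j => gradient (F i j) x :=
  gradient_mean (fun j => (hF.smooth i j).1) x

lemma gradient_loss (hF : IsProblem F xs L μ) (x : Vec d) :
    gradient (loss F) x = avg fun i => gradient (localLoss F i) x :=
  gradient_mean (fun i => (hF.smooth_local i).1) x

lemma gradient_loss_min (hF : IsProblem F xs L μ) : gradient (loss F) xs = 0 :=
  gradient_eq_zero_of_isMin hF.quasi.isMin

lemma gap_nonneg (hF : IsProblem F xs L μ) (x : Vec d) : 0 ≤ loss F x - loss F xs :=
  sub_nonneg.2 (hF.quasi.isMin x)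

lemma gap_le (hF : IsProblem F xs L μ) (x : Vec d) :
    loss F x - loss F xs ≤ L / 2 * ‖x - xs‖ ^ 2 := by
  have := hF.smooth_loss.le_quadratic xs x
  rw [hF.gradient_loss_min, inner_zero_left] at this
  linarith

/-- The linear terms average to `⟨∇f(x*), x - x*⟩`, which vanishes at the minimizer, although no
single `∇f_ij(x*)` need vanish. -/
lemma mean_bregman (hF : IsProblem F xs L μ) (x : Vec d) :
    (1 / (n : ℝ)) * ∑ i, (1 / (m : ℝ)) * ∑ j,
      (F i j x - F i j xs - inner ℝ (gradient (F i j) xs) (x - xs)) = loss F x - loss F xs := by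
  have h : ∀ i, (1 / (m : ℝ)) * ∑ j,
      (F i j x - F i j xs - inner ℝ (gradient (F i j) xs) (x - xs)) =
      localLoss F i x - localLoss F i xs - inner ℝ (gradient (localLoss F i) xs) (x - xs) := by
    intro i
    rw [mean_sub, mean_sub, hF.gradient_local, real_inner_comm, inner_avg]
    simp only [real_inner_comm]
    rfl
  simp only [h]
  rw [mean_sub, mean_sub]
  have h2 : (1 / (n : ℝ)) * ∑ i, inner ℝ (gradient (localLoss F i) xs) (x - xs) = 0 := by
    have := inner_avg (x - xs) (fun i => gradient (localLoss F i) xs)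
    rw [← hF.gradient_loss, hF.gradient_loss_min, inner_zero_right] at this
    simp only [real_inner_comm] at this ⊢
    exact this.symm
  rw [h2, sub_zero]
  rfl

lemma mean_gradient_sub_sq_le (hF : IsProblem F xs L μ) (x : Vec d) :
    (1 / (n : ℝ)) * ∑ i, (1 / (m : ℝ)) * ∑ j, ‖gradient (F i j) x - gradient (F i j) xs‖ ^ 2 ≤
      2 * L * (loss F x - loss F xs) := by
  rw [← hF.mean_bregman, ← mean_mul]
  refine mean_le_mean fun i => ?_
  rw [← mean_mul]
  exact mean_le_mean fun j =>
    (hF.smooth i j).norm_gradient_sub_sq_le hF.L_pos (hF.convex i j) x xs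

lemma mean_gradient_local_sub_sq_le (hF : IsProblem F xs L μ) (x : Vec d) :
    (1 / (n : ℝ)) * ∑ i, ‖gradient (localLoss F i) x - gradient (localLoss F i) xs‖ ^ 2 ≤
      2 * L * (loss F x - loss F xs) := by
  refine (mean_le_mean fun i => ?_).trans (hF.mean_gradient_sub_sq_le x)
  rw [hF.gradient_local, hF.gradient_local, ← avg_sub]
  exact norm_avg_sq_le hF.one_le_m _

lemma norm_gradient_loss_sq_le (hF : IsProblem F xs L μ) (x : Vec d) :
    ‖gradient (loss F) x‖ ^ 2 ≤ 2 * L * (loss F x - loss F xs) := by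
  have := hF.smooth_loss.norm_gradient_sub_sq_le hF.L_pos hF.convex_loss x xs
  simpa [hF.gradient_loss_min] using this

lemma avg_gHat (hF : IsProblem F xs L μ) (s : State d n) (i : Fin n) :
    avg (fun l => gHat F s i l) = gradient (localLoss F i) s.x := by
  unfold gHat
  rw [avg_add, avg_sub, avg_const hF.one_le_m, ← hF.gradient_local, ← hF.gradient_local]
  abel

lemma avg_gLoc (hF : IsProblem F xs L μ) (s : State d n) (i : Fin n) :
    avg (fun l => gLoc F s i l) = gBar F s i := by
  unfold gLoc gBar
  rw [avg_add, avg_sub, hF.avg_gHat, avg_const hF.one_le_m, avg_const hF.one_le_m]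

/-- The shifts cancel in the average over workers. This is why `σ₁²` does not enter the second
moment of `g` (`B1p = 0`). -/
lemma avg_gLoc_eq_avg_gHat (hF : IsProblem F xs L μ) (s : State d n) (l : Fin n → Fin m) :
    avg (fun i => gLoc F s i (l i)) = avg (fun i => gHat F s i (l i)) := by
  unfold gLoc
  rw [avg_add, avg_sub, avg_const hF.one_le_n]
  exact sub_add_cancel _ _

lemma avg_gBar (hF : IsProblem F xs L μ) (s : State d n) :
    avg (fun i => gBar F s i) = gradient (loss F) s.x := by
  unfold gBar
  rw [avg_add, avg_sub, avg_const hF.one_le_n, ← hF.gradient_loss]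
  exact sub_add_cancel _ _

/-- With `u_i = h_i - ∇f_i(x*)`, the mean of the `u_i` is `h`, because `∇f(x*) = 0`. Hence `ḡ_i` is
a gradient difference minus a centred `u_i`, and centring only decreases the second moment. -/
lemma mean_gBar_sq_le (hF : IsProblem F xs L μ) (s : State d n) :
    (1 / (n : ℝ)) * ∑ i, ‖gBar F s i‖ ^ 2 ≤
      4 * L * (loss F s.x - loss F xs) + 2 * sigma1Sq F xs s.h := by
  set u : Fin n → Vec d := fun i => s.h i - gradient (localLoss F i) xs with hu
  have hau : avg u = avg s.h := by
    rw [hu, avg_sub, ← hF.gradient_loss, hF.gradient_loss_min, sub_zero]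
  have h1 : ∀ i, ‖gBar F s i‖ ^ 2 ≤
      2 * ‖gradient (localLoss F i) s.x - gradient (localLoss F i) xs‖ ^ 2
        + 2 * ‖u i - avg u‖ ^ 2 := by
    intro i
    have : gBar F s i =
        (gradient (localLoss F i) s.x - gradient (localLoss F i) xs) - (u i - avg u) := by
      rw [hau]; simp only [hu, gBar]; abel
    rw [this]
    exact norm_sub_sq_le_two_mul _ _
  refine (mean_le_mean h1).trans ?_
  rw [mean_add, mean_mul, mean_mul]
  have h2 := hF.mean_gradient_local_sub_sq_le s.x
  have h3 := mean_norm_sub_avg_sq_le hF.one_le_n u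
  have h4 : sigma1Sq F xs s.h = (1 / (n : ℝ)) * ∑ i, ‖u i‖ ^ 2 := rfl
  linarith

/-- The same decomposition, centred over the index instead of the worker. This estimate serves the
variance, the second moment and the shift recursion. -/
lemma mean_gHat_sub_sq_le (hF : IsProblem F xs L μ) (s : State d n) :
    (1 / (n : ℝ)) * ∑ i, (1 / (m : ℝ)) * ∑ l, ‖gHat F s i l - gradient (localLoss F i) xs‖ ^ 2 ≤
      4 * L * (loss F s.x - loss F xs) + 2 * sigma2Sq F xs s.w := by
  have h1 : ∀ i, (1 / (m : ℝ)) * ∑ l, ‖gHat F s i l - gradient (localLoss F i) xs‖ ^ 2 ≤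
      2 * ((1 / (m : ℝ)) * ∑ l, ‖gradient (F i l) s.x - gradient (F i l) xs‖ ^ 2) +
      2 * ((1 / (m : ℝ)) * ∑ l, ‖gradient (F i l) (s.w i) - gradient (F i l) xs‖ ^ 2) := by
    intro i
    set u : Fin m → Vec d := fun l => gradient (F i l) (s.w i) - gradient (F i l) xs with hu
    have hau : avg u = gradient (localLoss F i) (s.w i) - gradient (localLoss F i) xs := by
      rw [hu, avg_sub, ← hF.gradient_local, ← hF.gradient_local]
    have h2 : ∀ l, ‖gHat F s i l - gradient (localLoss F i) xs‖ ^ 2 ≤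
        2 * ‖gradient (F i l) s.x - gradient (F i l) xs‖ ^ 2 + 2 * ‖u l - avg u‖ ^ 2 := by
      intro l
      have : gHat F s i l - gradient (localLoss F i) xs =
          (gradient (F i l) s.x - gradient (F i l) xs) - (u l - avg u) := by
        rw [hau]; simp only [hu, gHat]; abel
      rw [this]
      exact norm_sub_sq_le_two_mul _ _
    refine (mean_le_mean h2).trans ?_
    rw [mean_add, mean_mul, mean_mul]
    linarith [mean_norm_sub_avg_sq_le hF.one_le_m u]
  refine (mean_le_mean h1).trans ?_
  rw [mean_add, mean_mul 2, mean_mul 2, sigma2Sq_eq_mean]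
  linarith [hF.mean_gradient_sub_sq_le s.x]

/-- The shifts are fixed given the state, so this is the variance of `ĝ_i`, at most its second
moment about `∇f_i(x*)`. The argument gives the constants `4L, 0, 2`; the stated ones are weaker. -/
lemma mean_gLoc_sub_gBar_sq_le (hF : IsProblem F xs L μ) (s : State d n) :
    (1 / (n : ℝ)) * ∑ i, (1 / (m : ℝ)) * ∑ l, ‖gLoc F s i l - gBar F s i‖ ^ 2 ≤
      6 * L * (loss F s.x - loss F xs) + 3 * sigma1Sq F xs s.h + 3 * sigma2Sq F xs s.w := by
  have h1 : ∀ i, (1 / (m : ℝ)) * ∑ l, ‖gLoc F s i l - gBar F s i‖ ^ 2 ≤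
      (1 / (m : ℝ)) * ∑ l, ‖gHat F s i l - gradient (localLoss F i) xs‖ ^ 2 := by
    intro i
    have := mean_norm_sub_avg_sq_le hF.one_le_m
      (fun l => gHat F s i l - gradient (localLoss F i) xs)
    rw [avg_sub, hF.avg_gHat, avg_const hF.one_le_m] at this
    refine le_trans (le_of_eq ?_) this
    congr 2 with l
    congr 2
    unfold gLoc gBar
    abel
  refine (mean_le_mean h1).trans ((hF.mean_gHat_sub_sq_le s).trans ?_)
  have h2 := sigma1Sq_nonneg F xs s.h
  have h3 := sigma2Sq_nonneg F xs s.w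
  have h4 := mul_nonneg hF.L_pos.le (hF.gap_nonneg s.x)
  linarith

/-- The compressor argument is split into its mean over the index and centred noise. Young's
inequality, with its factor `2/δ`, is spent on the mean only; the noise is orthogonal and enters
with factor at most `1`. -/
lemma mean_error_step_le (hF : IsProblem F xs L μ) {δ γ : ℝ} (hδ : 0 < δ) (hδ1 : δ ≤ 1)
    (s : State d n) :
    (1 / (n : ℝ)) * ∑ i, (1 - δ) * ((1 / (m : ℝ)) * ∑ l, ‖s.e i + γ • gLoc F s i l‖ ^ 2) ≤
      (1 - δ / 2) * ((1 / (n : ℝ)) * ∑ i, ‖s.e i‖ ^ 2)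
      + γ ^ 2 * (2 * L * (4 / δ + 3) * (loss F s.x - loss F xs)
        + (4 / δ + 3) * sigma1Sq F xs s.h + 3 * sigma2Sq F xs s.w) := by
  have h1 : ∀ i, (1 - δ) * ((1 / (m : ℝ)) * ∑ l, ‖s.e i + γ • gLoc F s i l‖ ^ 2) ≤
      (1 - δ / 2) * ‖s.e i‖ ^ 2 + 2 / δ * γ ^ 2 * ‖gBar F s i‖ ^ 2
      + γ ^ 2 * ((1 / (m : ℝ)) * ∑ l, ‖gLoc F s i l - gBar F s i‖ ^ 2) := by
    intro i
    have h2 := mean_norm_add_sq hF.one_le_m (s.e i + γ • gBar F s i)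
      (fun l => γ • (gLoc F s i l - gBar F s i))
    rw [avg_smul, avg_sub, hF.avg_gLoc, avg_const hF.one_le_m, sub_self, smul_zero,
      inner_zero_right] at h2
    have e1 : ∀ l, s.e i + γ • gBar F s i + γ • (gLoc F s i l - gBar F s i) =
        s.e i + γ • gLoc F s i l := fun l => by rw [smul_sub]; abel
    simp only [e1, norm_smul, mul_pow, Real.norm_eq_abs, sq_abs] at h2
    rw [mean_mul] at h2
    have h3 := norm_add_sq_le_of_contraction hδ hδ1 (s.e i) (γ • gBar F s i)
    rw [norm_smul γ, mul_pow, Real.norm_eq_abs, sq_abs] at h3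
    have h4 : 0 ≤ γ ^ 2 * ((1 / (m : ℝ)) * ∑ l, ‖gLoc F s i l - gBar F s i‖ ^ 2) := by positivity
    rw [h2]
    nlinarith
  refine (mean_le_mean h1).trans ?_
  rw [mean_add, mean_add, mean_mul, mean_mul, mean_mul]
  have h2 := mul_le_mul_of_nonneg_left (hF.mean_gBar_sq_le s)
    (by positivity : 0 ≤ 2 / δ * γ ^ 2)
  have h3 := mul_le_mul_of_nonneg_left (hF.mean_gLoc_sub_gBar_sq_le s) (sq_nonneg γ)
  refine (add_le_add (add_le_add le_rfl h2) h3).trans (le_of_eq ?_)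
  ring

lemma mean_shift_step_le (hF : IsProblem F xs L μ) {α : ℝ} (hα : 0 < α) (s : State d n) :
    (1 / (n : ℝ)) * ∑ i, ((1 - α) * ‖s.h i - gradient (localLoss F i) xs‖ ^ 2 +
      α * ((1 / (m : ℝ)) * ∑ l, ‖gHat F s i l - gradient (localLoss F i) xs‖ ^ 2)) ≤
      (1 - α) * sigma1Sq F xs s.h + 2 * (3 * L * α) * (loss F s.x - loss F xs)
        + 2 * α * sigma2Sq F xs s.w := by
  rw [mean_add, mean_mul, mean_mul]
  have h1 := mul_le_mul_of_nonneg_left (hF.mean_gHat_sub_sq_le s) hα.le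
  have h2 := mul_nonneg hα.le (mul_nonneg hF.L_pos.le (hF.gap_nonneg s.x))
  have h3 : sigma1Sq F xs s.h =
    (1 / (n : ℝ)) * ∑ i, ‖s.h i - gradient (localLoss F i) xs‖ ^ 2 := rfl
  rw [← h3]
  linarith

lemma mean_reference_step_le (hF : IsProblem F xs L μ) {p : ℝ} (hp : 0 < p) (s : State d n) :
    (1 / (n : ℝ)) * ∑ i, (1 / (m : ℝ)) * ∑ j,
      (p * ‖gradient (F i j) s.x - gradient (F i j) xs‖ ^ 2 +
        (1 - p) * ‖gradient (F i j) (s.w i) - gradient (F i j) xs‖ ^ 2) ≤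
      (1 - p) * sigma2Sq F xs s.w + 2 * (L * p) * (loss F s.x - loss F xs) := by
  simp only [mean_add, mean_mul p, mean_mul (1 - p)]
  rw [← sigma2Sq_eq_mean F xs s.w]
  have h1 := mul_le_mul_of_nonneg_left (hF.mean_gradient_sub_sq_le s.x) hp.le
  linarith

end IsProblem

/-! ### Integrating out an independent variable -/

section Independent

variable {Ω β ζ E : Type*} {m mΩ : MeasurableSpace Ω} [MeasurableSpace β] [MeasurableSpace ζ]
  {P : Measure Ω} [IsProbabilityMeasure P] {X : Ω → β} {Z : Ω → ζ} {ν : Measure ζ}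
  [NormedAddCommGroup E] [NormedSpace ℝ E]

/-- Restricting to an arbitrary event `A` of the past keeps `Z` independent of `X`. Testing on such
events is what characterizes a conditional expectation. -/
lemma map_restrict_prodMk_eq_prod (hm : m ≤ mΩ) (hX : Measurable[m] X) (hZ : Measurable Z)
    (hν : P.map Z = ν) (hind : Indep m (MeasurableSpace.comap Z inferInstance) P) {A : Set Ω}
    (hA : MeasurableSet[m] A) :
    (P.restrict A).map (fun ω => (X ω, Z ω)) = ((P.restrict A).map X).prod ν := by
  have hX' : Measurable X := hX.mono hm le_rfl
  have : IsProbabilityMeasure ν := hν ▸ Measure.isProbabilityMeasure_map hZ.aemeasurable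
  refine (Measure.prod_eq fun s t hs ht => ?_).symm
  rw [Measure.map_apply (hX'.prodMk hZ) (hs.prod ht), Measure.map_apply hX' hs, ← hν,
    Measure.map_apply hZ ht, Measure.restrict_apply ((hX'.prodMk hZ) (hs.prod ht)),
    Measure.restrict_apply (hX' hs)]
  have h := (Indep_iff _ _ P).1 hind (X ⁻¹' s ∩ A) (Z ⁻¹' t) ((hX hs).inter hA) ⟨t, ht, rfl⟩
  rw [← h]
  congr 1
  ext ω
  simp only [Set.mem_inter_iff, Set.mem_preimage, Set.mem_prod]
  tauto

lemma setIntegral_comp_prodMk (hm : m ≤ mΩ) (hX : Measurable[m] X) (hZ : Measurable Z)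
    (hν : P.map Z = ν) (hind : Indep m (MeasurableSpace.comap Z inferInstance) P)
    {Φ : β → ζ → E} (hΦ : StronglyMeasurable (Function.uncurry Φ))
    (hint : Integrable (fun ω => Φ (X ω) (Z ω)) P) {A : Set Ω} (hA : MeasurableSet[m] A) :
    IntegrableOn (fun ω => ∫ z, Φ (X ω) z ∂ν) A P ∧
      ∫ ω in A, ∫ z, Φ (X ω) z ∂ν ∂P = ∫ ω in A, Φ (X ω) (Z ω) ∂P := by
  have hX' : Measurable X := hX.mono hm le_rfl
  have : IsProbabilityMeasure ν := hν ▸ Measure.isProbabilityMeasure_map hZ.aemeasurable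
  have hmap := map_restrict_prodMk_eq_prod hm hX hZ hν hind hA
  have hXZ : Measurable (fun ω => (X ω, Z ω)) := hX'.prodMk hZ
  have hI : Integrable (Function.uncurry Φ) (((P.restrict A).map X).prod ν) := by
    rw [← hmap, integrable_map_measure hΦ.aestronglyMeasurable hXZ.aemeasurable]
    exact hint.integrableOn
  have hsm : StronglyMeasurable (fun b => ∫ z, Φ b z ∂ν) := hΦ.integral_prod_right
  constructor
  · have := hI.integral_prod_left
    simp only [Function.uncurry_apply_pair] at this
    rwa [integrable_map_measure hsm.aestronglyMeasurable hX'.aemeasurable] at this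
  · have h1 := integral_map hXZ.aemeasurable (μ := P.restrict A) (f := Function.uncurry Φ)
      hΦ.aestronglyMeasurable
    rw [hmap, integral_prod _ hI] at h1
    simp only [Function.uncurry_apply_pair] at h1
    rw [integral_map hX'.aemeasurable hsm.aestronglyMeasurable] at h1
    exact h1

/-- The freezing principle: the known variable is held fixed and the independent one is integrated
out. -/
lemma condExp_comp_prodMk [CompleteSpace E] (hm : m ≤ mΩ) (hX : Measurable[m] X)
    (hZ : Measurable Z) (hν : P.map Z = ν)
    (hind : Indep m (MeasurableSpace.comap Z inferInstance) P)
    {Φ : β → ζ → E} (hΦ : StronglyMeasurable (Function.uncurry Φ))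
    (hint : Integrable (fun ω => Φ (X ω) (Z ω)) P) :
    P[fun ω => Φ (X ω) (Z ω) | m] =ᵐ[P] fun ω => ∫ z, Φ (X ω) z ∂ν := by
  have : IsProbabilityMeasure ν := hν ▸ Measure.isProbabilityMeasure_map hZ.aemeasurable
  refine (ae_eq_condExp_of_forall_setIntegral_eq hm hint
    (fun A hA _ => (setIntegral_comp_prodMk hm hX hZ hν hind hΦ hint hA).1)
    (fun A hA _ => (setIntegral_comp_prodMk hm hX hZ hν hind hΦ hint hA).2) ?_).symm
  have h1 : StronglyMeasurable (fun b => ∫ z, Φ b z ∂ν) := hΦ.integral_prod_right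
  exact (h1.comp_measurable hX).aestronglyMeasurable

/-- By Tonelli, integrability of a nonnegative function follows from a bound on its frozen integral.
It is needed because the operators are controlled only at each deterministic argument, while the
method feeds them random ones. -/
lemma integrable_comp_prodMk (hm : m ≤ mΩ) (hX : Measurable[m] X) (hZ : Measurable Z)
    (hν : P.map Z = ν) (hind : Indep m (MeasurableSpace.comap Z inferInstance) P)
    {Φ : β → ζ → ℝ} (hΦ : StronglyMeasurable (Function.uncurry Φ)) (h0 : ∀ b z, 0 ≤ Φ b z)
    (hI : ∀ b, Integrable (Φ b) ν) {B : Ω → ℝ} (hB : Integrable B P)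
    (hle : ∀ ω, ∫ z, Φ (X ω) z ∂ν ≤ B ω) : Integrable (fun ω => Φ (X ω) (Z ω)) P := by
  have hX' : Measurable X := hX.mono hm le_rfl
  have : IsProbabilityMeasure ν := hν ▸ Measure.isProbabilityMeasure_map hZ.aemeasurable
  have hmap := map_restrict_prodMk_eq_prod hm hX hZ hν hind (MeasurableSet.univ)
  rw [Measure.restrict_univ] at hmap
  have hXZ : Measurable (fun ω => (X ω, Z ω)) := hX'.prodMk hZ
  have hsm : StronglyMeasurable (fun b => ∫ z, Φ b z ∂ν) := hΦ.integral_prod_right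
  have hI2 : Integrable (Function.uncurry Φ) ((P.map X).prod ν) := by
    rw [integrable_prod_iff hΦ.aestronglyMeasurable]
    refine ⟨Filter.Eventually.of_forall hI, ?_⟩
    simp only [Function.uncurry, Real.norm_of_nonneg (h0 _ _)]
    rw [integrable_map_measure hsm.aestronglyMeasurable hX'.aemeasurable]
    refine hB.mono' (hsm.comp_measurable hX').aestronglyMeasurable
      (Filter.Eventually.of_forall fun ω => ?_)
    rw [Function.comp, Real.norm_of_nonneg (integral_nonneg (h0 _))]
    exact hle ω
  rw [← hmap, integrable_map_measure hΦ.aestronglyMeasurable hXZ.aemeasurable] at hI2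
  exact hI2

end Independent

/-! ### The law of one draw -/

section Law

/-- The law of what one worker draws in one iteration. -/
def noiseLaw (m : ℕ) {S T : Type*} [MeasurableSpace S] [MeasurableSpace T] (p : ℝ)
    (νC : Measure S) (νQ : Measure T) : Measure (Noise m S T) :=
  (uniformOn (Set.univ : Set (Fin m))).prod ((coin p).prod (νC.prod νQ))

variable {m : ℕ} {S T E : Type*} [MeasurableSpace S] [MeasurableSpace T] {p : ℝ}
  {νC : Measure S} {νQ : Measure T} [IsProbabilityMeasure νC] [IsProbabilityMeasure νQ]
  [NormedAddCommGroup E] [NormedSpace ℝ E]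

lemma isProbabilityMeasure_coin (hp : 0 ≤ p) (hp1 : p ≤ 1) : IsProbabilityMeasure (coin p) := by
  constructor
  simp only [coin, Measure.add_apply, Measure.smul_apply, measure_univ, smul_eq_mul, mul_one]
  rw [← ENNReal.ofReal_add hp (by linarith)]
  simp

lemma isProbabilityMeasure_uniformOn_fin (hm : 1 ≤ m) :
    IsProbabilityMeasure (uniformOn (Set.univ : Set (Fin m))) := by
  have : Nonempty (Fin m) := ⟨⟨0, hm⟩⟩
  infer_instance

lemma integral_uniformOn_fin [CompleteSpace E] (hm : 1 ≤ m) (φ : Fin m → E) :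
    ∫ l, φ l ∂(uniformOn (Set.univ : Set (Fin m))) = (1 / (m : ℝ)) • ∑ l, φ l := by
  have := isProbabilityMeasure_uniformOn_fin hm
  rw [integral_fintype Integrable.of_finite, Finset.smul_sum]
  refine Finset.sum_congr rfl fun l _ => ?_
  congr 1
  simp [Measure.real, uniformOn_univ]

lemma integral_coin [CompleteSpace E] (hp : 0 ≤ p) (hp1 : p ≤ 1) (φ : Bool → E) :
    ∫ b, φ b ∂(coin p) = p • φ true + (1 - p) • φ false := by
  have := isProbabilityMeasure_coin hp hp1
  rw [integral_fintype Integrable.of_finite]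
  simp [coin, Measure.real, hp, hp1]

lemma integral_noiseLaw_index [CompleteSpace E] (hm : 1 ≤ m) (hp : 0 ≤ p) (hp1 : p ≤ 1)
    (φ : Fin m → E) :
    ∫ z, φ z.1 ∂(noiseLaw m p νC νQ) = (1 / (m : ℝ)) • ∑ l, φ l := by
  have := isProbabilityMeasure_coin hp hp1
  have := isProbabilityMeasure_uniformOn_fin hm
  rw [noiseLaw, integral_fun_fst, integral_uniformOn_fin hm]
  simp

lemma integral_noiseLaw_coin [CompleteSpace E] (hm : 1 ≤ m) (hp : 0 ≤ p) (hp1 : p ≤ 1)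
    (φ : Bool → E) :
    ∫ z, φ z.2.1 ∂(noiseLaw m p νC νQ) = p • φ true + (1 - p) • φ false := by
  have := isProbabilityMeasure_coin hp hp1
  have := isProbabilityMeasure_uniformOn_fin hm
  rw [noiseLaw, integral_fun_snd (fun y : Bool × S × T => φ y.1), integral_fun_fst,
    integral_coin hp hp1]
  simp

/-- The index takes finitely many values, so the function is a finite sum of indicators times
functions of the second variable, and no joint measurability has to be assumed. -/
lemma integrable_index_prod {R : Type*} [MeasurableSpace R] {ρ : Measure R}
    [IsProbabilityMeasure ρ] (hm : 1 ≤ m) {φ : Fin m → R → ℝ} (hI : ∀ l, Integrable (φ l) ρ) :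
    Integrable (fun z : Fin m × R => φ z.1 z.2)
      ((uniformOn (Set.univ : Set (Fin m))).prod ρ) := by
  have := isProbabilityMeasure_uniformOn_fin hm
  have h : (fun z : Fin m × R => φ z.1 z.2) =
      fun z => ∑ l, (if z.1 = l then (1 : ℝ) else 0) * φ l z.2 := by
    ext z
    simp
  rw [h]
  exact integrable_finsetSum _ fun l _ =>
    Integrable.mul_prod (f := fun j : Fin m => if j = l then (1 : ℝ) else 0)
      Integrable.of_finite (hI l)

lemma integrable_noiseLaw_index_compressor (hm : 1 ≤ m) (hp : 0 ≤ p) (hp1 : p ≤ 1)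
    {φ : Fin m → S → ℝ} (hI : ∀ l, Integrable (φ l) νC) :
    Integrable (fun z : Noise m S T => φ z.1 z.2.2.1) (noiseLaw m p νC νQ) := by
  have := isProbabilityMeasure_coin hp hp1
  exact integrable_index_prod hm (φ := fun l (r : Bool × S × T) => φ l r.2.1)
    fun l => ((hI l).comp_fst νQ).comp_snd (coin p)

lemma integral_noiseLaw_index_compressor (hm : 1 ≤ m) (hp : 0 ≤ p) (hp1 : p ≤ 1)
    {φ : Fin m → S → ℝ} (hI : ∀ l, Integrable (φ l) νC) :
    ∫ z, φ z.1 z.2.2.1 ∂(noiseLaw m p νC νQ) = (1 / (m : ℝ)) * ∑ l, ∫ s, φ l s ∂νC := by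
  have := isProbabilityMeasure_coin hp hp1
  have := isProbabilityMeasure_uniformOn_fin hm
  have h := integrable_noiseLaw_index_compressor (νQ := νQ) hm hp hp1 hI
  rw [noiseLaw] at h ⊢
  rw [integral_prod _ h, integral_uniformOn_fin hm, smul_eq_mul]
  congr 2 with l
  rw [integral_fun_snd (fun y : S × T => φ l y.1), integral_fun_fst]
  simp only [probReal_univ, one_smul]

lemma integrable_noiseLaw_index_quantizer (hm : 1 ≤ m) (hp : 0 ≤ p) (hp1 : p ≤ 1)
    {φ : Fin m → T → ℝ} (hI : ∀ l, Integrable (φ l) νQ) :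
    Integrable (fun z : Noise m S T => φ z.1 z.2.2.2) (noiseLaw m p νC νQ) := by
  have := isProbabilityMeasure_coin hp hp1
  exact integrable_index_prod hm (φ := fun l (r : Bool × S × T) => φ l r.2.2)
    fun l => ((hI l).comp_snd νC).comp_snd (coin p)

lemma integral_noiseLaw_index_quantizer (hm : 1 ≤ m) (hp : 0 ≤ p) (hp1 : p ≤ 1)
    {φ : Fin m → T → ℝ} (hI : ∀ l, Integrable (φ l) νQ) :
    ∫ z, φ z.1 z.2.2.2 ∂(noiseLaw m p νC νQ) = (1 / (m : ℝ)) * ∑ l, ∫ t, φ l t ∂νQ := by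
  have := isProbabilityMeasure_coin hp hp1
  have := isProbabilityMeasure_uniformOn_fin hm
  have h := integrable_noiseLaw_index_quantizer (νC := νC) hm hp hp1 hI
  rw [noiseLaw] at h ⊢
  rw [integral_prod _ h, integral_uniformOn_fin hm, smul_eq_mul]
  congr 2 with l
  rw [integral_fun_snd (fun y : S × T => φ l y.2), integral_fun_snd]
  simp only [probReal_univ, one_smul]

end Law

/-! ### The history -/

section History

variable {n m : ℕ} {S T Ω : Type*} [MeasurableSpace S] [MeasurableSpace T]

lemma history_mono (ξ : ℕ → Fin n → Ω → Noise m S T) {k k' : ℕ} (h : k ≤ k') :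
    history ξ k ≤ history ξ k' :=
  iSup_le fun j => iSup_le fun i =>
    le_iSup_of_le (⟨j, j.2.trans_le h⟩ : Fin k') (le_iSup_of_le i le_rfl)

lemma measurable_history (ξ : ℕ → Fin n → Ω → Noise m S T) (k : ℕ) (i : Fin n) :
    Measurable[history ξ (k + 1)] (ξ k i) := by
  refine measurable_iff_comap_le.2 ?_
  exact le_iSup_of_le (⟨k, k.lt_succ_self⟩ : Fin (k + 1)) (le_iSup_of_le i le_rfl)

variable [mΩ : MeasurableSpace Ω] {P : Measure Ω} {p : ℝ} {νC : Measure S} {νQ : Measure T}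
  {ξ : ℕ → Fin n → Ω → Noise m S T}

lemma IsNoise.history_le (hξ : IsNoise P p νC νQ ξ) (k : ℕ) : history ξ k ≤ mΩ :=
  iSup_le fun j => iSup_le fun i => (hξ.measurable j i).comap_le

/-- The draws with iteration number below `k` and the single draw `(k, i)` belong to disjoint blocks
of one independent family. -/
lemma IsNoise.indep_history (hξ : IsNoise P p νC νQ ξ) (k : ℕ) (i : Fin n) :
    Indep (history ξ k) (MeasurableSpace.comap (ξ k i) inferInstance) P := by
  have h := indep_iSup_of_disjoint
    (m := fun a : ℕ × Fin n => MeasurableSpace.comap (ξ a.1 a.2) inferInstance)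
    (fun a => (hξ.measurable a.1 a.2).comap_le) hξ.indep.iIndep
    (S := {a | a.1 < k}) (T := {(k, i)}) (by simp)
  refine indep_of_indep_of_le_left (indep_of_indep_of_le_right h ?_) ?_
  · exact le_iSup₂_of_le (k, i) rfl le_rfl
  · exact iSup_le fun j => iSup_le fun i =>
      le_iSup₂_of_le ((j : ℕ), i) j.2 le_rfl

end History

/-! ### Measurability of the method -/

section Measurability

variable {d n m : ℕ} {S T : Type*}

/-- Pulled back from the product of the components, so that a map into states is measurable exactly
when its tuple of components is. -/
instance : MeasurableSpace (State d n) :=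
  MeasurableSpace.comap (fun s : State d n => (s.x, s.e, s.h, s.w)) inferInstance

lemma State.measurable_tuple : Measurable (fun s : State d n => (s.x, s.e, s.h, s.w)) :=
  comap_measurable _

lemma State.measurable_x : Measurable (State.x : State d n → Vec d) :=
  State.measurable_tuple.fst

lemma State.measurable_e (i : Fin n) : Measurable (fun s : State d n => s.e i) :=
  (measurable_pi_apply i).comp State.measurable_tuple.snd.fst

lemma State.measurable_h (i : Fin n) : Measurable (fun s : State d n => s.h i) :=
  (measurable_pi_apply i).comp State.measurable_tuple.snd.snd.fst

lemma State.measurable_w (i : Fin n) : Measurable (fun s : State d n => s.w i) :=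
  (measurable_pi_apply i).comp State.measurable_tuple.snd.snd.snd

lemma State.measurable_of {A : Type*} [MeasurableSpace A] {f : A → State d n}
    (hx : Measurable fun a => (f a).x) (he : ∀ i, Measurable fun a => (f a).e i)
    (hh : ∀ i, Measurable fun a => (f a).h i) (hw : ∀ i, Measurable fun a => (f a).w i) :
    Measurable f := by
  refine measurable_comap_iff.2 ?_
  exact hx.prodMk ((measurable_pi_lambda _ he).prodMk
    ((measurable_pi_lambda _ hh).prodMk (measurable_pi_lambda _ hw)))

lemma measurable_avg {A : Type*} [MeasurableSpace A] {v : A → Fin n → Vec d}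
    (hv : ∀ i, Measurable fun a => v a i) : Measurable fun a => avg (v a) := by
  unfold avg
  exact (Finset.measurable_sum _ fun i _ => hv i).const_smul (1 / (n : ℝ))

/-- The error of worker `i` after the draw `z`. -/
def errStep (F : Fin n → Fin m → Vec d → ℝ) (C : S → Vec d → Vec d) (γ : ℝ) (i : Fin n)
    (s : State d n) (z : Noise m S T) : Vec d :=
  s.e i + γ • gLoc F s i z.1 - C z.2.2.1 (s.e i + γ • gLoc F s i z.1)

/-- The shift of worker `i` after the draw `z`. -/
def shiftStep (F : Fin n → Fin m → Vec d → ℝ) (Q : T → Vec d → Vec d) (α : ℝ) (i : Fin n)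
    (s : State d n) (z : Noise m S T) : Vec d :=
  s.h i + α • Q z.2.2.2 (gHat F s i z.1 - s.h i)

/-- The reference point of worker `i` after the draw `z`. -/
def refStep (i : Fin n) (s : State d n) (z : Noise m S T) : Vec d :=
  if z.2.1 = true then s.x else s.w i

/-- The sequence `x - e`, with `e` the average error, moves along `-γ g`. -/
lemma step_x_sub_avg_e (F : Fin n → Fin m → Vec d → ℝ) (C : S → Vec d → Vec d)
    (Q : T → Vec d → Vec d) (γ α : ℝ) (s : State d n) (z : Fin n → Noise m S T) :
    (step F C Q γ α s z).x - avg (step F C Q γ α s z).e =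
      s.x - avg s.e - γ • avg (fun i => gLoc F s i (z i).1) := by
  simp only [step]
  rw [avg_sub, avg_add, avg_smul]
  abel

variable {F : Fin n → Fin m → Vec d → ℝ} {xs : Vec d} {L μ : ℝ}

lemma IsProblem.measurable_gHat (hF : IsProblem F xs L μ) (i : Fin n) :
    Measurable (fun a : State d n × Fin m => gHat F a.1 i a.2) := by
  refine measurable_from_prod_countable_left fun l => ?_
  unfold gHat
  exact (((hF.smooth i l).continuous_gradient.measurable.comp State.measurable_x).sub
    ((hF.smooth i l).continuous_gradient.measurable.comp (State.measurable_w i))).add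
    ((hF.smooth_local i).continuous_gradient.measurable.comp (State.measurable_w i))

lemma IsProblem.measurable_gLoc (hF : IsProblem F xs L μ) (i : Fin n) :
    Measurable (fun a : State d n × Fin m => gLoc F a.1 i a.2) := by
  unfold gLoc
  exact ((hF.measurable_gHat i).sub ((State.measurable_h i).comp measurable_fst)).add
    (measurable_avg fun j => (State.measurable_h j).comp measurable_fst)

variable [MeasurableSpace S] [MeasurableSpace T] {C : S → Vec d → Vec d} {Q : T → Vec d → Vec d}
  {νC : Measure S} {νQ : Measure T} {δ ω γ α : ℝ}

attribute [local irreducible] gHat gLoc avg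

variable (S T) in
lemma IsProblem.measurable_gLoc_noise (hF : IsProblem F xs L μ) (i : Fin n) :
    Measurable (Function.uncurry fun (s : State d n) (z : Noise m S T) => gLoc F s i z.1) := by
  have h : Measurable fun a : State d n × Noise m S T => (a.1, a.2.1) :=
    measurable_fst.prodMk measurable_snd.fst
  exact (hF.measurable_gLoc i).comp h

lemma IsProblem.measurable_errStep (hF : IsProblem F xs L μ) (hC : IsCompressor νC δ C) (γ : ℝ)
    (i : Fin n) :
    Measurable (Function.uncurry (errStep (T := T) F C γ i)) := by
  have h : Measurable (fun a : State d n × Noise m S T => a.1.e i + γ • gLoc F a.1 i a.2.1) :=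
    ((State.measurable_e i).comp measurable_fst).add
      ((hF.measurable_gLoc_noise S T i).const_smul γ)
  exact h.sub (hC.measurable.comp (measurable_snd.snd.snd.fst.prodMk h))

lemma IsProblem.measurable_shiftStep (hF : IsProblem F xs L μ) (hQ : IsQuantizer νQ ω Q) (α : ℝ)
    (i : Fin n) :
    Measurable (Function.uncurry (shiftStep (S := S) F Q α i)) := by
  have h0 : Measurable fun a : State d n × Noise m S T => (a.1, a.2.1) :=
    measurable_fst.prodMk measurable_snd.fst
  have h : Measurable (fun a : State d n × Noise m S T => gHat F a.1 i a.2.1 - a.1.h i) :=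
    ((hF.measurable_gHat i).comp h0).sub ((State.measurable_h i).comp measurable_fst)
  exact ((State.measurable_h i).comp measurable_fst).add
    ((hQ.measurable.comp (measurable_snd.snd.snd.snd.prodMk h)).const_smul α)

lemma measurable_refStep (i : Fin n) :
    Measurable (Function.uncurry (refStep (d := d) (m := m) (S := S) (T := T) i)) := by
  have hc : Measurable fun a : State d n × Noise m S T => a.2.2.1 := measurable_snd.snd.fst
  have hx : Measurable fun a : State d n × Noise m S T => a.1.x :=
    State.measurable_x.comp measurable_fst
  have hw : Measurable fun a : State d n × Noise m S T => a.1.w i :=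
    (State.measurable_w i).comp measurable_fst
  exact Measurable.ite (p := fun a : State d n × Noise m S T => a.2.2.1 = true)
    (hc (measurableSet_singleton true)) hx hw

lemma IsProblem.measurable_step (hF : IsProblem F xs L μ) (hC : IsCompressor νC δ C)
    (hQ : IsQuantizer νQ ω Q) :
    Measurable (fun a : State d n × (Fin n → Noise m S T) => step F C Q γ α a.1 a.2) := by
  have hz : ∀ i : Fin n, Measurable fun a : State d n × (Fin n → Noise m S T) => (a.1, a.2 i) :=
    fun i => measurable_fst.prodMk ((measurable_pi_apply i).comp measurable_snd)
  have he : ∀ i, Measurable fun a : State d n × (Fin n → Noise m S T) =>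
      (step F C Q γ α a.1 a.2).e i := fun i => (hF.measurable_errStep hC γ i).comp (hz i)
  have hg : ∀ i, Measurable fun a : State d n × (Fin n → Noise m S T) => gLoc F a.1 i (a.2 i).1 :=
    fun i => (hF.measurable_gLoc_noise S T i).comp (hz i)
  refine State.measurable_of ?_ he (fun i => (hF.measurable_shiftStep hQ α i).comp (hz i))
    (fun i => (measurable_refStep i).comp (hz i))
  -- The new `x` is recovered from the new errors and the virtual step, so only the errors require
  -- the measurability of the compressor.
  have h : ∀ a : State d n × (Fin n → Noise m S T), (step F C Q γ α a.1 a.2).x =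
      avg (step F C Q γ α a.1 a.2).e
        + (a.1.x - avg a.1.e - γ • avg (fun i => gLoc F a.1 i (a.2 i).1)) := by
    intro a
    rw [← step_x_sub_avg_e F C Q γ α]
    abel
  simp only [h]
  exact (measurable_avg he).add (((State.measurable_x.comp measurable_fst).sub
    (measurable_avg fun i => (State.measurable_e i).comp measurable_fst)).sub
    ((measurable_avg hg).const_smul γ))

lemma IsProblem.measurable_run {Ω : Type*} (hF : IsProblem F xs L μ) (hC : IsCompressor νC δ C)
    (hQ : IsQuantizer νQ ω Q) (x0 : Vec d) (h0 w0 : Fin n → Vec d)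
    (ξ : ℕ → Fin n → Ω → Noise m S T) (k : ℕ) :
    Measurable[history ξ k] (run F C Q γ α x0 h0 w0 ξ k) := by
  induction k with
  | zero => exact @measurable_const _ _ _ (history ξ 0) _
  | succ k ih =>
    have h1 : Measurable[history ξ (k + 1)] (run F C Q γ α x0 h0 w0 ξ k) :=
      ih.mono (history_mono ξ k.le_succ) le_rfl
    have h2 : Measurable[history ξ (k + 1)] (fun o i => ξ k i o) :=
      @measurable_pi_lambda _ _ _ (history ξ (k + 1)) _ _ fun i => measurable_history ξ k i
    exact (hF.measurable_step hC hQ).comp (h1.prodMk h2)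

end Measurability

/-! ### Averaging over one draw -/

section OneDraw

attribute [local irreducible] gHat gLoc avg

variable {d n m : ℕ} {S T : Type*} [MeasurableSpace S] [MeasurableSpace T]
  {F : Fin n → Fin m → Vec d → ℝ} {xs : Vec d} {L μ : ℝ}
  {C : S → Vec d → Vec d} {Q : T → Vec d → Vec d}
  {νC : Measure S} {νQ : Measure T} [IsProbabilityMeasure νC] [IsProbabilityMeasure νQ]
  {δ ω γ α p : ℝ}

lemma integrable_norm_errStep_sq (hm : 1 ≤ m) (hp : 0 ≤ p) (hp1 : p ≤ 1)
    (hC : IsCompressor νC δ C) (i : Fin n) (s : State d n) :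
    Integrable (fun z => ‖errStep (T := T) F C γ i s z‖ ^ 2) (noiseLaw m p νC νQ) := by
  refine integrable_noiseLaw_index_compressor hm hp hp1 (φ := fun l r =>
    ‖s.e i + γ • gLoc F s i l - C r (s.e i + γ • gLoc F s i l)‖ ^ 2) fun l => ?_
  simp only [norm_sub_rev _ (C _ _)]
  exact hC.integrable _

lemma integral_norm_errStep_sq_le (hm : 1 ≤ m) (hp : 0 ≤ p) (hp1 : p ≤ 1)
    (hC : IsCompressor νC δ C) (i : Fin n) (s : State d n) :
    ∫ z, ‖errStep (T := T) F C γ i s z‖ ^ 2 ∂(noiseLaw m p νC νQ) ≤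
      (1 - δ) * ((1 / (m : ℝ)) * ∑ l, ‖s.e i + γ • gLoc F s i l‖ ^ 2) := by
  have h : ∀ l, Integrable (fun r =>
      ‖s.e i + γ • gLoc F s i l - C r (s.e i + γ • gLoc F s i l)‖ ^ 2) νC := fun l => by
    simp only [norm_sub_rev _ (C _ _)]
    exact hC.integrable _
  refine (integral_noiseLaw_index_compressor hm hp hp1 (φ := fun l r =>
    ‖s.e i + γ • gLoc F s i l - C r (s.e i + γ • gLoc F s i l)‖ ^ 2) h).le.trans ?_
  rw [← mean_mul]
  refine mean_le_mean fun l => ?_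
  simp only [norm_sub_rev _ (C _ _)]
  exact hC.contraction _

/-- The quantized step towards `b`, seen from `c`, for a fixed argument of the quantizer. -/
lemma IsQuantizer.integrable_shift (hQ : IsQuantizer νQ ω Q) (h b c : Vec d) (α : ℝ) :
    Integrable (fun t => ‖h + α • Q t (b - h) - c‖ ^ 2) νQ := by
  have h1 : MemLp (fun t => Q t (b - h) - (b - h)) 2 νQ :=
    (memLp_two_iff_integrable_sq_norm ((hQ.integrable _).sub
      (integrable_const _)).aestronglyMeasurable).2 (hQ.integrable_sq _)
  have h2 := (h1.const_smul α).add (memLp_const (h + α • (b - h) - c))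
  have h3 := (memLp_two_iff_integrable_sq_norm h2.1).1 h2
  refine h3.congr (Filter.Eventually.of_forall fun t => ?_)
  simp only [Pi.add_apply, Pi.smul_apply]
  congr 2
  rw [smul_sub]
  abel

/-- The new shift, seen from `c`, is a convex combination `u` of `h - c` and `b - c` plus centred
noise of variance at most `α² ω ‖y‖²`. The strict convexity of the squared norm contributes
`-α(1-α)‖y‖²`, which absorbs this variance exactly when `α(ω+1) ≤ 1`. -/
lemma IsQuantizer.integral_shift_le (hQ : IsQuantizer νQ ω Q) (h b c : Vec d) (hα : 0 < α)
    (hαω : α * (ω + 1) ≤ 1) :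
    ∫ t, ‖h + α • Q t (b - h) - c‖ ^ 2 ∂νQ ≤ (1 - α) * ‖h - c‖ ^ 2 + α * ‖b - c‖ ^ 2 := by
  set u : Vec d := (1 - α) • (h - c) + α • (b - c) with hu
  set y : Vec d := b - h with hy
  have e1 : ∀ t, ‖h + α • Q t y - c‖ ^ 2 =
      ‖u‖ ^ 2 + 2 * α * inner ℝ u (Q t y - y) + α ^ 2 * ‖Q t y - y‖ ^ 2 := by
    intro t
    have : h + α • Q t y - c = u + α • (Q t y - y) := by
      rw [hu, hy]; module
    rw [this, norm_add_sq_real, inner_smul_right, norm_smul, mul_pow, Real.norm_eq_abs, sq_abs]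
    ring
  have hI1 : Integrable (fun t => Q t y - y) νQ := (hQ.integrable y).sub (integrable_const y)
  have hI2 : Integrable (fun t => inner ℝ u (Q t y - y)) νQ := hI1.const_inner u
  have e2 : ∫ t, inner ℝ u (Q t y - y) ∂νQ = 0 := by
    rw [integral_inner hI1, integral_sub (hQ.integrable y) (integrable_const y), hQ.unbiased]
    simp
  simp only [e1]
  have hI3 : Integrable (fun t => ‖u‖ ^ 2 + 2 * α * inner ℝ u (Q t y - y)) νQ :=
    (integrable_const _).add (hI2.const_mul _)
  rw [integral_add hI3 ((hQ.integrable_sq y).const_mul _),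
    integral_add (integrable_const _) (hI2.const_mul _), integral_const_mul, integral_const_mul,
    e2]
  simp only [integral_const, probReal_univ, smul_eq_mul, one_mul, mul_zero, add_zero]
  have e3 : ‖u‖ ^ 2 = _ := norm_convexComb_sq α (h - c) (b - c)
  have e4 : b - c - (h - c) = y := by rw [hy]; abel
  rw [e4] at e3
  have h5 := mul_le_mul_of_nonneg_left (hQ.variance y) (sq_nonneg α)
  have h6 : 0 ≤ α * (1 - α * (ω + 1)) * ‖y‖ ^ 2 :=
    mul_nonneg (mul_nonneg hα.le (by linarith)) (sq_nonneg _)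
  nlinarith

lemma integrable_norm_shiftStep_sub_sq (hm : 1 ≤ m) (hp : 0 ≤ p) (hp1 : p ≤ 1)
    (hQ : IsQuantizer νQ ω Q) (i : Fin n) (c : Vec d) (s : State d n) :
    Integrable (fun z => ‖shiftStep (S := S) F Q α i s z - c‖ ^ 2) (noiseLaw m p νC νQ) :=
  integrable_noiseLaw_index_quantizer hm hp hp1 (φ := fun l t =>
    ‖s.h i + α • Q t (gHat F s i l - s.h i) - c‖ ^ 2) fun _ => hQ.integrable_shift _ _ _ _

lemma integral_norm_shiftStep_sub_sq_le (hm : 1 ≤ m) (hp : 0 ≤ p) (hp1 : p ≤ 1)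
    (hQ : IsQuantizer νQ ω Q) (hα : 0 < α) (hαω : α * (ω + 1) ≤ 1) (i : Fin n) (c : Vec d)
    (s : State d n) :
    ∫ z, ‖shiftStep (S := S) F Q α i s z - c‖ ^ 2 ∂(noiseLaw m p νC νQ) ≤
      (1 - α) * ‖s.h i - c‖ ^ 2 + α * ((1 / (m : ℝ)) * ∑ l, ‖gHat F s i l - c‖ ^ 2) := by
  refine (integral_noiseLaw_index_quantizer hm hp hp1 (φ := fun l t =>
    ‖s.h i + α • Q t (gHat F s i l - s.h i) - c‖ ^ 2)
    fun l => hQ.integrable_shift _ _ _ _).le.trans ?_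
  rw [← mean_mul, ← mean_const hm ((1 - α) * ‖s.h i - c‖ ^ 2), ← mean_add]
  exact mean_le_mean fun l => hQ.integral_shift_le _ _ _ hα hαω

lemma integral_refStep (hm : 1 ≤ m) (hp : 0 ≤ p) (hp1 : p ≤ 1) (φ : Vec d → ℝ) (i : Fin n)
    (s : State d n) :
    ∫ z, φ (refStep (m := m) (S := S) (T := T) i s z) ∂(noiseLaw m p νC νQ) =
      p * φ s.x + (1 - p) * φ (s.w i) := by
  have := integral_noiseLaw_coin (νC := νC) (νQ := νQ) hm hp hp1
    (fun b => φ (if b = true then s.x else s.w i))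
  simpa [refStep] using this

end OneDraw

/-! ### Square integrability of the trajectory -/

/-- The standing hypotheses on the objective, the operators, the parameters and the draws. -/
structure IsSetting {d n m : ℕ} {S T Ω : Type*} [MeasurableSpace S] [MeasurableSpace T]
    [MeasurableSpace Ω] (F : Fin n → Fin m → Vec d → ℝ) (xs : Vec d) (L μ : ℝ) (νC : Measure S)
    (νQ : Measure T) (C : S → Vec d → Vec d) (Q : T → Vec d → Vec d) (δ ω γ α p : ℝ)
    (P : Measure Ω) (ξ : ℕ → Fin n → Ω → Noise m S T) : Prop where
  problem : IsProblem F xs L μ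
  δ_pos : 0 < δ
  δ_le_one : δ ≤ 1
  compressor : IsCompressor νC δ C
  quantizer : IsQuantizer νQ ω Q
  γ_pos : 0 < γ
  α_pos : 0 < α
  α_lt_one : α < 1
  α_mul_le : α * (ω + 1) ≤ 1
  p_pos : 0 < p
  p_lt_one : p < 1
  noise : IsNoise P p νC νQ ξ

/-- All components of the random state are square integrable. -/
structure SqIntegrable {d n : ℕ} {Ω : Type*} [MeasurableSpace Ω] (P : Measure Ω)
    (st : Ω → State d n) : Prop where
  x : MemLp (fun o => (st o).x) 2 P
  e : ∀ i, MemLp (fun o => (st o).e i) 2 P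
  h : ∀ i, MemLp (fun o => (st o).h i) 2 P
  w : ∀ i, MemLp (fun o => (st o).w i) 2 P

section L2

variable {d n m : ℕ} {Ω : Type*} [MeasurableSpace Ω] {P : Measure Ω}
  {F : Fin n → Fin m → Vec d → ℝ} {xs : Vec d} {L μ : ℝ} {st : Ω → State d n}

lemma integrable_norm_sq {f : Ω → Vec d} (hf : MemLp f 2 P) : Integrable (fun o => ‖f o‖ ^ 2) P :=
  (memLp_two_iff_integrable_sq_norm hf.1).1 hf

lemma memLp_avg {v : Fin n → Ω → Vec d} (hv : ∀ i, MemLp (v i) 2 P) :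
    MemLp (fun o => avg fun i => v i o) 2 P :=
  (memLp_finsetSum Finset.univ fun i _ => hv i).const_smul (1 / (n : ℝ))

lemma integrable_mean {u : Fin n → Ω → ℝ} (hu : ∀ i, Integrable (u i) P) :
    Integrable (fun o => (1 / (n : ℝ)) * ∑ i, u i o) P :=
  (integrable_finsetSum _ fun i _ => hu i).const_mul _

variable [IsProbabilityMeasure P]

lemma IsLSmooth.memLp_gradient {f : Vec d → ℝ} (hf : IsLSmooth L f) {X : Ω → Vec d}
    (hX : MemLp X 2 P) : MemLp (fun o => gradient f (X o)) 2 P := by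
  have h : MemLp (fun o => gradient f (X o) - gradient f 0) 2 P := by
    refine MemLp.of_le_mul (c := L) hX
      ((hf.continuous_gradient.comp_aestronglyMeasurable hX.1).sub aestronglyMeasurable_const)
      (Filter.Eventually.of_forall fun o => ?_)
    simpa using hf.2 (X o) 0
  refine (h.add (memLp_const (gradient f 0))).ae_eq (Filter.Eventually.of_forall fun o => ?_)
  simp

lemma IsProblem.integrable_gap (hF : IsProblem F xs L μ) {X : Ω → Vec d} (hX : MemLp X 2 P) :
    Integrable (fun o => loss F (X o) - loss F xs) P := by
  have h : Integrable (fun o => L / 2 * ‖X o - xs‖ ^ 2) P :=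
    (integrable_norm_sq (hX.sub (memLp_const xs))).const_mul _
  refine h.mono' ?_ (Filter.Eventually.of_forall fun o => ?_)
  · exact (hF.smooth_loss.1.continuous.comp_aestronglyMeasurable hX.1).sub
      aestronglyMeasurable_const
  · rw [Real.norm_of_nonneg (hF.gap_nonneg _)]
    exact hF.gap_le _

lemma SqIntegrable.memLp_gHat (hF : IsProblem F xs L μ) (hst : SqIntegrable P st) (i : Fin n)
    (l : Fin m) : MemLp (fun o => gHat F (st o) i l) 2 P :=
  (((hF.smooth i l).memLp_gradient hst.x).sub ((hF.smooth i l).memLp_gradient (hst.w i))).add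
    ((hF.smooth_local i).memLp_gradient (hst.w i))

lemma SqIntegrable.memLp_gHat_index (hF : IsProblem F xs L μ) (hst : SqIntegrable P st)
    (hmeas : Measurable st) (i : Fin n) {ℓ : Ω → Fin m} (hl : Measurable ℓ) :
    MemLp (fun o => gHat F (st o) i (ℓ o)) 2 P := by
  -- The random index is removed by dominating with the sum over all indices.
  have h : MemLp (fun o => ∑ l, ‖gHat F (st o) i l‖) 2 P :=
    memLp_finsetSum _ fun l _ => (hst.memLp_gHat hF i l).norm
  have hm : Measurable fun o => gHat F (st o) i (ℓ o) := by
    have h2 := (hF.measurable_gHat i).comp (hmeas.prodMk hl)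
    exact h2
  refine h.of_le hm.aestronglyMeasurable (Filter.Eventually.of_forall fun o => ?_)
  rw [Real.norm_of_nonneg (by positivity)]
  exact Finset.single_le_sum (f := fun l => ‖gHat F (st o) i l‖) (fun _ _ => norm_nonneg _)
    (Finset.mem_univ _)

lemma SqIntegrable.memLp_gLoc (hF : IsProblem F xs L μ) (hst : SqIntegrable P st) (i : Fin n)
    (l : Fin m) : MemLp (fun o => gLoc F (st o) i l) 2 P :=
  ((hst.memLp_gHat hF i l).sub (hst.h i)).add (memLp_avg hst.h)

lemma SqIntegrable.memLp_gLoc_index (hF : IsProblem F xs L μ) (hst : SqIntegrable P st)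
    (hmeas : Measurable st) (i : Fin n) {ℓ : Ω → Fin m} (hl : Measurable ℓ) :
    MemLp (fun o => gLoc F (st o) i (ℓ o)) 2 P :=
  ((hst.memLp_gHat_index hF hmeas i hl).sub (hst.h i)).add (memLp_avg hst.h)

lemma SqIntegrable.memLp_gBar (hF : IsProblem F xs L μ) (hst : SqIntegrable P st) (i : Fin n) :
    MemLp (fun o => gBar F (st o) i) 2 P :=
  (((hF.smooth_local i).memLp_gradient hst.x).sub (hst.h i)).add (memLp_avg hst.h)

lemma SqIntegrable.integrable_sigma1Sq (hst : SqIntegrable P st) :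
    Integrable (fun o => sigma1Sq F xs (st o).h) P :=
  integrable_mean fun i => integrable_norm_sq ((hst.h i).sub (memLp_const _))

lemma SqIntegrable.integrable_sigma2Sq (hF : IsProblem F xs L μ) (hst : SqIntegrable P st) :
    Integrable (fun o => sigma2Sq F xs (st o).w) P := by
  simp only [sigma2Sq_eq_mean]
  exact integrable_mean fun i => integrable_mean fun j =>
    integrable_norm_sq (((hF.smooth i j).memLp_gradient (hst.w i)).sub (memLp_const _))

end L2

namespace IsSetting

variable {d n m : ℕ} {S T Ω : Type*} [MeasurableSpace S] [MeasurableSpace T] [MeasurableSpace Ω]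
  {F : Fin n → Fin m → Vec d → ℝ} {xs : Vec d} {L μ : ℝ} {νC : Measure S} {νQ : Measure T}
  {C : S → Vec d → Vec d} {Q : T → Vec d → Vec d} {δ ω γ α p : ℝ}
  {P : Measure Ω} {ξ : ℕ → Fin n → Ω → Noise m S T}

lemma law (hs : IsSetting F xs L μ νC νQ C Q δ ω γ α p P ξ) (k : ℕ) (i : Fin n) :
    P.map (ξ k i) = noiseLaw m p νC νQ :=
  hs.noise.law k i

lemma measurable_run (hs : IsSetting F xs L μ νC νQ C Q δ ω γ α p P ξ) (x0 : Vec d)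
    (h0 w0 : Fin n → Vec d) (k : ℕ) :
    Measurable[history ξ k] (run F C Q γ α x0 h0 w0 ξ k) :=
  hs.problem.measurable_run hs.compressor hs.quantizer x0 h0 w0 ξ k

lemma measurable_run' (hs : IsSetting F xs L μ νC νQ C Q δ ω γ α p P ξ) (x0 : Vec d)
    (h0 w0 : Fin n → Vec d) (k : ℕ) : Measurable (run F C Q γ α x0 h0 w0 ξ k) :=
  (hs.measurable_run x0 h0 w0 k).mono (hs.noise.history_le k) le_rfl

attribute [local irreducible] gHat gLoc avg

variable [IsProbabilityMeasure νC] [IsProbabilityMeasure νQ] [IsProbabilityMeasure P]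

/-- Square integrability is propagated by induction with the same frozen one-step bounds that later
give the rates. -/
lemma sqIntegrable_run (hs : IsSetting F xs L μ νC νQ C Q δ ω γ α p P ξ) (x0 : Vec d)
    (h0 w0 : Fin n → Vec d) (k : ℕ) : SqIntegrable P (run F C Q γ α x0 h0 w0 ξ k) := by
  have hm := hs.problem.one_le_m
  have hp := hs.p_pos.le
  have hp1 := hs.p_lt_one.le
  induction k with
  | zero => exact ⟨memLp_const _, fun _ => memLp_const _, fun _ => memLp_const _,
      fun _ => memLp_const _⟩
  | succ k ih =>
    have hX := hs.measurable_run x0 h0 w0 k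
    have hX' := hs.measurable_run' x0 h0 w0 k
    have hξ := hs.noise.measurable k
    have he : ∀ i, MemLp (fun o => (run F C Q γ α x0 h0 w0 ξ (k + 1) o).e i) 2 P := by
      intro i
      have hme := hs.problem.measurable_errStep (T := T) hs.compressor γ i
      have hB : Integrable (fun o => (1 - δ) * ((1 / (m : ℝ)) * ∑ l,
          ‖(run F C Q γ α x0 h0 w0 ξ k o).e i
            + γ • gLoc F (run F C Q γ α x0 h0 w0 ξ k o) i l‖ ^ 2)) P :=
        (integrable_mean fun l => integrable_norm_sq
          ((ih.e i).add ((ih.memLp_gLoc hs.problem i l).const_smul γ))).const_mul _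
      refine (memLp_two_iff_integrable_sq_norm ?_).2 ?_
      · exact (hme.comp (hX'.prodMk (hξ i))).aestronglyMeasurable
      · exact integrable_comp_prodMk (hs.noise.history_le k) hX (hξ i) (hs.law k i)
          (hs.noise.indep_history k i)
          (Φ := fun s z => ‖errStep F C γ i s z‖ ^ 2)
          (hme.norm.pow_const 2).stronglyMeasurable (fun _ _ => sq_nonneg _)
          (fun s => integrable_norm_errStep_sq hm hp hp1 hs.compressor i s) hB
          (fun o => integral_norm_errStep_sq_le hm hp hp1 hs.compressor i _)
    have hg : ∀ i, MemLp (fun o => gLoc F (run F C Q γ α x0 h0 w0 ξ k o) i (ξ k i o).1) 2 P :=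
      fun i => ih.memLp_gLoc_index hs.problem hX' i (hξ i).fst
    refine ⟨?_, he, fun i => ?_, fun i => ?_⟩
    -- The iterate is the new average error plus the virtual step, both already known to be square
    -- integrable.
    · have h : (fun o => (run F C Q γ α x0 h0 w0 ξ (k + 1) o).x) = fun o =>
          avg (run F C Q γ α x0 h0 w0 ξ (k + 1) o).e
          + ((run F C Q γ α x0 h0 w0 ξ k o).x - avg (run F C Q γ α x0 h0 w0 ξ k o).e
            - γ • avg (fun i => gLoc F (run F C Q γ α x0 h0 w0 ξ k o) i (ξ k i o).1)) := by
        ext1 o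
        have := step_x_sub_avg_e F C Q γ α (run F C Q γ α x0 h0 w0 ξ k o) (fun i => ξ k i o)
        rw [← this]
        exact (add_sub_cancel _ _).symm
      rw [h]
      exact (memLp_avg he).add ((ih.x.sub (memLp_avg ih.e)).sub ((memLp_avg hg).const_smul γ))
    · have hmh := hs.problem.measurable_shiftStep (S := S) hs.quantizer α i
      have hmh' : Measurable fun o => shiftStep F Q α i (run F C Q γ α x0 h0 w0 ξ k o) (ξ k i o) :=
        hmh.comp (hX'.prodMk (hξ i))
      -- The reference point `c = 0` in the shift bound turns it into a bound on the shift itself.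
      have hB : Integrable (fun o => (1 - α) * ‖(run F C Q γ α x0 h0 w0 ξ k o).h i - 0‖ ^ 2
          + α * ((1 / (m : ℝ)) * ∑ l, ‖gHat F (run F C Q γ α x0 h0 w0 ξ k o) i l - 0‖ ^ 2)) P := by
        simp only [sub_zero]
        exact ((integrable_norm_sq (ih.h i)).const_mul _).add ((integrable_mean fun l =>
          integrable_norm_sq (ih.memLp_gHat hs.problem i l)).const_mul _)
      have := integrable_comp_prodMk (hs.noise.history_le k) hX (hξ i) (hs.law k i)
          (hs.noise.indep_history k i)
          (Φ := fun s z => ‖shiftStep F Q α i s z - 0‖ ^ 2)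
          ((hmh.sub_const 0).norm.pow_const 2).stronglyMeasurable (fun _ _ => sq_nonneg _)
          (fun s => integrable_norm_shiftStep_sub_sq hm hp hp1 hs.quantizer i 0 s) hB
          (fun o => integral_norm_shiftStep_sub_sq_le hm hp hp1 hs.quantizer hs.α_pos
            hs.α_mul_le i 0 _)
      simp only [sub_zero] at this
      exact (memLp_two_iff_integrable_sq_norm hmh'.aestronglyMeasurable).2 this
    · have hmw : Measurable fun o => refStep i (run F C Q γ α x0 h0 w0 ξ k o) (ξ k i o) :=
        (measurable_refStep i).comp (hX'.prodMk (hξ i))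
      refine MemLp.of_le (ih.x.norm.add (ih.w i).norm) hmw.aestronglyMeasurable
        (Filter.Eventually.of_forall fun o => ?_)
      simp only [Pi.add_apply]
      rw [Real.norm_of_nonneg (by positivity)]
      change ‖refStep i (run F C Q γ α x0 h0 w0 ξ k o) (ξ k i o)‖ ≤ _
      unfold refStep
      split_ifs
      · linarith [norm_nonneg ((run F C Q γ α x0 h0 w0 ξ k o).w i)]
      · linarith [norm_nonneg (run F C Q γ α x0 h0 w0 ξ k o).x]

end IsSetting

/-! ### Conditional expectations along the trajectory -/

lemma measurable_sigma1Sq {d n m : ℕ} (F : Fin n → Fin m → Vec d → ℝ) (xs : Vec d) :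
    Measurable (fun s : State d n => sigma1Sq F xs s.h) := by
  unfold sigma1Sq
  exact (Finset.measurable_sum _ fun i _ =>
    (((State.measurable_h i).sub_const _).norm.pow_const 2)).const_mul _

lemma IsProblem.measurable_norm_gradient_sub {d n m : ℕ} {F : Fin n → Fin m → Vec d → ℝ}
    {xs : Vec d} {L μ : ℝ} (hF : IsProblem F xs L μ) (i : Fin n) :
    Measurable (fun v : Vec d =>
      (1 / (m : ℝ)) * ∑ j, ‖gradient (F i j) v - gradient (F i j) xs‖ ^ 2) :=
  (Finset.measurable_sum _ fun j _ =>
    (((hF.smooth i j).continuous_gradient.measurable.sub_const _).norm.pow_const 2)).const_mul _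

lemma IsProblem.measurable_sigma2Sq {d n m : ℕ} {F : Fin n → Fin m → Vec d → ℝ} {xs : Vec d}
    {L μ : ℝ} (hF : IsProblem F xs L μ) :
    Measurable (fun s : State d n => sigma2Sq F xs s.w) := by
  simp only [sigma2Sq_eq_mean]
  exact (Finset.measurable_sum _ fun i _ =>
    (hF.measurable_norm_gradient_sub i).comp (State.measurable_w i)).const_mul _

lemma condExp_mean {n : ℕ} {Ω : Type*} {m mΩ : MeasurableSpace Ω} {P : Measure Ω}
    {Y : Fin n → Ω → ℝ} (hY : ∀ i, Integrable (Y i) P) :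
    P[fun o => (1 / (n : ℝ)) * ∑ i, Y i o | m] =ᵐ[P]
      fun o => (1 / (n : ℝ)) * ∑ i, (P[Y i | m]) o := by
  have h1 : (fun o => (1 / (n : ℝ)) * ∑ i, Y i o) = (1 / (n : ℝ)) • ∑ i, Y i := by
    ext o; simp
  rw [h1]
  filter_upwards [condExp_smul (μ := P) (1 / (n : ℝ)) (∑ i, Y i) m,
    condExp_finsetSum (μ := P) (s := Finset.univ) (fun i _ => hY i) m] with o h2 h3
  rw [h2, Pi.smul_apply, h3]
  simp

lemma condExp_avg {d n : ℕ} {Ω : Type*} {m mΩ : MeasurableSpace Ω} {P : Measure Ω}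
    {Y : Fin n → Ω → Vec d} (hY : ∀ i, Integrable (Y i) P) :
    P[fun o => avg (fun i => Y i o) | m] =ᵐ[P] fun o => avg (fun i => (P[Y i | m]) o) := by
  have h1 : (fun o => avg (fun i => Y i o)) = (1 / (n : ℝ)) • ∑ i, Y i := by
    ext1 o; simp [avg]
  rw [h1]
  filter_upwards [condExp_smul (μ := P) (1 / (n : ℝ)) (∑ i, Y i) m,
    condExp_finsetSum (μ := P) (s := Finset.univ) (fun i _ => hY i) m] with o h2 h3
  rw [h2, Pi.smul_apply, h3]
  simp [avg]

namespace IsSetting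

attribute [local irreducible] gHat gLoc gBar avg

variable {d n m : ℕ} {S T Ω : Type*} [MeasurableSpace S] [MeasurableSpace T] [MeasurableSpace Ω]
  {F : Fin n → Fin m → Vec d → ℝ} {xs : Vec d} {L μ : ℝ} {νC : Measure S} {νQ : Measure T}
  {C : S → Vec d → Vec d} {Q : T → Vec d → Vec d} {δ ω γ α p : ℝ}
  {P : Measure Ω} {ξ : ℕ → Fin n → Ω → Noise m S T}

lemma integral_gLoc [IsProbabilityMeasure νC] [IsProbabilityMeasure νQ]
    (hs : IsSetting F xs L μ νC νQ C Q δ ω γ α p P ξ)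
    (s : State d n) (i : Fin n) : ∫ z, gLoc F s i z.1 ∂(noiseLaw m p νC νQ) = gBar F s i := by
  rw [integral_noiseLaw_index hs.problem.one_le_m hs.p_pos.le hs.p_lt_one.le
    (fun l => gLoc F s i l), ← hs.problem.avg_gLoc, avg]

variable [IsProbabilityMeasure P]

lemma condExp_draw {E : Type*} [NormedAddCommGroup E] [NormedSpace ℝ E] [CompleteSpace E]
    (hs : IsSetting F xs L μ νC νQ C Q δ ω γ α p P ξ)
    (x0 : Vec d) (h0 w0 : Fin n → Vec d) (k : ℕ) (i : Fin n) {Φ : State d n → Noise m S T → E}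
    (hΦ : StronglyMeasurable (Function.uncurry Φ))
    (hI : Integrable (fun o => Φ (run F C Q γ α x0 h0 w0 ξ k o) (ξ k i o)) P) :
    P[fun o => Φ (run F C Q γ α x0 h0 w0 ξ k o) (ξ k i o) | history ξ k] =ᵐ[P]
      fun o => ∫ z, Φ (run F C Q γ α x0 h0 w0 ξ k o) z ∂(noiseLaw m p νC νQ) :=
  condExp_comp_prodMk (hs.noise.history_le k) (hs.measurable_run x0 h0 w0 k)
    (hs.noise.measurable k i) (hs.law k i) (hs.noise.indep_history k i) hΦ hI

lemma condExp_mean_draw (hs : IsSetting F xs L μ νC νQ C Q δ ω γ α p P ξ)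
    (x0 : Vec d) (h0 w0 : Fin n → Vec d) (k : ℕ) {Φ : Fin n → State d n → Noise m S T → ℝ}
    (hΦ : ∀ i, Measurable (Function.uncurry (Φ i)))
    (hI : ∀ i, Integrable (fun o => Φ i (run F C Q γ α x0 h0 w0 ξ k o) (ξ k i o)) P) :
    P[fun o => (1 / (n : ℝ)) * ∑ i, Φ i (run F C Q γ α x0 h0 w0 ξ k o) (ξ k i o) | history ξ k]
      =ᵐ[P] fun o => (1 / (n : ℝ)) *
        ∑ i, ∫ z, Φ i (run F C Q γ α x0 h0 w0 ξ k o) z ∂(noiseLaw m p νC νQ) := by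
  have h : ∀ᵐ o ∂P, ∀ i, (P[fun o => Φ i (run F C Q γ α x0 h0 w0 ξ k o) (ξ k i o) | history ξ k]) o
      = ∫ z, Φ i (run F C Q γ α x0 h0 w0 ξ k o) z ∂(noiseLaw m p νC νQ) :=
    ae_all_iff.2 fun i => hs.condExp_draw x0 h0 w0 k i (hΦ i).stronglyMeasurable (hI i)
  filter_upwards [condExp_mean (m := history ξ k) hI, h] with o h1 h2
  rw [h1]
  simp only [h2]

variable [IsProbabilityMeasure νC] [IsProbabilityMeasure νQ]

lemma memLp_gLoc (hs : IsSetting F xs L μ νC νQ C Q δ ω γ α p P ξ)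
    (x0 : Vec d) (h0 w0 : Fin n → Vec d) (k : ℕ) (i : Fin n) :
    MemLp (fun o => gLoc F (run F C Q γ α x0 h0 w0 ξ k o) i (ξ k i o).1) 2 P :=
  (hs.sqIntegrable_run x0 h0 w0 k).memLp_gLoc_index hs.problem (hs.measurable_run' x0 h0 w0 k) i
    (hs.noise.measurable k i).fst

lemma condExp_gLoc (hs : IsSetting F xs L μ νC νQ C Q δ ω γ α p P ξ)
    (x0 : Vec d) (h0 w0 : Fin n → Vec d) (k : ℕ) (i : Fin n) :
    P[fun o => gLoc F (run F C Q γ α x0 h0 w0 ξ k o) i (ξ k i o).1 | history ξ k] =ᵐ[P]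
      fun o => gBar F (run F C Q γ α x0 h0 w0 ξ k o) i := by
  have h := hs.condExp_draw x0 h0 w0 k i (Φ := fun s z => gLoc F s i z.1)
    (hs.problem.measurable_gLoc_noise S T i).stronglyMeasurable
    ((hs.memLp_gLoc x0 h0 w0 k i).integrable one_le_two)
  simpa only [hs.integral_gLoc] using h

/-- The inner conditional expectation is first replaced by its explicit version `gBar`, a function
of the state, so that the freezing principle applies. -/
lemma condExp_variance (hs : IsSetting F xs L μ νC νQ C Q δ ω γ α p P ξ)
    (x0 : Vec d) (h0 w0 : Fin n → Vec d) (k : ℕ) (i : Fin n) :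
    P[fun o => ‖gLoc F (run F C Q γ α x0 h0 w0 ξ k o) i (ξ k i o).1 -
        (P[fun o => gLoc F (run F C Q γ α x0 h0 w0 ξ k o) i (ξ k i o).1 | history ξ k]) o‖ ^ 2
        | history ξ k] =ᵐ[P]
      fun o => (1 / (m : ℝ)) * ∑ l, ‖gLoc F (run F C Q γ α x0 h0 w0 ξ k o) i l -
        gBar F (run F C Q γ α x0 h0 w0 ξ k o) i‖ ^ 2 := by
  have hst := hs.sqIntegrable_run x0 h0 w0 k
  have h1 : P[fun o => ‖gLoc F (run F C Q γ α x0 h0 w0 ξ k o) i (ξ k i o).1 -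
        (P[fun o => gLoc F (run F C Q γ α x0 h0 w0 ξ k o) i (ξ k i o).1 | history ξ k]) o‖ ^ 2
        | history ξ k] =ᵐ[P] P[fun o => ‖gLoc F (run F C Q γ α x0 h0 w0 ξ k o) i (ξ k i o).1 -
        gBar F (run F C Q γ α x0 h0 w0 ξ k o) i‖ ^ 2 | history ξ k] := by
    refine condExp_congr_ae ?_
    filter_upwards [hs.condExp_gLoc x0 h0 w0 k i] with o ho
    rw [ho]
  have hbar : Measurable (fun s : State d n => gBar F s i) := by
    have : (fun s : State d n => gBar F s i) = fun s => avg fun l => gLoc F s i l := by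
      ext1 s; exact (hs.problem.avg_gLoc s i).symm
    rw [this]
    exact measurable_avg fun l => (hs.problem.measurable_gLoc i).comp
      (measurable_id.prodMk (measurable_const (a := l)))
  have hmeas : Measurable (Function.uncurry fun (s : State d n) (z : Noise m S T) =>
      ‖gLoc F s i z.1 - gBar F s i‖ ^ 2) :=
    (((hs.problem.measurable_gLoc_noise S T i).sub (hbar.comp measurable_fst)).norm.pow_const 2)
  refine h1.trans ((hs.condExp_draw x0 h0 w0 k i hmeas.stronglyMeasurable ?_).trans ?_)
  · exact integrable_norm_sq ((hs.memLp_gLoc x0 h0 w0 k i).sub (hst.memLp_gBar hs.problem i))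
  · refine Filter.Eventually.of_forall fun o => ?_
    exact integral_noiseLaw_index hs.problem.one_le_m hs.p_pos.le hs.p_lt_one.le
      (fun l => ‖gLoc F (run F C Q γ α x0 h0 w0 ξ k o) i l -
        gBar F (run F C Q γ α x0 h0 w0 ξ k o) i‖ ^ 2)

/-- Since the shifts cancel and the `∇f_i(x*)` average to zero, `g` is the mean of `ĝ_i - ∇f_i(x*)`;
convexity of the squared norm reduces it to a mean over workers. -/
lemma condExp_second_moment_le (hs : IsSetting F xs L μ νC νQ C Q δ ω γ α p P ξ)
    (x0 : Vec d) (h0 w0 : Fin n → Vec d) (k : ℕ) :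
    ∀ᵐ o ∂P, (P[fun o => ‖avg fun i => gLoc F (run F C Q γ α x0 h0 w0 ξ k o) i (ξ k i o).1‖ ^ 2
        | history ξ k]) o ≤
      4 * L * (loss F (run F C Q γ α x0 h0 w0 ξ k o).x - loss F xs)
        + 2 * sigma2Sq F xs (run F C Q γ α x0 h0 w0 ξ k o).w := by
  have hst := hs.sqIntegrable_run x0 h0 w0 k
  have hF := hs.problem
  have hI : ∀ i, Integrable (fun o => ‖gHat F (run F C Q γ α x0 h0 w0 ξ k o) i (ξ k i o).1 -
      gradient (localLoss F i) xs‖ ^ 2) P := fun i => integrable_norm_sq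
    ((hst.memLp_gHat_index hF (hs.measurable_run' x0 h0 w0 k) i
      (hs.noise.measurable k i).fst).sub (memLp_const _))
  have hmeas : ∀ i, Measurable (Function.uncurry fun (s : State d n) (z : Noise m S T) =>
      ‖gHat F s i z.1 - gradient (localLoss F i) xs‖ ^ 2) := fun i => by
    have h : Measurable fun a : State d n × Noise m S T => (a.1, a.2.1) :=
      measurable_fst.prodMk measurable_snd.fst
    exact ((((hF.measurable_gHat i).comp h).sub_const _).norm.pow_const 2)
  have h1 := hs.condExp_mean_draw x0 h0 w0 k hmeas hI
  have h2 := condExp_mono (μ := P) (m := history ξ k)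
    (integrable_norm_sq (memLp_avg fun i => hs.memLp_gLoc x0 h0 w0 k i)) (integrable_mean hI)
    (Filter.Eventually.of_forall fun o => by
      simp only
      have e : avg (fun i => gLoc F (run F C Q γ α x0 h0 w0 ξ k o) i (ξ k i o).1) =
          avg fun i => gHat F (run F C Q γ α x0 h0 w0 ξ k o) i (ξ k i o).1 -
            gradient (localLoss F i) xs := by
        rw [hF.avg_gLoc_eq_avg_gHat, avg_sub, ← hF.gradient_loss, hF.gradient_loss_min, sub_zero]
      rw [e]
      exact norm_avg_sq_le hF.one_le_n _)
  filter_upwards [h1, h2] with o h1 h2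
  refine h2.trans (h1.le.trans (le_trans (le_of_eq ?_)
    (hF.mean_gHat_sub_sq_le (run F C Q γ α x0 h0 w0 ξ k o))))
  congr 2 with i
  exact integral_noiseLaw_index hF.one_le_m hs.p_pos.le hs.p_lt_one.le
    (fun l => ‖gHat F (run F C Q γ α x0 h0 w0 ξ k o) i l - gradient (localLoss F i) xs‖ ^ 2)

lemma condExp_sigma1Sq_le (hs : IsSetting F xs L μ νC νQ C Q δ ω γ α p P ξ)
    (x0 : Vec d) (h0 w0 : Fin n → Vec d) (k : ℕ) :
    ∀ᵐ o ∂P, (P[fun o => sigma1Sq F xs (run F C Q γ α x0 h0 w0 ξ (k + 1) o).h | history ξ k]) o ≤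
      (1 - α) * sigma1Sq F xs (run F C Q γ α x0 h0 w0 ξ k o).h
        + 2 * (3 * L * α) * (loss F (run F C Q γ α x0 h0 w0 ξ k o).x - loss F xs)
        + 2 * α * sigma2Sq F xs (run F C Q γ α x0 h0 w0 ξ k o).w := by
  have h1 := hs.condExp_mean_draw x0 h0 w0 k
    (Φ := fun i s z => ‖shiftStep F Q α i s z - gradient (localLoss F i) xs‖ ^ 2)
    (fun i => ((hs.problem.measurable_shiftStep hs.quantizer α i).sub_const _).norm.pow_const 2)
    (fun i => integrable_norm_sq
      (((hs.sqIntegrable_run x0 h0 w0 (k + 1)).h i).sub (memLp_const _)))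
  filter_upwards [h1] with o h1
  refine h1.le.trans ((mean_le_mean fun i => ?_).trans
    (hs.problem.mean_shift_step_le hs.α_pos (run F C Q γ α x0 h0 w0 ξ k o)))
  exact integral_norm_shiftStep_sub_sq_le hs.problem.one_le_m hs.p_pos.le hs.p_lt_one.le
    hs.quantizer hs.α_pos hs.α_mul_le i _ _

lemma condExp_sigma2Sq_le (hs : IsSetting F xs L μ νC νQ C Q δ ω γ α p P ξ)
    (x0 : Vec d) (h0 w0 : Fin n → Vec d) (k : ℕ) :
    ∀ᵐ o ∂P, (P[fun o => sigma2Sq F xs (run F C Q γ α x0 h0 w0 ξ (k + 1) o).w | history ξ k]) o ≤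
      (1 - p) * sigma2Sq F xs (run F C Q γ α x0 h0 w0 ξ k o).w
        + 2 * (L * p) * (loss F (run F C Q γ α x0 h0 w0 ξ k o).x - loss F xs) := by
  have hF := hs.problem
  have hst := hs.sqIntegrable_run x0 h0 w0 (k + 1)
  have h1 := hs.condExp_mean_draw x0 h0 w0 k
    (Φ := fun i s z => (1 / (m : ℝ)) * ∑ j,
      ‖gradient (F i j) (refStep i s z) - gradient (F i j) xs‖ ^ 2)
    (fun i => (hF.measurable_norm_gradient_sub i).comp (measurable_refStep i))
    (fun i => integrable_mean fun j => integrable_norm_sq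
      (((hF.smooth i j).memLp_gradient (hst.w i)).sub (memLp_const _)))
  have e : (fun o => sigma2Sq F xs (run F C Q γ α x0 h0 w0 ξ (k + 1) o).w) = fun o =>
      (1 / (n : ℝ)) * ∑ i, (1 / (m : ℝ)) * ∑ j,
        ‖gradient (F i j) (refStep i (run F C Q γ α x0 h0 w0 ξ k o) (ξ k i o)) -
          gradient (F i j) xs‖ ^ 2 := by
    ext1 o
    exact sigma2Sq_eq_mean F xs _
  rw [e]
  filter_upwards [h1] with o h1
  refine h1.le.trans (le_trans (le_of_eq ?_)
    (hF.mean_reference_step_le hs.p_pos (run F C Q γ α x0 h0 w0 ξ k o)))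
  congr 2 with i
  rw [integral_refStep hF.one_le_m hs.p_pos.le hs.p_lt_one.le (fun v => (1 / (m : ℝ)) * ∑ j,
      ‖gradient (F i j) v - gradient (F i j) xs‖ ^ 2), mean_add, mean_mul, mean_mul]

theorem parametricAssumption (hs : IsSetting F xs L μ νC νQ C Q δ ω γ α p P ξ)
    (x0 : Vec d) (h0 w0 : Fin n → Vec d) :
    ParametricAssumption P (history ξ) (loss F) xs
      (fun k o => (run F C Q γ α x0 h0 w0 ξ k o).x)
      (fun k i o => gLoc F (run F C Q γ α x0 h0 w0 ξ k o) i (ξ k i o).1)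
      (fun k o => sigma1Sq F xs (run F C Q γ α x0 h0 w0 ξ k o).h)
      (fun k o => sigma2Sq F xs (run F C Q γ α x0 h0 w0 ξ k o).w) (params L μ γ δ α p) where
  nonneg := by
    have := hs.problem.L_pos
    have := hs.α_pos
    have := hs.p_pos
    simp only [params]
    refine ⟨?_, ?_, ?_, ?_, ?_, ?_, ?_, ?_, ?_, ?_, ?_, ?_, ?_, ?_, ?_, ?_, ?_⟩ <;> positivity
  rho1_mem := ⟨hs.α_pos.le, hs.α_lt_one.le⟩
  rho2_mem := ⟨hs.p_pos.le, hs.p_lt_one.le⟩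
  x_known k := (State.measurable_x.comp (hs.measurable_run x0 h0 w0 k)).stronglyMeasurable
  s1_known k := ((measurable_sigma1Sq F xs).comp
    (hs.measurable_run x0 h0 w0 k)).stronglyMeasurable
  s2_known k := (hs.problem.measurable_sigma2Sq.comp
    (hs.measurable_run x0 h0 w0 k)).stronglyMeasurable
  s1_integrable k := (hs.sqIntegrable_run x0 h0 w0 k).integrable_sigma1Sq
  s2_integrable k := (hs.sqIntegrable_run x0 h0 w0 k).integrable_sigma2Sq hs.problem
  f_integrable k := by
    have := (hs.problem.integrable_gap (hs.sqIntegrable_run x0 h0 w0 k).x).add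
      (integrable_const (loss F xs))
    refine this.congr (Filter.Eventually.of_forall fun o => ?_)
    simp
  g_memLp k i := hs.memLp_gLoc x0 h0 w0 k i
  unbiased k := by
    have h : ∀ᵐ o ∂P, ∀ i, (P[fun o => gLoc F (run F C Q γ α x0 h0 w0 ξ k o) i (ξ k i o).1
        | history ξ k]) o = gBar F (run F C Q γ α x0 h0 w0 ξ k o) i :=
      ae_all_iff.2 fun i => hs.condExp_gLoc x0 h0 w0 k i
    filter_upwards [h, condExp_avg (m := history ξ k)
      (fun i => (hs.memLp_gLoc x0 h0 w0 k i).integrable one_le_two)] with o h1 h2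
    rw [h2]
    simp only [h1]
    exact hs.problem.avg_gBar _
  mean_bound k := by
    have h : ∀ᵐ o ∂P, ∀ i, (P[fun o => gLoc F (run F C Q γ α x0 h0 w0 ξ k o) i (ξ k i o).1
        | history ξ k]) o = gBar F (run F C Q γ α x0 h0 w0 ξ k o) i :=
      ae_all_iff.2 fun i => hs.condExp_gLoc x0 h0 w0 k i
    filter_upwards [h] with o h1
    simp only [h1]
    refine (hs.problem.mean_gBar_sq_le _).trans (le_of_eq ?_)
    simp only [params]
    ring
  variance_bound k := by
    filter_upwards [ae_all_iff.2 fun i => hs.condExp_variance x0 h0 w0 k i] with o h1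
    simp only [h1]
    refine (hs.problem.mean_gLoc_sub_gBar_sq_le _).trans (le_of_eq ?_)
    simp only [params]
    ring
  second_moment k := by
    filter_upwards [hs.condExp_second_moment_le x0 h0 w0 k] with o h1
    refine h1.trans (le_of_eq ?_)
    simp only [params]
    ring
  s1_step k := by
    filter_upwards [hs.condExp_sigma1Sq_le x0 h0 w0 k] with o h1
    refine h1.trans (le_of_eq ?_)
    simp only [params]
    ring
  s2_step k := by
    filter_upwards [hs.condExp_sigma2Sq_le x0 h0 w0 k] with o h1
    exact h1

end IsSetting

/-! ### Weighted sums of recursions -/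

lemma eta_le_p {γ μ α p : ℝ} : eta γ μ α p ≤ p / 4 := (min_le_right _ _).trans (min_le_right _ _)

lemma eta_le_α {γ μ α p : ℝ} : eta γ μ α p ≤ α / 4 := (min_le_right _ _).trans (min_le_left _ _)

lemma eta_nonneg {γ μ α p : ℝ} (hγ : 0 < γ) (hμ : 0 ≤ μ) (hα : 0 < α) (hp : 0 < p) :
    0 ≤ eta γ μ α p := by
  unfold eta
  refine le_min ?_ (le_min ?_ ?_) <;> positivity

lemma weight_pos {η : ℝ} (hη : η < 1) (k : ℕ) : 0 < weight η k := by
  have : 0 < 1 - η := by linarith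
  unfold weight
  positivity

lemma weight_succ (η : ℝ) (k : ℕ) : weight η (k + 1) = (1 - η)⁻¹ * weight η k := by
  rw [weight, weight, pow_succ, mul_inv, mul_comm]

lemma weight_zero (η : ℝ) : weight η 0 = (1 - η)⁻¹ := by simp [weight]

lemma weightSum_pos {η : ℝ} (hη : η < 1) (K : ℕ) : 0 < weightSum η K :=
  Finset.sum_pos (fun k _ => weight_pos hη k) (by simp)

/-- Summing a contraction with weights growing more slowly than it contracts. -/
lemma weighted_sum_le_of_contraction {η ρ θ : ℝ} {u b : ℕ → ℝ} (hη : η < 1) (hθ : θ ≤ 1)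
    (hρ : 1 - ρ ≤ (1 - θ) * (1 - η)) (hu : ∀ k, 0 ≤ u k) (hb : ∀ k, 0 ≤ b k)
    (h : ∀ k, u (k + 1) ≤ (1 - ρ) * u k + b k) (K : ℕ) :
    θ * ∑ k ∈ Finset.range (K + 1), weight η k * u k ≤
      (1 - η)⁻¹ * (u 0 + ∑ k ∈ Finset.range (K + 1), weight η k * b k) := by
  have hq : 0 < 1 - η := by linarith
  have hstep : ∀ k, weight η (k + 1) * u (k + 1) ≤
      (1 - θ) * (weight η k * u k) + (1 - η)⁻¹ * (weight η k * b k) := by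
    intro k
    have hw := weight_pos hη k
    have h1 : u (k + 1) ≤ (1 - θ) * (1 - η) * u k + b k :=
      (h k).trans (by gcongr; exact hu k)
    calc weight η (k + 1) * u (k + 1)
        ≤ weight η (k + 1) * ((1 - θ) * (1 - η) * u k + b k) :=
          mul_le_mul_of_nonneg_left h1 (weight_pos hη _).le
      _ = _ := by rw [weight_succ]; field_simp
  have hsum : ∑ k ∈ Finset.range K, weight η (k + 1) * u (k + 1) ≤
      (1 - θ) * ∑ k ∈ Finset.range (K + 1), weight η k * u k
        + (1 - η)⁻¹ * ∑ k ∈ Finset.range (K + 1), weight η k * b k := by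
    -- The sum over `k < K` is extended to `k ≤ K` by one nonnegative term; here `θ ≤ 1` is needed.
    rw [Finset.mul_sum, Finset.mul_sum, ← Finset.sum_add_distrib]
    refine (Finset.sum_le_sum fun k _ => hstep k).trans
      (Finset.sum_le_sum_of_subset_of_nonneg (Finset.range_mono K.le_succ) fun k _ _ => ?_)
    have hw := (weight_pos hη k).le
    exact add_nonneg (mul_nonneg (by linarith) (mul_nonneg hw (hu k)))
      (mul_nonneg (by positivity) (mul_nonneg hw (hb k)))
  -- Splitting off the term `k = 0` leaves the shifted sum just bounded. The full sum then occurs on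
  -- both sides, with factors `1` and `1 - θ`.
  have h0 : ∑ k ∈ Finset.range (K + 1), weight η k * u k =
      ∑ k ∈ Finset.range K, weight η (k + 1) * u (k + 1) + (1 - η)⁻¹ * u 0 := by
    rw [Finset.sum_range_succ', weight_zero]
  linarith

lemma weighted_sum_le_of_descent {η : ℝ} {u c : ℕ → ℝ} (hη : η < 1) (hu : ∀ k, 0 ≤ u k)
    (h : ∀ k, u (k + 1) ≤ (1 - η) * u k - c k) (K : ℕ) :
    ∑ k ∈ Finset.range (K + 1), weight η k * c k ≤ u 0 := by
  have hq : 0 < 1 - η := by linarith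
  -- Telescoping: since `w_k` carries the exponent `k + 1`, the potential at time `N` has weight
  -- `(1-η)^(-N)`, equal to `1` at the start.
  have key : ∀ N, ∑ k ∈ Finset.range N, weight η k * c k + ((1 - η) ^ N)⁻¹ * u N ≤ u 0 := by
    intro N
    induction N with
    | zero => simp
    | succ N ih =>
      rw [Finset.sum_range_succ]
      have h1 : weight η N * u (N + 1) ≤ weight η N * ((1 - η) * u N - c N) :=
        mul_le_mul_of_nonneg_left (h N) (weight_pos hη N).le
      have h2 : weight η N * ((1 - η) * u N) = ((1 - η) ^ N)⁻¹ * u N := by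
        rw [weight, pow_succ]; field_simp
      have h3 : ((1 - η) ^ (N + 1))⁻¹ = weight η N := rfl
      rw [h3]
      linarith
  have h1 := key (K + 1)
  have h2 : 0 ≤ ((1 - η) ^ (K + 1))⁻¹ * u (K + 1) := mul_nonneg (by positivity) (hu _)
  linarith

/-! ### The stepsize -/

/-- The quantity under the square root in the stepsize bound, divided by six. -/
def stepConst (δ α p : ℝ) : ℝ :=
  4 + 3 * δ + 2 / (1 - α) * (3 + 4 / (1 - p)) * (4 + 3 * δ) + 6 * δ / (1 - p)

lemma four_le_stepConst {δ α p : ℝ} (hδ : 0 < δ) (hα : α < 1) (hp : p < 1) :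
    4 ≤ stepConst δ α p := by
  have h1 : 0 < 1 - α := by linarith
  have h2 : 0 < 1 - p := by linarith
  have h3 : 0 ≤ 3 * δ + 2 / (1 - α) * (3 + 4 / (1 - p)) * (4 + 3 * δ) + 6 * δ / (1 - p) := by
    positivity
  unfold stepConst
  linarith

lemma mul_sqrt_le_of_le_gammaMax {L γ δ α p : ℝ} (hL : 0 < L) (hδ : 0 < δ) (hα : α < 1)
    (hp : p < 1) (h : γ ≤ gammaMax L δ α p) : γ * (4 * L * √(6 * stepConst δ α p)) ≤ δ := by
  have hX := four_le_stepConst hδ hα hp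
  have : 0 < √(6 * stepConst δ α p) := Real.sqrt_pos.2 (by linarith)
  exact (le_div_iff₀ (by positivity)).1 (h.trans (min_le_right _ _))

lemma sq_mul_stepConst_le {L γ δ α p : ℝ} (hL : 0 < L) (hδ : 0 < δ) (hα : α < 1)
    (hp : p < 1) (hγ : 0 < γ) (h : γ ≤ gammaMax L δ α p) :
    96 * L ^ 2 * γ ^ 2 * stepConst δ α p ≤ δ ^ 2 := by
  have hX := four_le_stepConst hδ hα hp
  have h1 := mul_sqrt_le_of_le_gammaMax hL hδ hα hp h
  have h2 := pow_le_pow_left₀ (by positivity) h1 2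
  rw [mul_pow, mul_pow, Real.sq_sqrt (by linarith)] at h2
  linarith

lemma gamma_mul_le {L γ δ α p : ℝ} (hL : 0 < L) (hδ : 0 < δ) (hα : α < 1)
    (hp : p < 1) (hγ : 0 < γ) (h : γ ≤ gammaMax L δ α p) : γ * L ≤ δ / 4 := by
  have hX := four_le_stepConst hδ hα hp
  have h1 := mul_sqrt_le_of_le_gammaMax hL hδ hα hp h
  have h2 : 1 ≤ √(6 * stepConst δ α p) := Real.one_le_sqrt.2 (by linarith)
  have h3 : γ * (4 * L) * 1 ≤ γ * (4 * L) * √(6 * stepConst δ α p) := by gcongr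
  linarith

lemma one_le_inv_one_sub_eta {η : ℝ} (h0 : 0 ≤ η) (h1 : η < 1) : 1 ≤ (1 - η)⁻¹ :=
  (one_le_inv₀ (by linarith)).2 (by linarith)

/-- Bernoulli: `(1-η)^4 ≥ 1-4η ≥ 1-a`. This is why `η` is a minimum of quarters of rates: up to four
powers of `(1-η)⁻¹` can be traded for `1/(1-α)` or `1/(1-p)`. -/
lemma inv_one_sub_pow_four_le {η a : ℝ} (h1 : η < 1) (ha1 : a < 1)
    (h : η ≤ a / 4) : (1 - η)⁻¹ ^ 4 ≤ 1 / (1 - a) := by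
  have hq : 0 < 1 - η := by linarith
  rw [inv_pow, ← one_div]
  refine one_div_le_one_div_of_le (by linarith) ?_
  have := one_add_mul_le_pow (a := -η) (by linarith) 4
  push_cast at this
  rw [← sub_eq_add_neg] at this
  linarith

/-- The left side is what accumulates in front of the gap when the three weighted sums are
substituted into one another, with `q = (1-η)⁻¹`. The right side is twice `stepConst`, with `a =
1/(1-α)` and `b = 1/(1-p)`. -/
lemma stepConst_dominates {q a b δ : ℝ} (hδ : 0 < δ) (hq1 : 1 ≤ q) (ha : q ^ 4 ≤ a)
    (hb : q ^ 4 ≤ b) :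
    q * (2 * (4 + 3 * δ) + 8 * q * (4 + 3 * δ)
        + (8 / 3 * q * (4 + 3 * δ) + 3 * δ) * (8 / 3 * q)) ≤
      2 * (4 + 3 * δ + 2 * a * (3 + 4 * b) * (4 + 3 * δ) + 6 * δ * b) := by
  have hq4 : ∀ j ≤ 4, q ^ j ≤ q ^ 4 := fun j hj => pow_le_pow_right₀ hq1 hj
  have hq4' : 1 ≤ q ^ 4 := one_le_pow₀ hq1
  have e1 : q * (2 * (4 + 3 * δ) + 8 * q * (4 + 3 * δ)
      + (8 / 3 * q * (4 + 3 * δ) + 3 * δ) * (8 / 3 * q)) =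
      (2 * q ^ 1 + 8 * q ^ 2 + 64 / 9 * q ^ 3) * (4 + 3 * δ) + 8 * δ * q ^ 2 := by ring
  rw [e1]
  -- Every power of `q` is at most `q ^ 4 ≤ a`, and `2 + 8 + 64/9 < 18`.
  have h2 : 2 * q ^ 1 + 8 * q ^ 2 + 64 / 9 * q ^ 3 ≤ 18 * a := by
    linarith [hq4 1 (by norm_num), hq4 2 (by norm_num), hq4 3 (by norm_num)]
  have h3 : q ^ 2 ≤ b := (hq4 2 (by norm_num)).trans hb
  have hb1 : 1 ≤ b := hq4'.trans hb
  have ha1 : 1 ≤ a := hq4'.trans ha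
  have h4 : (2 * q ^ 1 + 8 * q ^ 2 + 64 / 9 * q ^ 3) * (4 + 3 * δ) ≤ 18 * a * (4 + 3 * δ) := by
    gcongr
  have h5 : 8 * δ * q ^ 2 ≤ 8 * δ * b := by gcongr
  have h6 : a * (4 + 3 * δ) * 1 ≤ a * (4 + 3 * δ) * b := by gcongr
  have h7 : 0 ≤ a * (4 + 3 * δ) := by positivity
  have h8 : 0 ≤ δ * b := by positivity
  linarith

lemma F1_eq {L μ γ δ α p : ℝ} : F1 L μ γ δ α p =
    12 * L * γ ^ 2 * (1 - eta γ μ α p)⁻¹ / δ * ((4 / δ + 3) * (2 / α)) := by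
  rw [F1, div_eq_mul_inv, mul_inv, mul_inv]
  ring

lemma F2_eq {L μ γ δ α p : ℝ} : F2 L μ γ δ α p = 12 * L * γ ^ 2 * (1 - eta γ μ α p)⁻¹ / δ *
    ((4 * (1 / (1 - α)) * (4 / δ + 3) + 3) * (2 / p)) := by
  rw [F2, div_eq_mul_inv, mul_inv, mul_inv]
  ring

set_option maxHeartbeats 800000 in
/-- The arithmetic behind the error bound, for the weighted sums `Φ` of the function gaps, `S1`,
`S2` of the variances and `A` of the squared errors. -/
lemma error_sum_arith {L μ γ δ α p Φ S1 S2 A s10 s20 : ℝ} (hL : 0 < L) (hδ : 0 < δ)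
    (hγ : 0 < γ) (hμ : 0 ≤ μ) (hα : 0 < α) (hα1 : α < 1) (hp : 0 < p) (hp1 : p < 1)
    (hγm : γ ≤ gammaMax L δ α p) (hΦ : 0 ≤ Φ) (h10 : 0 ≤ s10) (h20 : 0 ≤ s20)
    (H2 : 3 * p / 4 * S2 ≤ (1 - eta γ μ α p)⁻¹ * (s20 + 2 * (L * p) * Φ))
    (H1 : 3 * α / 4 * S1 ≤
      (1 - eta γ μ α p)⁻¹ * (s10 + (2 * (3 * L * α) * Φ + 2 * α * S2)))
    (HA : δ / 4 * A ≤ (1 - eta γ μ α p)⁻¹ *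
      (γ ^ 2 * (2 * L * (4 / δ + 3) * Φ + (4 / δ + 3) * S1 + 3 * S2))) :
    3 * L * A ≤ 1 / 4 * Φ + F1 L μ γ δ α p * s10 + F2 L μ γ δ α p * s20 := by
  have hη0 := eta_nonneg hγ hμ hα hp
  have hηα : eta γ μ α p ≤ α / 4 := eta_le_α
  have hηp : eta γ μ α p ≤ p / 4 := eta_le_p
  set η := eta γ μ α p with hη
  have hη1 : η < 1 := by linarith
  have hq1 := one_le_inv_one_sub_eta hη0 hη1
  have hqα := inv_one_sub_pow_four_le hη1 hα1 hηα
  have hqp := inv_one_sub_pow_four_le hη1 hp1 hηp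
  have hq43 : (1 - η)⁻¹ ≤ 4 / 3 := by
    rw [inv_le_comm₀ (by linarith) (by norm_num)]
    linarith
  have hX := sq_mul_stepConst_le hL hδ hα1 hp1 hγ hγm
  have hF1 := F1_eq (L := L) (γ := γ) (δ := δ) (α := α) (p := p) (μ := μ)
  have hF2 := F2_eq (L := L) (γ := γ) (δ := δ) (α := α) (p := p) (μ := μ)
  rw [← hη] at hF1 hF2
  set q := (1 - η)⁻¹ with hqdef
  set a := 1 / (1 - α) with ha
  set b := 1 / (1 - p) with hb
  have hc : 0 < 4 / δ + 3 := by positivity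
  have hXe : stepConst δ α p = 4 + 3 * δ + 2 * a * (3 + 4 * b) * (4 + 3 * δ) + 6 * δ * b := by
    rw [stepConst, ha, hb]; ring
  set c := 4 / δ + 3 with hcdef
  have hδc : δ * c = 4 + 3 * δ := by rw [hcdef]; field_simp
  have hq4 : ∀ j ≤ 4, q ^ j ≤ q ^ 4 := fun j hj => pow_le_pow_right₀ hq1 hj
  have hq4' : 1 ≤ q ^ 4 := one_le_pow₀ hq1
  have hq0 : 0 < q := by linarith
  -- The chain is now solved in order: `S2` from the gap, `S1` from the gap and `S2`, and `A` from
  -- all three.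
  have hS2 : S2 ≤ 4 * q / (3 * p) * s20 + 8 / 3 * L * q * Φ := by
    have e : 4 / (3 * p) * (3 * p / 4 * S2) = S2 := by field_simp
    have := mul_le_mul_of_nonneg_left H2 (by positivity : 0 ≤ 4 / (3 * p))
    rw [e] at this
    refine this.trans (le_of_eq ?_)
    field_simp
    ring
  have hS1 : S1 ≤ 4 * q / (3 * α) * s10 + 8 * L * q * Φ + 8 / 3 * q * S2 := by
    have e : 4 / (3 * α) * (3 * α / 4 * S1) = S1 := by field_simp
    have := mul_le_mul_of_nonneg_left H1 (by positivity : 0 ≤ 4 / (3 * α))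
    rw [e] at this
    refine this.trans (le_of_eq ?_)
    field_simp
    ring
  have hA : 3 * L * A ≤ 12 * L * γ ^ 2 * q / δ * (2 * L * c * Φ + c * S1 + 3 * S2) := by
    have e : 12 * L / δ * (δ / 4 * A) = 3 * L * A := by field_simp; ring
    have := mul_le_mul_of_nonneg_left HA (by positivity : 0 ≤ 12 * L / δ)
    rw [e] at this
    refine this.trans (le_of_eq ?_)
    ring
  set κ := 12 * L * γ ^ 2 * q / δ with hκ
  have hκ0 : 0 ≤ κ := by positivity
  have hbr : 2 * L * c * Φ + c * S1 + 3 * S2 ≤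
      L * (2 * c + 8 * q * c + (8 / 3 * q * c + 3) * (8 / 3 * q)) * Φ
      + c * (4 * q / (3 * α)) * s10 + (8 / 3 * q * c + 3) * (4 * q / (3 * p)) * s20 := by
    have h1 := mul_le_mul_of_nonneg_left hS1 hc.le
    have h2 := mul_le_mul_of_nonneg_left hS2 (by positivity : 0 ≤ 8 / 3 * q * c + 3)
    refine (show _ ≤ _ from ?_).trans (le_of_eq (?_ :
      2 * L * c * Φ + c * (4 * q / (3 * α) * s10 + 8 * L * q * Φ) +
        (8 / 3 * q * c + 3) * (4 * q / (3 * p) * s20 + 8 / 3 * L * q * Φ) = _))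
    · linarith
    · ring
  -- The stepsize enters here: after `δ²` is cleared the coefficient is at most `24 L² γ² / δ²`
  -- times `stepConst`, a quarter of what the bound on `γ` keeps below `1`.
  have hcoefΦ : κ * (L * (2 * c + 8 * q * c + (8 / 3 * q * c + 3) * (8 / 3 * q))) ≤ 1 / 4 := by
    have h1 : q * (2 * (δ * c) + 8 * q * (δ * c) + (8 / 3 * q * (δ * c) + 3 * δ) * (8 / 3 * q)) ≤
        2 * stepConst δ α p := by
      rw [hδc, hXe]
      exact stepConst_dominates hδ hq1 hqα hqp
    have h2 : κ * (L * (2 * c + 8 * q * c + (8 / 3 * q * c + 3) * (8 / 3 * q))) =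
        12 * L ^ 2 * γ ^ 2 / δ ^ 2 *
          (q * (2 * (δ * c) + 8 * q * (δ * c) + (8 / 3 * q * (δ * c) + 3 * δ) * (8 / 3 * q))) := by
      rw [hκ]
      field_simp
    rw [h2]
    calc _ ≤ 12 * L ^ 2 * γ ^ 2 / δ ^ 2 * (2 * stepConst δ α p) := by gcongr
      _ = (96 * L ^ 2 * γ ^ 2 * stepConst δ α p) / (4 * δ ^ 2) := by ring
      _ ≤ δ ^ 2 / (4 * δ ^ 2) := by gcongr
      _ = 1 / 4 := by field_simp
  -- Amounts to `q ≤ 3/2`, which follows from `q ≤ 4/3`.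
  have hcoef1 : c * (4 * q / (3 * α)) ≤ c * (2 / α) := by
    refine mul_le_mul_of_nonneg_left ?_ hc.le
    rw [div_le_div_iff₀ (by positivity) hα]
    nlinarith
  -- After `2/p` is factored out, `16/9 q² ≤ 4a` and `2q ≤ 8/3 ≤ 3`.
  have hcoef2 : (8 / 3 * q * c + 3) * (4 * q / (3 * p)) ≤ (4 * a * c + 3) * (2 / p) := by
    have h1 : (8 / 3 * q * c + 3) * (4 * q / (3 * p)) =
        (16 / 9 * q ^ 2 * c + 2 * q) * (2 / p) := by field_simp; ring
    rw [h1]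
    refine mul_le_mul_of_nonneg_right ?_ (by positivity)
    have h2 : q ^ 2 ≤ a := (hq4 2 (by norm_num)).trans hqα
    have h3 : q ^ 2 * c ≤ a * c := by gcongr
    have h4 : 0 ≤ q ^ 2 * c := by positivity
    linarith
  rw [hF1, hF2]
  refine hA.trans ((mul_le_mul_of_nonneg_left hbr hκ0).trans ?_)
  have h1 := mul_le_mul_of_nonneg_right hcoefΦ hΦ
  have h2 := mul_le_mul_of_nonneg_right (mul_le_mul_of_nonneg_left hcoef1 hκ0) h10
  have h3 := mul_le_mul_of_nonneg_right (mul_le_mul_of_nonneg_left hcoef2 hκ0) h20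
  linarith

/-! ### Recursions in expectation -/

lemma integrable_inner_of_memLp {d : ℕ} {Ω : Type*} [MeasurableSpace Ω] {P : Measure Ω}
    {u v : Ω → Vec d} (hu : MemLp u 2 P) (hv : MemLp v 2 P) :
    Integrable (fun o => inner ℝ (u o) (v o)) P := by
  refine ((integrable_norm_sq hu).add (integrable_norm_sq hv)).mono' (hu.1.inner hv.1)
    (Filter.Eventually.of_forall fun o => ?_)
  have h := norm_inner_le_norm (𝕜 := ℝ) (u o) (v o)
  simp only [Pi.add_apply]
  nlinarith [sq_nonneg (‖u o‖ - ‖v o‖), sq_nonneg ‖u o‖, sq_nonneg ‖v o‖]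

lemma integral_le_of_condExp_le {Ω : Type*} {m mΩ : MeasurableSpace Ω} {P : Measure Ω}
    [IsProbabilityMeasure P] (hm : m ≤ mΩ) {Y B : Ω → ℝ} (hB : Integrable B P)
    (h : ∀ᵐ o ∂P, (P[Y | m]) o ≤ B o) : ∫ o, Y o ∂P ≤ ∫ o, B o ∂P := by
  rw [← integral_condExp hm]
  exact integral_mono_ae integrable_condExp hB h

/-- Quasi strong convexity at `x` gives `-2` times the gap. One gap is returned by Young's
inequality for `2⟨e, ∇f(x)⟩`, which costs `2L‖e‖²`. Passing from `‖x - x*‖²` to `‖x - e - x*‖²`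
costs `μ‖e‖² ≤ L‖e‖²`, hence the total `3L`. -/
lemma IsProblem.perturbed_descent {d n m : ℕ} {F : Fin n → Fin m → Vec d → ℝ} {xs : Vec d}
    {L μ : ℝ} (hF : IsProblem F xs L μ) (x e : Vec d) :
    -2 * inner ℝ (x - e - xs) (gradient (loss F) x) ≤
      -(μ / 2) * ‖x - e - xs‖ ^ 2 - (loss F x - loss F xs) + 3 * L * ‖e‖ ^ 2 := by
  have hL := hF.L_pos
  have h1 := hF.quasi.ineq x
  have h2 := hF.norm_gradient_loss_sq_le x
  have h3 := hF.quasi.mul_norm_sq_le hF.smooth_loss e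
  set G := gradient (loss F) x
  have h4 : inner ℝ (x - e - xs) G = - inner ℝ G (xs - x) - inner ℝ e G := by
    have : x - e - xs = -(xs - x) - e := by abel
    rw [this, inner_sub_left, inner_neg_left, real_inner_comm]
  have h5 : 2 * inner ℝ e G ≤ 2 * L * ‖e‖ ^ 2 + (loss F x - loss F xs) := by
    have h6 := real_inner_le_norm e G
    have h7 : 4 * L * (‖e‖ * ‖G‖) ≤ 4 * L ^ 2 * ‖e‖ ^ 2 + ‖G‖ ^ 2 := by
      nlinarith [sq_nonneg (2 * L * ‖e‖ - ‖G‖)]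
    have h8 : 2 * L * (2 * inner ℝ e G) ≤
        2 * L * (2 * L * ‖e‖ ^ 2 + (loss F x - loss F xs)) := by
      have := mul_le_mul_of_nonneg_left h6 (by positivity : 0 ≤ 4 * L)
      linarith
    exact le_of_mul_le_mul_left h8 (by positivity)
  have h6 : ‖x - e - xs‖ ^ 2 ≤ 2 * ‖x - xs‖ ^ 2 + 2 * ‖e‖ ^ 2 := by
    have : x - e - xs = x - xs - e := by abel
    rw [this]
    exact norm_sub_sq_le_two_mul _ _
  have h7 := mul_le_mul_of_nonneg_left h6 (by linarith [hF.μ_nonneg] : 0 ≤ μ / 2)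
  linarith

namespace IsSetting

attribute [local irreducible] gHat gLoc gBar avg

variable {d n m : ℕ} {S T Ω : Type*} [MeasurableSpace S] [MeasurableSpace T] [MeasurableSpace Ω]
  {F : Fin n → Fin m → Vec d → ℝ} {xs : Vec d} {L μ : ℝ} {νC : Measure S} {νQ : Measure T}
  [IsProbabilityMeasure νC] [IsProbabilityMeasure νQ]
  {C : S → Vec d → Vec d} {Q : T → Vec d → Vec d} {δ ω γ α p : ℝ}
  {P : Measure Ω} [IsProbabilityMeasure P] {ξ : ℕ → Fin n → Ω → Noise m S T}

lemma integral_sigma2Sq_le (hs : IsSetting F xs L μ νC νQ C Q δ ω γ α p P ξ)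
    (x0 : Vec d) (h0 w0 : Fin n → Vec d) (k : ℕ) :
    ∫ o, sigma2Sq F xs (run F C Q γ α x0 h0 w0 ξ (k + 1) o).w ∂P ≤
      (1 - p) * ∫ o, sigma2Sq F xs (run F C Q γ α x0 h0 w0 ξ k o).w ∂P
      + 2 * (L * p) * ∫ o, (loss F (run F C Q γ α x0 h0 w0 ξ k o).x - loss F xs) ∂P := by
  have hst := hs.sqIntegrable_run x0 h0 w0 k
  have hI2 := (hst.integrable_sigma2Sq hs.problem).const_mul (1 - p)
  have hIf := (hs.problem.integrable_gap hst.x).const_mul (2 * (L * p))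
  refine (integral_le_of_condExp_le (hs.noise.history_le k) (hI2.add hIf)
    (hs.condExp_sigma2Sq_le x0 h0 w0 k)).trans (le_of_eq ?_)
  rw [integral_add' hI2 hIf, integral_const_mul, integral_const_mul]

lemma integral_sigma1Sq_le (hs : IsSetting F xs L μ νC νQ C Q δ ω γ α p P ξ)
    (x0 : Vec d) (h0 w0 : Fin n → Vec d) (k : ℕ) :
    ∫ o, sigma1Sq F xs (run F C Q γ α x0 h0 w0 ξ (k + 1) o).h ∂P ≤
      (1 - α) * ∫ o, sigma1Sq F xs (run F C Q γ α x0 h0 w0 ξ k o).h ∂P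
      + (2 * (3 * L * α) * ∫ o, (loss F (run F C Q γ α x0 h0 w0 ξ k o).x - loss F xs) ∂P
        + 2 * α * ∫ o, sigma2Sq F xs (run F C Q γ α x0 h0 w0 ξ k o).w ∂P) := by
  have hst := hs.sqIntegrable_run x0 h0 w0 k
  have hI1 := (hst.integrable_sigma1Sq (F := F) (xs := xs)).const_mul (1 - α)
  have hI2 := (hst.integrable_sigma2Sq hs.problem).const_mul (2 * α)
  have hIf := (hs.problem.integrable_gap hst.x).const_mul (2 * (3 * L * α))
  refine (integral_le_of_condExp_le (hs.noise.history_le k) ((hI1.add hIf).add hI2)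
    (hs.condExp_sigma1Sq_le x0 h0 w0 k)).trans (le_of_eq ?_)
  rw [integral_add' (hI1.add hIf) hI2, integral_add' hI1 hIf, integral_const_mul,
    integral_const_mul, integral_const_mul]
  ring

lemma integral_second_moment_le (hs : IsSetting F xs L μ νC νQ C Q δ ω γ α p P ξ)
    (x0 : Vec d) (h0 w0 : Fin n → Vec d) (k : ℕ) :
    ∫ o, ‖avg fun i => gLoc F (run F C Q γ α x0 h0 w0 ξ k o) i (ξ k i o).1‖ ^ 2 ∂P ≤
      4 * L * ∫ o, (loss F (run F C Q γ α x0 h0 w0 ξ k o).x - loss F xs) ∂P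
      + 2 * ∫ o, sigma2Sq F xs (run F C Q γ α x0 h0 w0 ξ k o).w ∂P := by
  have hst := hs.sqIntegrable_run x0 h0 w0 k
  have hI2 := (hst.integrable_sigma2Sq hs.problem).const_mul 2
  have hIf := (hs.problem.integrable_gap hst.x).const_mul (4 * L)
  refine (integral_le_of_condExp_le (hs.noise.history_le k) (hIf.add hI2)
    (hs.condExp_second_moment_le x0 h0 w0 k)).trans (le_of_eq ?_)
  rw [integral_add' hIf hI2, integral_const_mul, integral_const_mul]

lemma integral_error_le (hs : IsSetting F xs L μ νC νQ C Q δ ω γ α p P ξ)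
    (x0 : Vec d) (h0 w0 : Fin n → Vec d) (k : ℕ) :
    ∫ o, (1 / (n : ℝ)) * ∑ i, ‖(run F C Q γ α x0 h0 w0 ξ (k + 1) o).e i‖ ^ 2 ∂P ≤
      (1 - δ / 2) * ∫ o, (1 / (n : ℝ)) * ∑ i, ‖(run F C Q γ α x0 h0 w0 ξ k o).e i‖ ^ 2 ∂P
      + γ ^ 2 * (2 * L * (4 / δ + 3) *
          ∫ o, (loss F (run F C Q γ α x0 h0 w0 ξ k o).x - loss F xs) ∂P
        + (4 / δ + 3) * ∫ o, sigma1Sq F xs (run F C Q γ α x0 h0 w0 ξ k o).h ∂P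
        + 3 * ∫ o, sigma2Sq F xs (run F C Q γ α x0 h0 w0 ξ k o).w ∂P) := by
  have hst := hs.sqIntegrable_run x0 h0 w0 k
  have hst' := hs.sqIntegrable_run x0 h0 w0 (k + 1)
  have hIe : Integrable (fun o => (1 / (n : ℝ)) *
      ∑ i, ‖(run F C Q γ α x0 h0 w0 ξ k o).e i‖ ^ 2) P :=
    integrable_mean fun i => integrable_norm_sq (hst.e i)
  have hI0 := hIe.const_mul (1 - δ / 2)
  have hI1 := (hst.integrable_sigma1Sq (F := F) (xs := xs)).const_mul (4 / δ + 3)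
  have hI2 := (hst.integrable_sigma2Sq hs.problem).const_mul 3
  have hIf := (hs.problem.integrable_gap hst.x).const_mul (2 * L * (4 / δ + 3))
  have hI4 := ((hIf.add hI1).add hI2).const_mul (γ ^ 2)
  have h1 : ∀ᵐ o ∂P, (P[fun o => (1 / (n : ℝ)) *
      ∑ i, ‖(run F C Q γ α x0 h0 w0 ξ (k + 1) o).e i‖ ^ 2 | history ξ k]) o ≤
      (1 - δ / 2) * ((1 / (n : ℝ)) * ∑ i, ‖(run F C Q γ α x0 h0 w0 ξ k o).e i‖ ^ 2)
      + γ ^ 2 * (2 * L * (4 / δ + 3) * (loss F (run F C Q γ α x0 h0 w0 ξ k o).x - loss F xs)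
        + (4 / δ + 3) * sigma1Sq F xs (run F C Q γ α x0 h0 w0 ξ k o).h
        + 3 * sigma2Sq F xs (run F C Q γ α x0 h0 w0 ξ k o).w) := by
    have h2 := hs.condExp_mean_draw x0 h0 w0 k
      (Φ := fun i s z => ‖errStep F C γ i s z‖ ^ 2)
      (fun i => (hs.problem.measurable_errStep hs.compressor γ i).norm.pow_const 2)
      (fun i => integrable_norm_sq (hst'.e i))
    filter_upwards [h2] with o h2
    refine h2.le.trans ((mean_le_mean fun i => ?_).trans
      (hs.problem.mean_error_step_le hs.δ_pos hs.δ_le_one _))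
    exact integral_norm_errStep_sq_le hs.problem.one_le_m hs.p_pos.le hs.p_lt_one.le
      hs.compressor i _
  refine (integral_le_of_condExp_le (hs.noise.history_le k) (hI0.add hI4) h1).trans (le_of_eq ?_)
  rw [integral_add' hI0 hI4, integral_const_mul (1 - δ / 2), integral_const_mul (γ ^ 2),
    integral_add' (hIf.add hI1) hI2, integral_add' hIf hI1,
    integral_const_mul (2 * L * (4 / δ + 3)), integral_const_mul (4 / δ + 3),
    integral_const_mul 3]

lemma memLp_perturbed (hs : IsSetting F xs L μ νC νQ C Q δ ω γ α p P ξ)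
    (x0 : Vec d) (h0 w0 : Fin n → Vec d) (k : ℕ) :
    MemLp (fun o => (run F C Q γ α x0 h0 w0 ξ k o).x - avg (run F C Q γ α x0 h0 w0 ξ k o).e - xs)
      2 P :=
  ((hs.sqIntegrable_run x0 h0 w0 k).x.sub
    (memLp_avg (hs.sqIntegrable_run x0 h0 w0 k).e)).sub (memLp_const xs)

/-- The left factor is determined by the state at time `k`, so `g` may be replaced by its
conditional mean. -/
lemma integral_inner_avg_gLoc (hs : IsSetting F xs L μ νC νQ C Q δ ω γ α p P ξ)
    (x0 : Vec d) (h0 w0 : Fin n → Vec d) (k : ℕ) :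
    ∫ o, inner ℝ ((run F C Q γ α x0 h0 w0 ξ k o).x - avg (run F C Q γ α x0 h0 w0 ξ k o).e - xs)
        (avg fun i => gLoc F (run F C Q γ α x0 h0 w0 ξ k o) i (ξ k i o).1) ∂P =
      ∫ o, inner ℝ ((run F C Q γ α x0 h0 w0 ξ k o).x - avg (run F C Q γ α x0 h0 w0 ξ k o).e - xs)
        (gradient (loss F) (run F C Q γ α x0 h0 w0 ξ k o).x) ∂P := by
  have hu : Measurable (fun s : State d n => s.x - avg s.e - xs) :=
    ((State.measurable_x.sub (measurable_avg State.measurable_e)).sub_const xs)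
  have hI := fun i => integrable_inner_of_memLp (hs.memLp_perturbed x0 h0 w0 k)
    (hs.memLp_gLoc x0 h0 w0 k i)
  have hmeas : ∀ i, Measurable (Function.uncurry fun (s : State d n) (z : Noise m S T) =>
      inner ℝ (s.x - avg s.e - xs) (gLoc F s i z.1)) := fun i =>
    (hu.comp measurable_fst).inner (hs.problem.measurable_gLoc_noise S T i)
  have h1 := hs.condExp_mean_draw x0 h0 w0 k hmeas hI
  have h2 := integral_congr_ae h1
  rw [integral_condExp (hs.noise.history_le k)] at h2
  simp only [inner_avg]
  rw [h2]
  congr 1 with o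
  have h3 : ∀ (s : State d n) (i : Fin n), ∫ z, inner ℝ (s.x - avg s.e - xs) (gLoc F s i z.1)
      ∂(noiseLaw m p νC νQ) = inner ℝ (s.x - avg s.e - xs) (gBar F s i) := by
    intro s i
    rw [integral_noiseLaw_index hs.problem.one_le_m hs.p_pos.le hs.p_lt_one.le
      (fun l => inner ℝ (s.x - avg s.e - xs) (gLoc F s i l)), smul_eq_mul, ← inner_avg,
      hs.problem.avg_gLoc]
  simp only [h3]
  rw [← inner_avg, hs.problem.avg_gBar]

lemma integral_perturbed_le (hs : IsSetting F xs L μ νC νQ C Q δ ω γ α p P ξ)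
    (x0 : Vec d) (h0 w0 : Fin n → Vec d) (k : ℕ) :
    ∫ o, ‖(run F C Q γ α x0 h0 w0 ξ (k + 1) o).x
        - avg (run F C Q γ α x0 h0 w0 ξ (k + 1) o).e - xs‖ ^ 2 ∂P ≤
      (1 - γ * μ / 2) * ∫ o, ‖(run F C Q γ α x0 h0 w0 ξ k o).x
        - avg (run F C Q γ α x0 h0 w0 ξ k o).e - xs‖ ^ 2 ∂P
      - γ * ∫ o, (loss F (run F C Q γ α x0 h0 w0 ξ k o).x - loss F xs) ∂P
      + 3 * L * γ * ∫ o, ‖avg (run F C Q γ α x0 h0 w0 ξ k o).e‖ ^ 2 ∂P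
      + γ ^ 2 * (4 * L * ∫ o, (loss F (run F C Q γ α x0 h0 w0 ξ k o).x - loss F xs) ∂P
        + 2 * ∫ o, sigma2Sq F xs (run F C Q γ α x0 h0 w0 ξ k o).w ∂P) := by
  have hst := hs.sqIntegrable_run x0 h0 w0 k
  have hu := hs.memLp_perturbed x0 h0 w0 k
  have hg : MemLp (fun o => avg fun i => gLoc F (run F C Q γ α x0 h0 w0 ξ k o) i (ξ k i o).1) 2 P :=
    memLp_avg fun i => hs.memLp_gLoc x0 h0 w0 k i
  have e1 : ∀ o, ‖(run F C Q γ α x0 h0 w0 ξ (k + 1) o).x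
        - avg (run F C Q γ α x0 h0 w0 ξ (k + 1) o).e - xs‖ ^ 2 =
      (‖(run F C Q γ α x0 h0 w0 ξ k o).x - avg (run F C Q γ α x0 h0 w0 ξ k o).e - xs‖ ^ 2
      - 2 * γ * inner ℝ
        ((run F C Q γ α x0 h0 w0 ξ k o).x - avg (run F C Q γ α x0 h0 w0 ξ k o).e - xs)
        (avg fun i => gLoc F (run F C Q γ α x0 h0 w0 ξ k o) i (ξ k i o).1))
      + γ ^ 2 * ‖avg fun i => gLoc F (run F C Q γ α x0 h0 w0 ξ k o) i (ξ k i o).1‖ ^ 2 := by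
    intro o
    have h := step_x_sub_avg_e F C Q γ α (run F C Q γ α x0 h0 w0 ξ k o) (fun i => ξ k i o)
    have h' : (run F C Q γ α x0 h0 w0 ξ (k + 1) o).x
        - avg (run F C Q γ α x0 h0 w0 ξ (k + 1) o).e = _ := h
    rw [h', sub_right_comm, norm_sub_sq_real, inner_smul_right, norm_smul, mul_pow,
      Real.norm_eq_abs, sq_abs]
    ring
  have hI1 := integrable_norm_sq hu
  have hI2 := (integrable_inner_of_memLp hu hg).const_mul (2 * γ)
  have hI3 := (integrable_norm_sq hg).const_mul (γ ^ 2)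
  have e2 := integral_add (hI1.sub hI2) hI3
  simp only [Pi.sub_apply] at e2
  simp only [e1]
  rw [e2, integral_sub hI1 hI2, integral_const_mul,
    integral_const_mul, hs.integral_inner_avg_gLoc]
  have h2 := mul_le_mul_of_nonneg_left (hs.integral_second_moment_le x0 h0 w0 k) (sq_nonneg γ)
  have hgr := hs.problem.smooth_loss.memLp_gradient hst.x
  have hJ0 := (integrable_inner_of_memLp hu hgr).const_mul (-2)
  have hJ1 := hI1.const_mul (-(μ / 2))
  have hJf := hs.problem.integrable_gap hst.x
  have hJe := (integrable_norm_sq (memLp_avg hst.e)).const_mul (3 * L)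
  have h3 := integral_mono hJ0 ((hJ1.sub hJf).add hJe)
    (fun o => hs.problem.perturbed_descent (run F C Q γ α x0 h0 w0 ξ k o).x
      (avg (run F C Q γ α x0 h0 w0 ξ k o).e))
  rw [integral_add' (hJ1.sub hJf) hJe, integral_sub' hJ1 hJf, integral_const_mul,
    integral_const_mul, integral_const_mul] at h3
  have h4 := mul_le_mul_of_nonneg_left h3 hs.γ_pos.le
  linarith

end IsSetting

/-! ### The error bound and the rate -/

lemma F1_nonneg {L μ γ δ α p : ℝ} (hL : 0 < L) (hδ : 0 < δ) (hα : 0 < α)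
    (hη : eta γ μ α p < 1) : 0 ≤ F1 L μ γ δ α p := by
  have : 0 < 1 - eta γ μ α p := by linarith
  unfold F1
  positivity

lemma F2_nonneg {L μ γ δ α p : ℝ} (hL : 0 < L) (hδ : 0 < δ) (hα1 : α < 1) (hp : 0 < p)
    (hη : eta γ μ α p < 1) : 0 ≤ F2 L μ γ δ α p := by
  have : 0 < 1 - eta γ μ α p := by linarith
  have : 0 < 1 - α := by linarith
  unfold F2
  positivity

/-- One step of the Lyapunov function `‖x̃ - x*‖² + M₂ γ² σ₂²`. -/
lemma lyapunov_step {L μ γ α p r r' v v' f a : ℝ} (hL : 0 < L) (hγ : 0 < γ) (hp : 0 < p)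
    (hγL : γ ≤ 9 / (296 * L)) (hr : 0 ≤ r) (hv : 0 ≤ v) (hf : 0 ≤ f)
    (h1 : r' ≤ (1 - γ * μ / 2) * r - γ * f + 3 * L * γ * a + γ ^ 2 * (4 * L * f + 2 * v))
    (h2 : v' ≤ (1 - p) * v + 2 * (L * p) * f) :
    r' + (8 / (3 * p) + 32 / (9 * p)) * γ ^ 2 * v' ≤
      (1 - eta γ μ α p) * (r + (8 / (3 * p) + 32 / (9 * p)) * γ ^ 2 * v)
        - (γ / 2 * f - 3 * L * γ * a) := by
  have hM : 8 / (3 * p) + 32 / (9 * p) = 56 / 9 / p := by field_simp; norm_num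
  rw [hM]
  have hη1 : eta γ μ α p ≤ γ * μ / 2 := min_le_left _ _
  have hη2 : eta γ μ α p ≤ p / 4 := eta_le_p
  -- The weight `56/(9p)` turns the contraction of `σ₂²` into `-56/9 γ² v`. This covers the `2 γ² v`
  -- of the second moment and the `14/9 γ² v` lost because the potential is contracted only by `η ≤
  -- p/4`.
  have h3 := mul_le_mul_of_nonneg_left h2 (by positivity : 0 ≤ 56 / 9 / p * γ ^ 2)
  have e3 : 56 / 9 / p * γ ^ 2 * ((1 - p) * v + 2 * (L * p) * f) =
      56 / 9 / p * γ ^ 2 * v - 56 / 9 * γ ^ 2 * v + 112 / 9 * (γ ^ 2 * L * f) := by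
    field_simp; ring
  have h4 := mul_le_mul_of_nonneg_right hη1 hr
  have h5 := mul_le_mul_of_nonneg_right hη2 (by positivity : 0 ≤ 56 / 9 / p * γ ^ 2 * v)
  have e5 : p / 4 * (56 / 9 / p * γ ^ 2 * v) = 14 / 9 * (γ ^ 2 * v) := by field_simp; ring
  -- The gap terms of order `γ²` add up to `(4 + 112/9) γ² L f`, and `148/9 · 9/296 = 1/2`: the
  -- constant in the stepsize leaves exactly half of the decrease `γ f`.
  have h6 : γ * L ≤ 9 / 296 := by
    rw [le_div_iff₀ (by positivity)] at hγL
    linarith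
  have h7 := mul_le_mul_of_nonneg_right h6 (by positivity : 0 ≤ γ * f)
  have h8 : 0 ≤ γ ^ 2 * v := by positivity
  rw [e3] at h3
  rw [e5] at h5
  have e7 : γ * L * (γ * f) = γ ^ 2 * L * f := by ring
  rw [e7] at h7
  linarith

lemma loss_weightedAvg_le {d n m : ℕ} {F : Fin n → Fin m → Vec d → ℝ} {xs : Vec d} {L μ η : ℝ}
    (hF : IsProblem F xs L μ) (hη : η < 1) {Ω : Type*} (x : ℕ → Ω → Vec d) (K : ℕ) (o : Ω) :
    loss F (weightedAvg η x K o) - loss F xs ≤ (weightSum η K)⁻¹ *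
      ∑ k ∈ Finset.range (K + 1), weight η k * (loss F (x k o) - loss F xs) := by
  have hW := weightSum_pos hη K
  have h1 : ∑ k ∈ Finset.range (K + 1), (weightSum η K)⁻¹ * weight η k = 1 := by
    rw [← Finset.mul_sum]
    exact inv_mul_cancel₀ hW.ne'
  have h := hF.convex_loss.map_sum_le (t := Finset.range (K + 1))
    (w := fun k => (weightSum η K)⁻¹ * weight η k) (p := fun k => x k o)
    (fun k _ => mul_nonneg (inv_nonneg.2 hW.le) (weight_pos hη k).le) h1
    (fun _ _ => Set.mem_univ _)
  have e1 : weightedAvg η x K o =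
      ∑ k ∈ Finset.range (K + 1), ((weightSum η K)⁻¹ * weight η k) • x k o := by
    rw [weightedAvg, Finset.smul_sum]
    simp only [smul_smul]
  have e2 : (weightSum η K)⁻¹ *
      ∑ k ∈ Finset.range (K + 1), weight η k * (loss F (x k o) - loss F xs) =
      ∑ k ∈ Finset.range (K + 1), ((weightSum η K)⁻¹ * weight η k) • loss F (x k o)
        - loss F xs := by
    calc _ = ∑ k ∈ Finset.range (K + 1), (((weightSum η K)⁻¹ * weight η k) • loss F (x k o)
          - ((weightSum η K)⁻¹ * weight η k) * loss F xs) := by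
          rw [Finset.mul_sum]
          refine Finset.sum_congr rfl fun k _ => ?_
          rw [smul_eq_mul]
          ring
      _ = _ := by rw [Finset.sum_sub_distrib, ← Finset.sum_mul, h1, one_mul]
  rw [e1, e2]
  linarith

lemma eta_lt_one {γ μ α p : ℝ} (hp1 : p < 1) : eta γ μ α p < 1 := by
  have : eta γ μ α p ≤ p / 4 := eta_le_p
  linarith

namespace IsSetting

attribute [local irreducible] gHat gLoc gBar avg

variable {d n m : ℕ} {S T Ω : Type*} [MeasurableSpace S] [MeasurableSpace T] [MeasurableSpace Ω]
  {F : Fin n → Fin m → Vec d → ℝ} {xs : Vec d} {L μ : ℝ} {νC : Measure S} {νQ : Measure T}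
  {C : S → Vec d → Vec d} {Q : T → Vec d → Vec d} {δ ω γ α p : ℝ}
  {P : Measure Ω} {ξ : ℕ → Fin n → Ω → Noise m S T}

lemma initConst_nonneg (hs : IsSetting F xs L μ νC νQ C Q δ ω γ α p P ξ)
    (x0 : Vec d) (h0 w0 : Fin n → Vec d) :
    0 ≤ initConst L μ γ δ α p x0 xs (sigma1Sq F xs h0) (sigma2Sq F xs w0) := by
  have hη1 : eta γ μ α p < 1 := eta_lt_one hs.p_lt_one
  have := F1_nonneg (δ := δ) hs.problem.L_pos hs.δ_pos hs.α_pos hη1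
  have := F2_nonneg (δ := δ) hs.problem.L_pos hs.δ_pos hs.α_lt_one hs.p_pos hη1
  have := sigma1Sq_nonneg F xs h0
  have := sigma2Sq_nonneg F xs w0
  have := hs.γ_pos
  have := hs.p_pos
  unfold initConst T0
  positivity

variable [IsProbabilityMeasure νC] [IsProbabilityMeasure νQ] [IsProbabilityMeasure P]

lemma weighted_error_le_of_μ_le (hs : IsSetting F xs L μ νC νQ C Q δ ω γ α p P ξ)
    (hγm : γ ≤ gammaMax L δ α p) (hμL : μ ≤ L) (x0 : Vec d) (h0 w0 : Fin n → Vec d) (K : ℕ) :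
    3 * L * ∑ k ∈ Finset.range (K + 1), weight (eta γ μ α p) k *
        ∫ o, (1 / (n : ℝ)) * ∑ i, ‖(run F C Q γ α x0 h0 w0 ξ k o).e i‖ ^ 2 ∂P ≤
      1 / 4 * ∑ k ∈ Finset.range (K + 1), weight (eta γ μ α p) k *
        ∫ o, (loss F (run F C Q γ α x0 h0 w0 ξ k o).x - loss F xs) ∂P
      + F1 L μ γ δ α p * sigma1Sq F xs h0 + F2 L μ γ δ α p * sigma2Sq F xs w0 := by
  have hη1 : eta γ μ α p < 1 := eta_lt_one hs.p_lt_one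
  have hη0 := eta_nonneg (p := p) hs.γ_pos hs.problem.μ_nonneg hs.α_pos hs.p_pos
  have hηα : eta γ μ α p ≤ α / 4 := eta_le_α
  have hηp : eta γ μ α p ≤ p / 4 := eta_le_p
  have hα := hs.α_pos
  have hp := hs.p_pos
  have hδ := hs.δ_pos
  have hδ1 := hs.δ_le_one
  have hL := hs.problem.L_pos
  -- The minimum defining `η` does not contain `δ`; the comparison with the error contraction comes
  -- from `η ≤ γμ/2 ≤ γL/2` and `γL ≤ δ/4`.
  have hηδ : eta γ μ α p ≤ δ / 4 := by
    have h1 : eta γ μ α p ≤ γ * μ / 2 := min_le_left _ _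
    have h2 := gamma_mul_le hL hδ hs.α_lt_one hs.p_lt_one hs.γ_pos hγm
    have h3 := mul_le_mul_of_nonneg_left hμL hs.γ_pos.le
    linarith
  have hφ : ∀ k, 0 ≤ ∫ o, (loss F (run F C Q γ α x0 h0 w0 ξ k o).x - loss F xs) ∂P :=
    fun k => integral_nonneg fun o => hs.problem.gap_nonneg _
  have hv1 : ∀ k, 0 ≤ ∫ o, sigma1Sq F xs (run F C Q γ α x0 h0 w0 ξ k o).h ∂P :=
    fun k => integral_nonneg fun o => sigma1Sq_nonneg _ _ _
  have hv2 : ∀ k, 0 ≤ ∫ o, sigma2Sq F xs (run F C Q γ α x0 h0 w0 ξ k o).w ∂P :=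
    fun k => integral_nonneg fun o => sigma2Sq_nonneg _ _ _
  have ha : ∀ k, 0 ≤ ∫ o, (1 / (n : ℝ)) *
      ∑ i, ‖(run F C Q γ α x0 h0 w0 ξ k o).e i‖ ^ 2 ∂P :=
    fun k => integral_nonneg fun o => by positivity
  -- For a rate `ρ` with `η ≤ ρ/4` the choice `θ = 3ρ/4` works, as `1-ρ ≤ (1-3ρ/4)(1-ρ/4)`. For the
  -- errors the rate is `δ/2` and `θ = δ/4`, as `1-δ/2 ≤ (1-δ/4)²`.
  have H2 := weighted_sum_le_of_contraction (θ := 3 * p / 4) hη1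
    (by linarith [hs.p_lt_one]) (by nlinarith) hv2
    (fun k => mul_nonneg (by positivity) (hφ k)) (hs.integral_sigma2Sq_le x0 h0 w0) K
  have H1 := weighted_sum_le_of_contraction (θ := 3 * α / 4) hη1
    (by linarith [hs.α_lt_one]) (by nlinarith) hv1
    (fun k => add_nonneg (mul_nonneg (by positivity) (hφ k)) (mul_nonneg (by positivity) (hv2 k)))
    (hs.integral_sigma1Sq_le x0 h0 w0) K
  have HA := weighted_sum_le_of_contraction (θ := δ / 4) hη1 (by linarith) (by nlinarith) ha
    (fun k => mul_nonneg (sq_nonneg γ) (add_nonneg (add_nonneg (mul_nonneg (by positivity) (hφ k))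
      (mul_nonneg (by positivity) (hv1 k))) (mul_nonneg (by positivity) (hv2 k))))
    (hs.integral_error_le x0 h0 w0) K
  -- The errors start at zero, so the error recursion contributes no initial term.
  have e0 : ∫ o, (1 / (n : ℝ)) * ∑ i, ‖(run F C Q γ α x0 h0 w0 ξ 0 o).e i‖ ^ 2 ∂P = 0 := by
    simp [run]
  have e1 : ∫ o, sigma1Sq F xs (run F C Q γ α x0 h0 w0 ξ 0 o).h ∂P = sigma1Sq F xs h0 := by
    simp [run]
  have e2 : ∫ o, sigma2Sq F xs (run F C Q γ α x0 h0 w0 ξ 0 o).w ∂P = sigma2Sq F xs w0 := by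
    simp [run]
  have pull : ∀ (c : ℝ) (u : ℕ → ℝ), ∑ k ∈ Finset.range (K + 1), weight (eta γ μ α p) k * (c * u k)
      = c * ∑ k ∈ Finset.range (K + 1), weight (eta γ μ α p) k * u k := fun c u => by
    rw [Finset.mul_sum]
    exact Finset.sum_congr rfl fun k _ => by ring
  rw [e2, pull] at H2
  simp only [mul_add, Finset.sum_add_distrib] at H1 HA
  rw [e1, pull, pull] at H1
  rw [e0, pull, pull, pull, pull, pull, pull] at HA
  refine error_sum_arith hL hδ hs.γ_pos hs.problem.μ_nonneg hα hs.α_lt_one hp hs.p_lt_one hγm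
    (Finset.sum_nonneg fun k _ => mul_nonneg (weight_pos hη1 k).le (hφ k))
    (sigma1Sq_nonneg F xs h0) (sigma2Sq_nonneg F xs w0) H2
    (H1.trans (le_of_eq (by ring))) (HA.trans (le_of_eq (by ring)))

/-- The per-worker bound needs `μ ≤ L`, which holds once a nonzero vector exists. In dimension zero
`μ` may be arbitrarily large, but every error vanishes and the remaining terms are nonnegative. -/
lemma weighted_avg_error_le (hs : IsSetting F xs L μ νC νQ C Q δ ω γ α p P ξ)
    (hγm : γ ≤ gammaMax L δ α p) (x0 : Vec d) (h0 w0 : Fin n → Vec d) (K : ℕ) :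
    3 * L * ∑ k ∈ Finset.range (K + 1), weight (eta γ μ α p) k *
        ∫ o, ‖avg (run F C Q γ α x0 h0 w0 ξ k o).e‖ ^ 2 ∂P ≤
      1 / 4 * ∑ k ∈ Finset.range (K + 1), weight (eta γ μ α p) k *
        ∫ o, (loss F (run F C Q γ α x0 h0 w0 ξ k o).x - loss F xs) ∂P
      + F1 L μ γ δ α p * sigma1Sq F xs h0 + F2 L μ γ δ α p * sigma2Sq F xs w0 := by
  have hη1 : eta γ μ α p < 1 := eta_lt_one hs.p_lt_one
  have hL := hs.problem.L_pos
  by_cases hv : ∃ v : Vec d, v ≠ 0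
  · obtain ⟨v, hv⟩ := hv
    have hμL : μ ≤ L := by
      have h1 := hs.problem.quasi.mul_norm_sq_le hs.problem.smooth_loss v
      exact le_of_mul_le_mul_right h1 (by positivity)
    refine le_trans ?_ (hs.weighted_error_le_of_μ_le hγm hμL x0 h0 w0 K)
    refine mul_le_mul_of_nonneg_left (Finset.sum_le_sum fun k _ => ?_) (by positivity)
    refine mul_le_mul_of_nonneg_left ?_ (weight_pos hη1 k).le
    have hst := hs.sqIntegrable_run x0 h0 w0 k
    exact integral_mono (integrable_norm_sq (memLp_avg hst.e))
      (integrable_mean fun i => integrable_norm_sq (hst.e i))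
      fun o => norm_avg_sq_le hs.problem.one_le_n _
  · push Not at hv
    have h1 : ∀ k o, avg (run F C Q γ α x0 h0 w0 ξ k o).e = 0 := fun k o => hv _
    simp only [h1, norm_zero, ne_eq, OfNat.ofNat_ne_zero, not_false_eq_true, zero_pow,
      integral_zero, mul_zero, Finset.sum_const_zero]
    have h2 : 0 ≤ ∑ k ∈ Finset.range (K + 1), weight (eta γ μ α p) k *
        ∫ o, (loss F (run F C Q γ α x0 h0 w0 ξ k o).x - loss F xs) ∂P :=
      Finset.sum_nonneg fun k _ => mul_nonneg (weight_pos hη1 k).le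
        (integral_nonneg fun o => hs.problem.gap_nonneg _)
    have h3 := mul_nonneg (F1_nonneg (δ := δ) hL hs.δ_pos hs.α_pos hη1) (sigma1Sq_nonneg F xs h0)
    have h4 := mul_nonneg (F2_nonneg (δ := δ) hL hs.δ_pos hs.α_lt_one hs.p_pos hη1)
      (sigma2Sq_nonneg F xs w0)
    linarith

theorem errorSumBound (hs : IsSetting F xs L μ νC νQ C Q δ ω γ α p P ξ)
    (hγm : γ ≤ gammaMax L δ α p) (x0 : Vec d) (h0 w0 : Fin n → Vec d) :
    ErrorSumBound P (loss F) xs (fun k o => (run F C Q γ α x0 h0 w0 ξ k o).x)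
      (fun k o => avg (run F C Q γ α x0 h0 w0 ξ k o).e)
      (fun k o => sigma1Sq F xs (run F C Q γ α x0 h0 w0 ξ k o).h)
      (fun k o => sigma2Sq F xs (run F C Q γ α x0 h0 w0 ξ k o).w) L μ γ (params L μ γ δ α p) := by
  have hη1 : eta γ μ α p < 1 := eta_lt_one hs.p_lt_one
  have hL := hs.problem.L_pos
  refine ⟨F1_nonneg hL hs.δ_pos hs.α_pos hη1, F2_nonneg hL hs.δ_pos hs.α_lt_one hs.p_pos hη1,
    fun k => memLp_avg (hs.sqIntegrable_run x0 h0 w0 k).e, fun K => ?_⟩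
  have h := hs.weighted_avg_error_le hγm x0 h0 w0 K
  have e1 : ∫ o, sigma1Sq F xs (run F C Q γ α x0 h0 w0 ξ 0 o).h ∂P = sigma1Sq F xs h0 := by
    simp [run]
  have e2 : ∫ o, sigma2Sq F xs (run F C Q γ α x0 h0 w0 ξ 0 o).w ∂P = sigma2Sq F xs w0 := by
    simp [run]
  simp only [e1, e2]
  simpa [params] using h

lemma weighted_gap_le (hs : IsSetting F xs L μ νC νQ C Q δ ω γ α p P ξ)
    (hγm : γ ≤ gammaMax L δ α p) (x0 : Vec d) (h0 w0 : Fin n → Vec d) (K : ℕ) :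
    ∑ k ∈ Finset.range (K + 1), weight (eta γ μ α p) k *
        ∫ o, (loss F (run F C Q γ α x0 h0 w0 ξ k o).x - loss F xs) ∂P ≤
      initConst L μ γ δ α p x0 xs (sigma1Sq F xs h0) (sigma2Sq F xs w0) := by
  have hη1 : eta γ μ α p < 1 := eta_lt_one hs.p_lt_one
  have hγ := hs.γ_pos
  have hp := hs.p_pos
  have hr : ∀ k, 0 ≤ ∫ o, ‖(run F C Q γ α x0 h0 w0 ξ k o).x
      - avg (run F C Q γ α x0 h0 w0 ξ k o).e - xs‖ ^ 2 ∂P :=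
    fun k => integral_nonneg fun o => by positivity
  have hφ : ∀ k, 0 ≤ ∫ o, (loss F (run F C Q γ α x0 h0 w0 ξ k o).x - loss F xs) ∂P :=
    fun k => integral_nonneg fun o => hs.problem.gap_nonneg _
  have hv2 : ∀ k, 0 ≤ ∫ o, sigma2Sq F xs (run F C Q γ α x0 h0 w0 ξ k o).w ∂P :=
    fun k => integral_nonneg fun o => sigma2Sq_nonneg _ _ _
  have h1 := weighted_sum_le_of_descent hη1
    (fun k => add_nonneg (hr k) (mul_nonneg (by positivity) (hv2 k)))
    (fun k => lyapunov_step (α := α) hs.problem.L_pos hγ hp (hγm.trans (min_le_left _ _)) (hr k)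
      (hv2 k) (hφ k) (hs.integral_perturbed_le x0 h0 w0 k) (hs.integral_sigma2Sq_le x0 h0 w0 k)) K
  have h2 := hs.weighted_avg_error_le hγm x0 h0 w0 K
  have e1 : ∫ o, ‖(run F C Q γ α x0 h0 w0 ξ 0 o).x
      - avg (run F C Q γ α x0 h0 w0 ξ 0 o).e - xs‖ ^ 2 ∂P = ‖x0 - xs‖ ^ 2 := by
    simp [run, avg_const hs.problem.one_le_n]
  have e2 : ∫ o, sigma2Sq F xs (run F C Q γ α x0 h0 w0 ξ 0 o).w ∂P = sigma2Sq F xs w0 := by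
    simp [run]
  have pull : ∀ (c : ℝ) (u : ℕ → ℝ), ∑ k ∈ Finset.range (K + 1), weight (eta γ μ α p) k * (c * u k)
      = c * ∑ k ∈ Finset.range (K + 1), weight (eta γ μ α p) k * u k := fun c u => by
    rw [Finset.mul_sum]
    exact Finset.sum_congr rfl fun k _ => by ring
  simp only [mul_sub, Finset.sum_sub_distrib] at h1
  rw [e1, e2, pull, pull] at h1
  -- The error bound uses `γ/4` of the `γ/2` in front of the gaps; the remaining `γ/4` is the factor
  -- `4/γ` in `initConst`.
  have h3 := mul_le_mul_of_nonneg_left h2 hγ.le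
  rw [initConst, le_div_iff₀ hγ, T0]
  linarith

lemma memLp_weightedAvg (hs : IsSetting F xs L μ νC νQ C Q δ ω γ α p P ξ)
    (η : ℝ) (x0 : Vec d) (h0 w0 : Fin n → Vec d) (K : ℕ) :
    MemLp (weightedAvg η (fun k o => (run F C Q γ α x0 h0 w0 ξ k o).x) K) 2 P :=
  (memLp_finsetSum _ fun k _ =>
    ((hs.sqIntegrable_run x0 h0 w0 k).x.const_smul (weight η k))).const_smul (weightSum η K)⁻¹

lemma integral_gap_weightedAvg_le (hs : IsSetting F xs L μ νC νQ C Q δ ω γ α p P ξ)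
    (hγm : γ ≤ gammaMax L δ α p) (x0 : Vec d) (h0 w0 : Fin n → Vec d) (K : ℕ) :
    ∫ o, (loss F (weightedAvg (eta γ μ α p)
        (fun k o => (run F C Q γ α x0 h0 w0 ξ k o).x) K o) - loss F xs) ∂P ≤
      (weightSum (eta γ μ α p) K)⁻¹ *
        initConst L μ γ δ α p x0 xs (sigma1Sq F xs h0) (sigma2Sq F xs w0) := by
  have hη1 : eta γ μ α p < 1 := eta_lt_one hs.p_lt_one
  have hI : ∀ k, Integrable (fun o => weight (eta γ μ α p) k *
      (loss F (run F C Q γ α x0 h0 w0 ξ k o).x - loss F xs)) P := fun k =>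
    (hs.problem.integrable_gap (hs.sqIntegrable_run x0 h0 w0 k).x).const_mul _
  have h1 := integral_mono
    (hs.problem.integrable_gap (hs.memLp_weightedAvg (eta γ μ α p) x0 h0 w0 K))
    ((integrable_finsetSum (Finset.range (K + 1)) fun k _ => hI k).const_mul
      (weightSum (eta γ μ α p) K)⁻¹)
    (fun o => loss_weightedAvg_le hs.problem hη1 _ K o)
  refine h1.trans ?_
  rw [integral_const_mul, integral_finsetSum _ fun k _ => hI k]
  simp only [integral_const_mul]
  exact mul_le_mul_of_nonneg_left (hs.weighted_gap_le hγm x0 h0 w0 K)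
    (inv_nonneg.2 (weightSum_pos hη1 K).le)

theorem linear_rate (hs : IsSetting F xs L μ νC νQ C Q δ ω γ α p P ξ)
    (hγm : γ ≤ gammaMax L δ α p) (x0 : Vec d) (h0 w0 : Fin n → Vec d) (K : ℕ) :
    ∫ o, (loss F (weightedAvg (eta γ μ α p)
        (fun k o => (run F C Q γ α x0 h0 w0 ξ k o).x) K o) - loss F xs) ∂P ≤
      (1 - eta γ μ α p) ^ K *
        initConst L μ γ δ α p x0 xs (sigma1Sq F xs h0) (sigma2Sq F xs w0) := by
  have hη1 : eta γ μ α p < 1 := eta_lt_one hs.p_lt_one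
  have hη0 := eta_nonneg (p := p) hs.γ_pos hs.problem.μ_nonneg hs.α_pos hs.p_pos
  refine (hs.integral_gap_weightedAvg_le hγm x0 h0 w0 K).trans
    (mul_le_mul_of_nonneg_right ?_ (hs.initConst_nonneg x0 h0 w0))
  -- The last weight alone gives `W_K ≥ (1-η)^(-(K+1))`; one surplus factor `1-η` is dropped at the
  -- end.
  have h1 : weight (eta γ μ α p) K ≤ weightSum (eta γ μ α p) K :=
    Finset.single_le_sum (f := weight (eta γ μ α p)) (fun k _ => (weight_pos hη1 k).le)
      (Finset.self_mem_range_succ K)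
  have h2 := inv_anti₀ (weight_pos hη1 K) h1
  rw [weight, inv_inv] at h2
  exact h2.trans (pow_le_pow_of_le_one (by linarith) (by linarith) K.le_succ)

theorem sublinear_rate (hs : IsSetting F xs L μ νC νQ C Q δ ω γ α p P ξ)
    (hγm : γ ≤ gammaMax L δ α p) (hμ : μ = 0) (x0 : Vec d) (h0 w0 : Fin n → Vec d) (K : ℕ)
    (hK : 1 ≤ K) :
    ∫ o, (loss F (weightedAvg (eta γ μ α p)
        (fun k o => (run F C Q γ α x0 h0 w0 ξ k o).x) K o) - loss F xs) ∂P ≤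
      initConst L μ γ δ α p x0 xs (sigma1Sq F xs h0) (sigma2Sq F xs w0) / K := by
  have hη : eta γ μ α p = 0 := by
    have := hs.α_pos
    have := hs.p_pos
    rw [eta, hμ, mul_zero, zero_div]
    exact min_eq_left (le_min (by positivity) (by positivity))
  have hW : weightSum (eta γ μ α p) K = K + 1 := by simp [weightSum, weight, hη]
  have h := hs.integral_gap_weightedAvg_le hγm x0 h0 w0 K
  have hK' : (0 : ℝ) < K := by positivity
  refine h.trans ?_
  rw [hW, div_eq_inv_mul]
  refine mul_le_mul_of_nonneg_right ?_ (hs.initConst_nonneg x0 h0 w0)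
  exact inv_anti₀ hK' (by linarith)

end IsSetting

/-! ### The iteration complexity -/

lemma pow_mul_le_of_log_le {η C0 ε : ℝ} (hη1 : η < 1) (hC : 0 ≤ C0) (hε : 0 < ε)
    {K : ℕ} (hK : Real.log (C0 / ε) ≤ η * K) : (1 - η) ^ K * C0 ≤ ε := by
  rcases hC.eq_or_lt with rfl | hC
  · simpa using hε.le
  have h1 : (1 - η) ^ K ≤ Real.exp (-(η * K)) := by
    have h2 : 1 - η ≤ Real.exp (-η) := by linarith [Real.add_one_le_exp (-η)]
    calc (1 - η) ^ K ≤ Real.exp (-η) ^ K := pow_le_pow_left₀ (by linarith) h2 K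
      _ = Real.exp (-(η * K)) := by rw [← Real.exp_nat_mul]; congr 1; ring
  have h3 : Real.exp (-(η * K)) ≤ (C0 / ε)⁻¹ := by
    rw [← Real.exp_log (by positivity : 0 < C0 / ε), ← Real.exp_neg]
    exact Real.exp_le_exp.2 (by linarith)
  calc (1 - η) ^ K * C0 ≤ (C0 / ε)⁻¹ * C0 := mul_le_mul_of_nonneg_right (h1.trans h3) hC.le
    _ = ε := by field_simp

/-- With `α, p ≤ 1/2` both `1/(1-α)` and `1/(1-p)` are at most `2`, so `stepConst ≤ 7 + 4·11·7 + 12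
= 327`. Then `6·327 ≤ 45²` and `4·45 = 180`. -/
lemma inv_gammaMax_le {L δ α p : ℝ} (hL : 0 < L) (hδ : 0 < δ) (hδ1 : δ ≤ 1) (hα : α ≤ 1 / 2)
    (hp : p ≤ 1 / 2) : δ / (180 * L) ≤ gammaMax L δ α p := by
  have hX := four_le_stepConst hδ (by linarith : α < 1) (by linarith : p < 1)
  have ha : 1 / (1 - α) ≤ 2 := by
    rw [div_le_iff₀ (by linarith)]; linarith
  have hb : 1 / (1 - p) ≤ 2 := by
    rw [div_le_iff₀ (by linarith)]; linarith
  have ha0 : 0 < 1 / (1 - α) := by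
    have : 0 < 1 - α := by linarith
    positivity
  have hb0 : 0 < 1 / (1 - p) := by
    have : 0 < 1 - p := by linarith
    positivity
  have hX2 : stepConst δ α p ≤ 327 := by
    have e : stepConst δ α p = 4 + 3 * δ
        + 2 * (1 / (1 - α)) * (3 + 4 * (1 / (1 - p))) * (4 + 3 * δ) + 6 * δ * (1 / (1 - p)) := by
      rw [stepConst]; ring
    rw [e]
    calc _ ≤ 4 + 3 * (1 : ℝ) + 2 * 2 * (3 + 4 * 2) * (4 + 3 * 1) + 6 * 1 * 2 := by gcongr
      _ = 327 := by norm_num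
  refine le_min ?_ ?_
  · rw [div_le_div_iff₀ (by positivity) (by positivity)]
    nlinarith
  · have h1 : √(6 * stepConst δ α p) ≤ 45 := by
      rw [Real.sqrt_le_left (by norm_num)]
      linarith
    have h0 : 0 < √(6 * stepConst δ α p) := Real.sqrt_pos.2 (by linarith)
    refine div_le_div_of_nonneg_left hδ.le (by positivity) ?_
    have := mul_le_mul_of_nonneg_left h1 (by positivity : 0 ≤ 4 * L)
    change 4 * L * √(6 * stepConst δ α p) ≤ 180 * L
    linarith

/-- With the recommended parameters, `1/η = O(ω + m + κ/δ)`. -/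
lemma one_le_eta_mul {L μ δ ω α p γ : ℝ} {m : ℕ} (hL : 0 < L) (hμ : 0 < μ) (hδ : 0 < δ)
    (hδ1 : δ ≤ 1) (hω : 0 ≤ ω) (hm : 2 ≤ m) (hp : p = 1 / (m : ℝ))
    (hα : α = min (1 / (ω + 1)) (1 / 2)) (hγ : γ = gammaMax L δ α p) :
    1 ≤ eta γ μ α p * (360 * (ω + m + L / μ / δ)) := by
  have hm' : (2 : ℝ) ≤ m := by exact_mod_cast hm
  have hκ : 0 < L / μ / δ := by positivity
  set R := ω + m + L / μ / δ with hR
  have hR0 : 0 < R := by positivity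
  have hα2 : α ≤ 1 / 2 := hα ▸ min_le_right _ _
  have hp2 : p ≤ 1 / 2 := by
    rw [hp]
    exact one_div_le_one_div_of_le (by norm_num) hm'
  have hγ' : δ / (180 * L) ≤ γ := hγ ▸ inv_gammaMax_le hL hδ hδ1 hα2 hp2
  have h1 : 1 / (360 * R) ≤ eta γ μ α p := by
    refine le_min ?_ (le_min ?_ ?_)
    -- The constant `360` is `2·180`: the `180` comes from the stepsize and the `2` from `γμ/2`.
    · calc 1 / (360 * R) ≤ 1 / (360 * (L / μ / δ)) := by
            gcongr
            rw [hR]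
            linarith
        _ = δ / (180 * L) * μ / 2 := by field_simp; norm_num
        _ ≤ γ * μ / 2 := by gcongr
    · have h2 : 1 / R ≤ α := by
        rw [hα]
        -- Since `2 ≤ m`, `R` is at least `ω + 1` and at least `2`.
        refine le_min ?_ ?_
        · exact one_div_le_one_div_of_le (by positivity) (by rw [hR]; linarith)
        · exact one_div_le_one_div_of_le (by positivity) (by rw [hR]; linarith)
      calc 1 / (360 * R) ≤ 1 / (4 * R) := by gcongr; norm_num
        _ = 1 / R / 4 := by field_simp
        _ ≤ α / 4 := by gcongr
    · have h2 : 1 / R ≤ p := by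
        rw [hp]
        exact one_div_le_one_div_of_le (by positivity) (by rw [hR]; linarith)
      calc 1 / (360 * R) ≤ 1 / (4 * R) := by gcongr; norm_num
        _ = 1 / R / 4 := by field_simp
        _ ≤ p / 4 := by gcongr
  rwa [div_le_iff₀ (by positivity)] at h1

/-- The iteration complexity implied by a linear rate `η` with `1/η ≤ 360 R`. -/
lemma complexity_of_linear_rate {η C0 R : ℝ} {E : ℕ → ℝ} (hη0 : 0 ≤ η) (hη1 : η < 1) (hC : 0 ≤ C0)
    (hR : 1 ≤ η * (360 * R)) (hE : ∀ K, E K ≤ (1 - η) ^ K * C0) :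
    (∀ ε : ℝ, 0 < ε → ∀ K : ℕ, 720 * R * Real.log (C0 / ε) ≤ K → E K ≤ ε) ∧
    (∃ ε₀ : ℝ, 0 < ε₀ ∧ ∀ ε : ℝ, 0 < ε → ε ≤ ε₀ → ∀ K : ℕ,
      720 * R * Real.log (1 / ε) ≤ K → E K ≤ ε) := by
  have hη : 0 < η := by
    rcases hη0.eq_or_lt with h | h
    · rw [← h] at hR; linarith
    · exact h
  have hR0 : 0 < R := by
    by_contra hneg
    push Not at hneg
    nlinarith
  -- A factor `360` suffices for the bound with `C0 / ε`. If that logarithm is not positive, no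
  -- condition on `K` is needed.
  have key : ∀ ε : ℝ, 0 < ε → ∀ K : ℕ, 360 * R * Real.log (C0 / ε) ≤ K → E K ≤ ε := by
    intro ε hε K hK
    refine (hE K).trans ?_
    rcases le_total (Real.log (C0 / ε)) 0 with hneg | hpos
    · exact pow_mul_le_of_log_le hη1 hC hε (hneg.trans (by positivity))
    · refine pow_mul_le_of_log_le hη1 hC hε ?_
      have h1 := mul_le_mul_of_nonneg_right hR hpos
      have h2 := mul_le_mul_of_nonneg_left hK hη.le
      linarith
  -- The threshold `1` makes `log (1/ε)` nonnegative, and `1/(C0+1)` gives `C0 ≤ 1/ε`. Then `log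
  -- (C0/ε) ≤ 2 log (1/ε)`, which doubles `360` to `720`.
  refine ⟨fun ε hε K hK => ?_, min 1 (1 / (C0 + 1)), by positivity, fun ε hε hε0 K hK => ?_⟩
  · refine key ε hε K ?_
    rcases le_total (Real.log (C0 / ε)) 0 with hneg | hpos
    · have : 360 * R * Real.log (C0 / ε) ≤ 0 := mul_nonpos_of_nonneg_of_nonpos (by positivity) hneg
      exact this.trans (by positivity)
    · have : 0 ≤ R * Real.log (C0 / ε) := by positivity
      linarith
  · refine key ε hε K (le_trans ?_ hK)
    have h1 : ε ≤ 1 / (C0 + 1) := hε0.trans (min_le_right _ _)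
    have h2 : C0 ≤ 1 / ε := by
      rw [le_div_iff₀ (by positivity)] at h1 ⊢
      nlinarith
    have h0 : 0 ≤ Real.log (1 / ε) :=
      Real.log_nonneg (by rw [le_div_iff₀ hε]; linarith [hε0.trans (min_le_left _ _)])
    have h3 : Real.log (C0 / ε) ≤ 2 * Real.log (1 / ε) := by
      rcases hC.eq_or_lt with h | h
      -- For `C0 = 0` the convention `Real.log 0 = 0` makes the left side zero.
      · rw [← h]
        simp only [zero_div, Real.log_zero]
        positivity
      · have e : 2 * Real.log (1 / ε) = Real.log (1 / ε * (1 / ε)) := by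
          rw [Real.log_mul (by positivity) (by positivity)]; ring
        rw [e]
        refine Real.log_le_log (by positivity) ?_
        rw [div_eq_mul_one_div]
        gcongr
    have := mul_le_mul_of_nonneg_left h3 (by positivity : 0 ≤ 360 * R)
    linarith

end ECLSVRGDiana

end

open ECLSVRGDiana in
theorem mainTheorem5 :
    ∃ c : ℝ, 0 < c ∧
    ∀ (d n m : ℕ) (_ : 1 ≤ n) (_ : 1 ≤ m)
      -- the objective
      (F : Fin n → Fin m → Vec d → ℝ) (xs : Vec d) (L μ : ℝ) (_ : 0 < L) (_ : 0 ≤ μ)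
      (_ : ∀ i j, ConvexOn ℝ Set.univ (F i j)) (_ : ∀ i j, IsLSmooth L (F i j))
      (_ : IsQuasiStronglyConvex μ (loss F) xs)
      -- the compressor and the quantizer
      (S T : Type*) [MeasurableSpace S] [MeasurableSpace T]
      (νC : Measure S) (νQ : Measure T) [IsProbabilityMeasure νC] [IsProbabilityMeasure νQ]
      (C : S → Vec d → Vec d) (Q : T → Vec d → Vec d) (δ ω : ℝ)
      (_ : 0 < δ) (_ : δ ≤ 1) (_ : 0 ≤ ω) (_ : IsCompressor νC δ C) (_ : IsQuantizer νQ ω Q)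
      -- the parameters of the method
      (γ α p : ℝ) (_ : 0 < α) (_ : α < 1) (_ : α ≤ 1 / (ω + 1)) (_ : 0 < p) (_ : p < 1)
      (_ : 0 < γ) (_ : γ ≤ gammaMax L δ α p)
      (x0 : Vec d) (h0 w0 : Fin n → Vec d)
      -- the randomness
      (Ω : Type*) [MeasurableSpace Ω] (P : Measure Ω) [IsProbabilityMeasure P]
      (ξ : ℕ → Fin n → Ω → Noise m S T) (_ : IsNoise P p νC νQ ξ),
      let f : Vec d → ℝ := loss F
      let st : ℕ → Ω → State d n := run F C Q γ α x0 h0 w0 ξ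
      let x : ℕ → Ω → Vec d := fun k o => (st k o).x
      let e : ℕ → Ω → Vec d := fun k o => avg (st k o).e
      let g : ℕ → Fin n → Ω → Vec d := fun k i o => gLoc F (st k o) i (ξ k i o).1
      let s1 : ℕ → Ω → ℝ := fun k o => sigma1Sq F xs (st k o).h
      let s2 : ℕ → Ω → ℝ := fun k o => sigma2Sq F xs (st k o).w
      let xbar : ℕ → Ω → Vec d := weightedAvg (eta γ μ α p) x
      let C0 : ℝ := initConst L μ γ δ α p x0 xs (sigma1Sq F xs h0) (sigma2Sq F xs w0)
      ParametricAssumption P (history ξ) f xs x g s1 s2 (params L μ γ δ α p) ∧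
      ErrorSumBound P f xs x e s1 s2 L μ γ (params L μ γ δ α p) ∧
      (∀ K : ℕ, Integrable (fun o => f (xbar K o) - f xs) P) ∧
      (0 < μ → ∀ K : ℕ, ∫ o, (f (xbar K o) - f xs) ∂P ≤ (1 - eta γ μ α p) ^ K * C0) ∧
      (μ = 0 → ∀ K : ℕ, 1 ≤ K → ∫ o, (f (xbar K o) - f xs) ∂P ≤ C0 / K) ∧
      (0 < μ → 2 ≤ m → p = 1 / (m : ℝ) → α = min (1 / (ω + 1)) (1 / 2) → γ = gammaMax L δ α p →
        (∀ ε : ℝ, 0 < ε → ∀ K : ℕ,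
          c * (ω + m + (L / μ) / δ) * Real.log (C0 / ε) ≤ K →
            ∫ o, (f (xbar K o) - f xs) ∂P ≤ ε) ∧
        (∃ ε₀ : ℝ, 0 < ε₀ ∧ ∀ ε : ℝ, 0 < ε → ε ≤ ε₀ → ∀ K : ℕ,
          c * (ω + m + (L / μ) / δ) * Real.log (1 / ε) ≤ K →
            ∫ o, (f (xbar K o) - f xs) ∂P ≤ ε)) := by
  refine ⟨720, by norm_num, ?_⟩
  intro d n m hn hm F xs L μ hL hμ hconv hsm hq S T _ _ νC νQ _ _ C Q δ ω hδ hδ1 hω hC hQ γ α p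
    hα hα1 hαω hp hp1 hγ hγm x0 h0 w0 Ω _ P _ ξ hξ
  have hs : IsSetting F xs L μ νC νQ C Q δ ω γ α p P ξ :=
    ⟨⟨hn, hm, hL, hμ, hconv, hsm, hq⟩, hδ, hδ1, hC, hQ, hγ, hα, hα1,
      (le_div_iff₀ (by linarith)).1 hαω, hp, hp1, hξ⟩
  refine ⟨hs.parametricAssumption x0 h0 w0, hs.errorSumBound hγm x0 h0 w0,
    fun K => hs.problem.integrable_gap (hs.memLp_weightedAvg _ x0 h0 w0 K),
    fun _ K => hs.linear_rate hγm x0 h0 w0 K,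
    fun hμ0 K hK => hs.sublinear_rate hγm hμ0 x0 h0 w0 K hK,
    fun hμ0 hm2 hpm hαe hγe => ?_⟩
  exact complexity_of_linear_rate (eta_nonneg hγ hμ hα hp) (eta_lt_one hp1)
    (hs.initConst_nonneg x0 h0 w0) (one_le_eta_mul hL hμ0 hδ hδ1 hω hm2 hpm hαe hγe)
    (hs.linear_rate hγm x0 h0 w0)
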